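/- Let $T>0$ and let $f\colon[0,T]\times\mathbb{R}^n\to\mathbb{R}$. Write $\nabla_x f$ and $\nabla_x^2 f$ for the gradient and the Hessian matrix of $f$ with respect to $x$, $f_t$ for its time derivative, and $$Z_f=\{(t,\xi)\in[0,T]\times\mathbb{R}^n:\ \nabla_x f(t,\xi)=0,\ \det\nabla_x^2 f(t,\xi)=0\}.$$ Assume: 1. $f$ is of class $C^3$ and there are $a_0\ge 0$, $c_0>0$ with $\nabla_x f(t,x)\cdot x\ge c_0|x|^2-a_0$ for all $(t,x)\in[0,T]\times\mathbb{R}^n$. 2. $Z_f$ is finite, the projection $(t,\xi)\mapsto t$ is injective on $Z_f$, and no point of $Z_f$ has $t=0$ or $t=T$. 3. For every $(\tau,\xi)\in Z_f$ with $\nabla_x^2 f(\tau,\xi)$ positive semidefinite there is $\ell\in\mathbb{R}^n\setminus\{0\}$ such that (a) $\ker\nabla_x^2 f(\tau,\xi)=\mathrm{span}(\ell)$; (b) $\nabla_x f_t(\tau,\xi)\cdot\ell\ne 0$; (c) $\sum_{i,j,k}f_{x_ix_jx_k}(\tau,\xi)\,\ell_i\ell_j\ell_k\neq 0$. 4. For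 every $(\tau,\xi)\in Z_f$ with $\nabla_x^2 f(\tau,\xi)$ positive semidefinite and satisfying (a) and (c) for some $\ell\neq0$: if $w\colon\mathbb{R}\to\mathbb{R}^n$ is a solution of $\dot w(s)=-\nabla_x f(\tau,w(s))$, not identically equal to $\xi$, with $w(s)\to\xi$ as $s\to-\infty$ and $w(s)\to w_\infty$ as $s\to+\infty$, then $\nabla_x^2 f(\tau,w_\infty)$ is positive definite. Let $y_0\in\mathbb{R}^n$ be such that $\nabla_x f(0,y_0)=0$ and $\nabla_x^2 f(0,y_0)$ is positive definite. Then there exist a unique $k\geq 1$, a unique finite family of times $0=t_0<t_1<\dots<t_k=T$, a unique family of functions $u_i\colon[t_{i-1},t_i[\to\mathbb{R}^n$ of class $C^2$, $i=1,\dots,k$, and a unique (each up to a time translation) family of functions $v_i\colon\mathbb{R}\to\mathbb{R}^n$ of class $C^2$, $i=1,\dots,k-1$, such that all of the following hold: (1) $u_1(0)=y_0$; (2) for every $i=1,\dots,k$ and $t\in[t_{i-1},t_i[$, $\nabla_x f(t,u_i(t))=0$ and $\nabla_x^2 f(t,u_i(t))$ is positive definite; (3) for every $i=1,\dots,k$ the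 limit $x_i:=\lim_{t\to t_i^-}u_i(t)$ exists, and for every $i=1,\dots,k-1$, $(t_i,x_i)\in Z_f$, $\nabla_x^2 f(t_i,x_i)$ is positive semidefinite, and, for $\ell$ spanning its (one-dimensional) kernel, the numbers $\nabla_x f_t(t_i,x_i)\cdot\ell$ and $\sum_{j,l,m}f_{x_jx_lx_m}(t_i,x_i)\,\ell_j\ell_l\ell_m$ are nonzero and have the same sign; (4) for every $i=1,\dots,k-1$, $\dot v_i(s)=-\nabla_x f(t_i,v_i(s))$ for all $s\in\mathbb{R}$, $\lim_{s\to-\infty}v_i(s)=x_i$ and $\lim_{s\to+\infty}v_i(s)=u_{i+1}(t_i)$. -/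

import Mathlib

open Set Filter Topology

noncomputable section

namespace GradFlow

/-- `ℝⁿ` with the Euclidean norm. -/
abbrev Rn (n : ℕ) : Type := EuclideanSpace ℝ (Fin n)

variable {n : ℕ}

/-- The partial derivative `g_{x_i}` of a function on `ℝⁿ`. -/
def pderiv (i : Fin n) (g : Rn n → ℝ) (x : Rn n) : ℝ :=
  fderiv ℝ g x (EuclideanSpace.single i 1)

/-- The Hessian matrix `(g_{x_i x_j}(x))_{ij}`. -/
def hessian (g : Rn n → ℝ) (x : Rn n) : Matrix (Fin n) (Fin n) ℝ :=
  Matrix.of fun i j => pderiv j (pderiv i g) x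

/-- The cubic form `∑_{i,j,k} g_{x_i x_j x_k}(x) ℓ_i ℓ_j ℓ_k`. -/
def cubicForm (g : Rn n → ℝ) (x ℓ : Rn n) : ℝ :=
  ∑ i, ∑ j, ∑ k, pderiv k (pderiv j (pderiv i g)) x * ℓ i * ℓ j * ℓ k

/-- The time derivative `f_t(t, x)` of `f : [0, T] × ℝⁿ → ℝ` (one-sided at `t = 0` and `t = T`). -/
def timeDeriv (T : ℝ) (f : ℝ → Rn n → ℝ) (t : ℝ) (x : Rn n) : ℝ :=
  derivWithin (fun s => f s x) (Icc 0 T) t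

/-- The quantity `∇_x f_t(t, x) · ℓ`. -/
def mixedForm (T : ℝ) (f : ℝ → Rn n → ℝ) (t : ℝ) (x ℓ : Rn n) : ℝ :=
  inner ℝ (gradient (timeDeriv T f t) x) ℓ

/-- The set of pairs `(t, x)` in `[0, T] × ℝⁿ` such that `x` is a critical point of `f(t, ·)`. -/
def criticalSet (T : ℝ) (f : ℝ → Rn n → ℝ) : Set (ℝ × Rn n) :=
  {p | p.1 ∈ Icc 0 T ∧ gradient (f p.1) p.2 = 0}

/-- The set of pairs `(t, ξ)` such that `ξ` is a degenerate critical point of `f(t, ·)`. -/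
def degenerateSet (T : ℝ) (f : ℝ → Rn n → ℝ) : Set (ℝ × Rn n) :=
  {p | p ∈ criticalSet T f ∧ (hessian (f p.1) p.2).det = 0}

/-- `ℓ` is nonzero and spans the kernel of the Hessian matrix of `g` at `x`. -/
def SpansKernel (g : Rn n → ℝ) (x ℓ : Rn n) : Prop :=
  ℓ ≠ 0 ∧ LinearMap.ker (Matrix.toEuclideanLin (hessian g x)) = Submodule.span ℝ {ℓ}

/-- `w : ℝ → ℝⁿ` solves the autonomous gradient flow `w' = -∇g(w)` on the whole line. -/
def IsGradientFlow (g : Rn n → ℝ) (w : ℝ → Rn n) : Prop :=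
  ∀ s, HasDerivAt w (-gradient g (w s)) s

/-- Regularity and coercivity: `f` is `C³` on `[0, T] × ℝⁿ` and
`∇_x f(t, x) · x ≥ c₀ |x|² - a₀` for some `c₀ > 0`, `a₀ ≥ 0`. -/
def SmoothCoercive (T : ℝ) (f : ℝ → Rn n → ℝ) : Prop :=
  ContDiffOn ℝ 3 (Function.uncurry f) (Icc 0 T ×ˢ univ) ∧
  ∃ a₀ c₀ : ℝ, 0 ≤ a₀ ∧ 0 < c₀ ∧
    ∀ t ∈ Icc 0 T, ∀ x : Rn n, c₀ * ‖x‖ ^ 2 - a₀ ≤ inner ℝ (gradient (f t) x) x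

/-- There are finitely many degenerate critical pairs, at most one at each time, and none at the
times `0` and `T`. -/
def FinitelyDegenerate (T : ℝ) (f : ℝ → Rn n → ℝ) : Prop :=
  (degenerateSet T f).Finite ∧
  InjOn Prod.fst (degenerateSet T f) ∧
  0 ∉ Prod.fst '' degenerateSet T f ∧ T ∉ Prod.fst '' degenerateSet T f

/-- At each degenerate critical point with positive semidefinite Hessian, the kernel of the Hessian
is a line and the two transversality conditions hold. -/
def Transversal (T : ℝ) (f : ℝ → Rn n → ℝ) : Prop :=
  ∀ τ ξ, (τ, ξ) ∈ degenerateSet T f → (hessian (f τ) ξ).PosSemidef →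
    ∃ ℓ, SpansKernel (f τ) ξ ℓ ∧ mixedForm T f τ ξ ℓ ≠ 0 ∧ cubicForm (f τ) ξ ℓ ≠ 0

/-- Every heteroclinic orbit issuing from a degenerate critical point with positive semidefinite
Hessian, one-dimensional kernel and nonzero cubic term ends at a point with positive definite
Hessian. The stationary solution `w ≡ ξ` is not a heteroclinic orbit. -/
def HeteroclinicEndsNondegenerate (T : ℝ) (f : ℝ → Rn n → ℝ) : Prop :=
  ∀ τ ξ, (τ, ξ) ∈ degenerateSet T f → (hessian (f τ) ξ).PosSemidef →
    (∃ ℓ, SpansKernel (f τ) ξ ℓ ∧ cubicForm (f τ) ξ ℓ ≠ 0) →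
    ∀ (w : ℝ → Rn n) (w_inf : Rn n), IsGradientFlow (f τ) w → (∃ s, w s ≠ ξ) →
      Tendsto w atBot (𝓝 ξ) → Tendsto w atTop (𝓝 w_inf) →
      (hessian (f τ) w_inf).PosDef

/-- The conditions on the times `0 = t 0 < ⋯ < t k = T`, the branches `u`, their left limits `x` and
the connecting orbits `v`. Indices start from `0`: the branch `u i` lives on `[t i, t (i+1))`
for `i < k`, its limit at `t (i+1)` is `x i`, and for `i + 1 < k` the orbit `v i` goes from `x i`
to `u (i+1) (t (i+1))` at the frozen time `t (i+1)`. Values at other indices, and of `u i` outside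
`[t i, t (i+1))`, are irrelevant. -/
structure IsEvolution (T : ℝ) (f : ℝ → Rn n → ℝ) (y₀ : Rn n)
    (k : ℕ) (t : ℕ → ℝ) (u : ℕ → ℝ → Rn n) (x : ℕ → Rn n) (v : ℕ → ℝ → Rn n) : Prop where
  pos : 0 < k
  t_zero : t 0 = 0
  t_last : t k = T
  t_lt : ∀ i < k, t i < t (i + 1)
  u_contDiff : ∀ i < k, ContDiffOn ℝ 2 (u i) (Ico (t i) (t (i + 1)))
  v_contDiff : ∀ i, i + 1 < k → ContDiff ℝ 2 (v i)
  u_init : u 0 0 = y₀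
  u_critical : ∀ i < k, ∀ s ∈ Ico (t i) (t (i + 1)), gradient (f s) (u i s) = 0
  u_posDef : ∀ i < k, ∀ s ∈ Ico (t i) (t (i + 1)), (hessian (f s) (u i s)).PosDef
  u_limit : ∀ i < k, Tendsto (u i) (𝓝[<] t (i + 1)) (𝓝 (x i))
  x_degenerate : ∀ i, i + 1 < k → (t (i + 1), x i) ∈ degenerateSet T f
  x_posSemidef : ∀ i, i + 1 < k → (hessian (f (t (i + 1))) (x i)).PosSemidef
  x_sameSign : ∀ i, i + 1 < k → ∃ ℓ, SpansKernel (f (t (i + 1))) (x i) ℓ ∧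
    0 < mixedForm T f (t (i + 1)) (x i) ℓ * cubicForm (f (t (i + 1))) (x i) ℓ
  v_flow : ∀ i, i + 1 < k → IsGradientFlow (f (t (i + 1))) (v i)
  v_atBot : ∀ i, i + 1 < k → Tendsto (v i) atBot (𝓝 (x i))
  v_atTop : ∀ i, i + 1 < k → Tendsto (v i) atTop (𝓝 (u (i + 1) (t (i + 1))))

end GradFlow

end

/-! Write `F t` for the gradient field of `f t`. A nondegenerate minimum lies on a unique C² curve
of zeros of `F t`, which can be followed as long as the linearization stays positive definite.
Coercivity keeps the curve bounded. At a fixed time the critical points are countable, because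
nondegenerate ones are isolated and at most one is degenerate. A continuous bounded curve whose
cluster points are countable converges, so the maximal curve has an end point `ξ`
(`exists_maximal_branch`).

If this happens at a time `τ < T`, the Hessian at `ξ` is positive semidefinite and singular, with
kernel spanned by some `ℓ`. Along `ℓ` the equation reads, to leading order, `a (t - τ) + b z² = 0`.
Since it has solutions for `t < τ`, the coefficients `a` and `b` have the same sign
(`IsFold.timeDeriv_nonpos`, `mixedForm_mul_cubicForm_pos`).

At the frozen time, the flow of `-F τ` contracts across `ℓ` and drifts quadratically along `ℓ`. A
cone argument replaces the centre manifold. For `h = zℓ + y` with `y ⟂ ℓ`, let `V(h) = |y|² - ε²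
z²`. On the difference of two solutions near `ξ` one has `V' ≤ -μ V`, so `V ≤ 0` if both stay near
`ξ` for all past times. Two orbits issuing from `ξ` that share their `ℓ`-coordinate at one time then
coincide, which is uniqueness up to translation (`IsFold.unique`). An orbit exists by compactness:
orbits started on the axis ever closer to `ξ` take ever longer to leave the cone
(`IsFold.exists_solution`).

Coercivity bounds this orbit, and the decay of energy with countability of the critical points makes
it converge (`IsSolution.exists_tendsto_atTop`). Its limit is a nondegenerate minimum by hypothesis,
so a new branch starts there. Every jump uses up one of finitely many degenerate points, so the
construction stops (`exists_isEvolutionFrom`). Uniqueness follows by induction over the branches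
(`IsEvolutionFrom.branch_unique`). -/

open Set Filter Topology

noncomputable section

namespace GradFlow

variable {n : ℕ}

/-! ### Global solutions of autonomous equations. -/

section Flow

variable {E : Type*} [NormedAddCommGroup E] [NormedSpace ℝ E]

/-- A curve solving the autonomous equation `w' = G(w)` on the whole line. -/
def IsSolution (G : E → E) (w : ℝ → E) : Prop := ∀ s, HasDerivAt w (G (w s)) s

lemma IsSolution.continuous {G : E → E} {w : ℝ → E} (hw : IsSolution G w) : Continuous w :=
  continuous_iff_continuousAt.2 fun s => (hw s).continuousAt

lemma IsSolution.comp_add {G : E → E} {w : ℝ → E} (hw : IsSolution G w) (c : ℝ) :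
    IsSolution G (fun s => w (s + c)) := fun s => (hw (s + c)).comp_add_const s c

lemma IsSolution.comp_neg {G : E → E} {w : ℝ → E} (hw : IsSolution G w) :
    IsSolution (fun x => -G x) (fun s => w (-s)) := fun s => by
  have := (hw (-s)).scomp s (hasDerivAt_neg s)
  rw [neg_one_smul] at this
  exact this

lemma isSolution_const {G : E → E} {x : E} (hx : G x = 0) : IsSolution G (fun _ => x) :=
  fun s => by simpa [hx] using hasDerivAt_const s x

/-- A bounded Lipschitz vector field has a global solution through each point. -/
theorem exists_isSolution [CompleteSpace E] {G : E → E} {K : NNReal} (hG : LipschitzWith K G)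
    {M : ℝ} (hM : ∀ x, ‖G x‖ ≤ M) (x₀ : E) : ∃ w, w 0 = x₀ ∧ IsSolution G w := by
  lift M to NNReal using (norm_nonneg _).trans (hM x₀)
  have key : ∀ N : ℕ, ∃ w : ℝ → E, w 0 = x₀ ∧
      ∀ s ∈ Ioo (-(N + 1 : ℝ)) (N + 1), HasDerivAt w (G (w s)) s := by
    intro N
    have h0 : (0 : ℝ) ∈ Icc (-(N + 1 : ℝ)) (N + 1) := ⟨by linarith [N.cast_nonneg (α := ℝ)],
      by linarith [N.cast_nonneg (α := ℝ)]⟩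
    -- Speed at most `M` during a time `N + 1` keeps the solution in the ball of radius `M * (N +
    -- 1)`.
    have hPL : IsPicardLindelof (fun _ => G) (⟨0, h0⟩ : Icc (-(N + 1 : ℝ)) (N + 1)) x₀
        (M * (N + 1)) 0 M K :=
      IsPicardLindelof.of_time_independent (fun x _ => hM x) hG.lipschitzOnWith
        (by simp)
    obtain ⟨w, hw0, hw⟩ := hPL.exists_eq_forall_mem_Icc_hasDerivWithinAt₀
    exact ⟨w, hw0, fun s hs => (hw s (Ioo_subset_Icc_self hs)).hasDerivAt (Icc_mem_nhds hs.1 hs.2)⟩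
  choose W hW0 hW using key
  have agree : ∀ N M : ℕ, N ≤ M → EqOn (W N) (W M) (Ioo (-(N + 1 : ℝ)) (N + 1)) := by
    intro N M hNM
    have hc : (N : ℝ) ≤ M := by exact_mod_cast hNM
    have hN := N.cast_nonneg (α := ℝ)
    refine ODE_solution_unique_of_mem_Ioo (v := fun _ => G) (s := fun _ => univ) (K := K) (t₀ := 0)
      (fun t _ => hG.lipschitzOnWith) ⟨by linarith, by linarith⟩ (fun t ht => ⟨hW N t ht, trivial⟩)
      (fun t ht => ⟨hW M t ⟨by linarith [ht.1], by linarith [ht.2]⟩, trivial⟩) ?_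
    rw [hW0, hW0]
  -- Since `|s| < ⌈|s|⌉₊ + 1`, the time `s` is interior to the interval of `W ⌈|s|⌉₊`. For nearby
  -- times the index grows by at most one, so the glued curve is locally a single `W N`.
  refine ⟨fun s => W ⌈|s|⌉₊ s, by simp [hW0], fun s => ?_⟩
  set N := ⌈|s|⌉₊ + 1 with hN
  have hsN : s ∈ Ioo (-((⌈|s|⌉₊ : ℝ) + 1)) (⌈|s|⌉₊ + 1) := by
    have := abs_le.1 (Nat.le_ceil |s|)
    exact ⟨by linarith [this.1], by linarith [this.2]⟩
  have hev : (fun r => W ⌈|r|⌉₊ r) =ᶠ[𝓝 s] W N := by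
    filter_upwards [Ioo_mem_nhds hsN.1 hsN.2] with r hr
    refine agree _ _ ?_ ?_
    · refine Nat.ceil_le.2 ?_
      push_cast [hN]
      exact abs_le.2 ⟨hr.1.le, hr.2.le⟩
    · have := abs_le.1 (Nat.le_ceil |r|)
      exact ⟨by linarith [this.1], by linarith [this.2]⟩
  have h1 : HasDerivAt (W N) (G (W N s)) s :=
    hW N s ⟨by push_cast [hN]; linarith [hsN.1], by push_cast [hN]; linarith [hsN.2]⟩
  have h2 := h1.congr_of_eventuallyEq hev
  rwa [← hev.self_of_nhds] at h2

lemma IsSolution.dist_le_of_nonneg {G : E → E} {K : NNReal} (hG : LipschitzWith K G)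
    {w₁ w₂ : ℝ → E} (h₁ : IsSolution G w₁) (h₂ : IsSolution G w₂) {s : ℝ} (hs : 0 ≤ s) :
    dist (w₁ s) (w₂ s) ≤ dist (w₁ 0) (w₂ 0) * Real.exp (K * s) := by
  have := dist_le_of_trajectories_ODE (v := fun _ => G) (K := K) (a := 0) (b := s) (fun _ => hG)
    h₁.continuous.continuousOn (fun t _ => (h₁ t).hasDerivWithinAt)
    h₂.continuous.continuousOn (fun t _ => (h₂ t).hasDerivWithinAt) le_rfl s ⟨hs, le_rfl⟩
  simpa using this

/-- Solutions depend continuously on the initial datum. -/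
theorem IsSolution.dist_le {G : E → E} {K : NNReal} (hG : LipschitzWith K G)
    {w₁ w₂ : ℝ → E} (h₁ : IsSolution G w₁) (h₂ : IsSolution G w₂) (s : ℝ) :
    dist (w₁ s) (w₂ s) ≤ dist (w₁ 0) (w₂ 0) * Real.exp (K * |s|) := by
  rcases le_total 0 s with hs | hs
  · simpa [abs_of_nonneg hs] using h₁.dist_le_of_nonneg hG h₂ hs
  · have := h₁.comp_neg.dist_le_of_nonneg (K := K) hG.neg h₂.comp_neg (neg_nonneg.2 hs)
    simpa [abs_of_nonpos hs] using this

/-- Two solutions of an autonomous `C¹` equation which agree at one time are equal. -/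
theorem IsSolution.eq_of_eq [FiniteDimensional ℝ E] {G : E → E} (hG : ContDiff ℝ 1 G)
    {w₁ w₂ : ℝ → E} (h₁ : IsSolution G w₁) (h₂ : IsSolution G w₂) {s₀ : ℝ}
    (h : w₁ s₀ = w₂ s₀) : w₁ = w₂ := by
  have : ProperSpace E := FiniteDimensional.proper ℝ E
  funext s
  set R := |s| + |s₀| + 1 with hR
  -- `G` is only locally Lipschitz; on a compact time window both curves stay in one ball, where a
  -- single Lipschitz constant is available.
  have hcomp : IsCompact (w₁ '' Icc (-R) R ∪ w₂ '' Icc (-R) R) :=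
    (isCompact_Icc.image h₁.continuous).union (isCompact_Icc.image h₂.continuous)
  obtain ⟨ρ, hρ⟩ := hcomp.isBounded.subset_closedBall 0
  obtain ⟨K, hK⟩ := hG.contDiffOn.exists_lipschitzOnWith one_ne_zero (convex_closedBall (0 : E) ρ)
    (isCompact_closedBall 0 ρ)
  have hs := abs_le.1 (le_refl |s|)
  have hs₀ := abs_le.1 (le_refl |s₀|)
  have hp := abs_nonneg s
  have hp' := abs_nonneg s₀
  refine ODE_solution_unique_of_mem_Ioo (v := fun _ => G) (s := fun _ => Metric.closedBall 0 ρ)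
    (K := K) (a := -R) (b := R) (t₀ := s₀) (fun t _ => hK) ⟨by linarith, by linarith⟩
    (fun t ht => ⟨h₁ t, hρ (Or.inl ⟨t, Ioo_subset_Icc_self ht, rfl⟩)⟩)
    (fun t ht => ⟨h₂ t, hρ (Or.inr ⟨t, Ioo_subset_Icc_self ht, rfl⟩)⟩) h ⟨by linarith, by linarith⟩

/-- Solutions inherit the regularity of the vector field. -/
theorem IsSolution.contDiff_two {G : E → E} (hG : ContDiff ℝ 1 G) {w : ℝ → E}
    (hw : IsSolution G w) : ContDiff ℝ 2 w := by
  have hd : deriv w = fun s => G (w s) := funext fun s => (hw s).deriv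
  have hdiff : Differentiable ℝ w := fun s => (hw s).differentiableAt
  have h1 : ContDiff ℝ 1 w := by
    rw [contDiff_one_iff_deriv, hd]
    exact ⟨hdiff, hG.continuous.comp hw.continuous⟩
  rw [show (2 : WithTop ℕ∞) = 1 + 1 by norm_num, contDiff_succ_iff_deriv, hd]
  exact ⟨hdiff, by simp, hG.comp h1⟩

end Flow

/-! ### Convergence of paths with countably many cluster points. -/

section Cluster

variable {E : Type*} [NormedAddCommGroup E] [ProperSpace E]

/-- A bounded path, continuous near the end of an interval, whose cluster points form a countable
set, converges. -/
theorem exists_tendsto_of_countable_cluster {l : Filter ℝ} [l.NeBot] {u : ℝ → E} {R : ℝ}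
    {C : Set E} (hC : C.Countable) (hR : ∀ᶠ s in l, ‖u s‖ ≤ R)
    (hcl : ∀ p, MapClusterPt p l u → p ∈ C)
    (hconn : ∀ A ∈ l, ∃ B ∈ l, B ⊆ A ∧ IsPreconnected B ∧ ContinuousOn u B) :
    ∃ p ∈ C, Tendsto u l (𝓝 p) := by
  have hcpt : IsCompact (Metric.closedBall (0 : E) R) := isCompact_closedBall 0 R
  have hmem : ∀ᶠ s in l, u s ∈ Metric.closedBall (0 : E) R := by simpa using hR
  obtain ⟨p, -, hp⟩ := hcpt.exists_mapClusterPt_of_frequently hmem.frequently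
  refine ⟨p, hcl p hp, ?_⟩
  refine hcpt.tendsto_nhds_of_unique_mapClusterPt hmem fun q _ hq => ?_
  by_contra hne
  have hpos : 0 < dist q p := dist_pos.2 hne
  -- Between visits near `p` and near `q`, the path crosses every sphere of intermediate radius
  -- around `p`. By compactness it has a cluster point on each of them, which is uncountably many.
  have hsub : Ioo 0 (dist q p) ⊆ (fun x => dist x p) '' C := by
    intro c hc
    have hfreq : ∃ᶠ s in l, dist (u s) p = c := by
      rw [frequently_iff]
      intro A hA
      obtain ⟨B, hB, hBA, hBc, hBu⟩ := hconn A hA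
      have h1 : ∃ s ∈ B, dist (u s) p < c := by
        have := (mapClusterPt_iff_frequently.1 hp) _ (Metric.ball_mem_nhds p hc.1)
        obtain ⟨s, hs, hsB⟩ := (this.and_eventually hB).exists
        exact ⟨s, hsB, hs⟩
      have h2 : ∃ s ∈ B, c < dist (u s) p := by
        have := (mapClusterPt_iff_frequently.1 hq) _
          (Metric.ball_mem_nhds q (sub_pos.2 hc.2))
        obtain ⟨s, hs, hsB⟩ := (this.and_eventually hB).exists
        refine ⟨s, hsB, ?_⟩
        have h3 := dist_triangle q (u s) p
        rw [Metric.mem_ball, dist_comm] at hs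
        linarith
      obtain ⟨s₁, hs₁, h1⟩ := h1
      obtain ⟨s₂, hs₂, h2⟩ := h2
      have hBd : ContinuousOn (fun s => dist (u s) p) B :=
        (continuous_id.dist continuous_const).comp_continuousOn hBu
      obtain ⟨s, hs, hsc⟩ := hBc.intermediate_value hs₁ hs₂ hBd ⟨h1.le, h2.le⟩
      exact ⟨s, hBA hs, hsc⟩
    have hcpt' : IsCompact (Metric.closedBall (0 : E) R ∩ {x | dist x p = c}) :=
      hcpt.inter_right (isClosed_eq (continuous_id.dist continuous_const) continuous_const)
    have hfreq' : ∃ᶠ s in l, u s ∈ Metric.closedBall (0 : E) R ∩ {x | dist x p = c} :=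
      (hfreq.and_eventually hmem).mono fun s hs => ⟨hs.2, hs.1⟩
    obtain ⟨x, hx, hxc⟩ := hcpt'.exists_mapClusterPt_of_frequently hfreq'
    exact ⟨x, hcl x hxc, hx.2⟩
  exact absurd (Cardinal.Real.Ioo_countable_iff.1 ((hC.image _).mono hsub)) (not_le.2 hpos)

end Cluster

/-! ### Convergence of bounded gradient trajectories. -/

section GradientDescent

/-- If `h' = -φ` with `φ ≥ 0` Lipschitz and `h` bounded below, then `φ → 0` at infinity. -/
theorem tendsto_zero_of_deriv_neg {h φ : ℝ → ℝ} {L m : ℝ} (hL : 0 < L)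
    (hd : ∀ s, HasDerivAt h (-φ s) s) (hφ : ∀ s, 0 ≤ φ s) (hm : ∀ s, 0 ≤ s → m ≤ h s)
    (hlip : ∀ s r, 0 ≤ s → s ≤ r → φ s ≤ φ r + L * (r - s)) :
    Tendsto φ atTop (𝓝 0) := by
  have hanti : Antitone h := antitone_of_hasDerivAt_nonpos hd fun s => neg_nonpos.2 (hφ s)
  have hbdd : BddBelow (range h) := by
    refine ⟨m, ?_⟩
    rintro _ ⟨s, rfl⟩
    rcases le_total 0 s with hs | hs
    · exact hm s hs
    · exact (hm 0 le_rfl).trans (hanti hs)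
  have hlim := tendsto_atTop_ciInf hanti hbdd
  rw [Metric.tendsto_atTop]
  intro ε hε
  -- On a window of length `η` the growth of `φ` is at most `ε / 2`. As `h` converges, its drop over
  -- the window tends to zero, so by the mean value theorem `φ` is below `ε / 2` somewhere in the
  -- window, hence below `ε` at its left end.
  set η := ε / (2 * L) with hη
  have hηpos : 0 < η := by positivity
  have hdiff : Tendsto (fun s => h s - h (s + η)) atTop (𝓝 0) := by
    simpa using hlim.sub (hlim.comp (tendsto_atTop_add_const_right _ η tendsto_id))
  have hev : ∀ᶠ s in atTop, h s - h (s + η) < η * (ε / 2) :=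
    hdiff.eventually_lt_const (by positivity)
  obtain ⟨N, hN⟩ := eventually_atTop.1 (hev.and (eventually_ge_atTop 0))
  refine ⟨N, fun s hs => ?_⟩
  obtain ⟨hlt, hs0⟩ := hN s hs
  obtain ⟨r, hr, hrd⟩ := exists_hasDerivAt_eq_slope h (fun s => -φ s) (lt_add_of_pos_right s hηpos)
    (fun x _ => (hd x).continuousAt.continuousWithinAt) (fun x _ => hd x)
  have h1 : φ r * η = h s - h (s + η) := by
    rw [add_sub_cancel_left, eq_div_iff hηpos.ne'] at hrd
    linarith
  have h2 : φ r < ε / 2 := by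
    by_contra hcon
    nlinarith
  have h3 := hlip s r hs0 hr.1.le
  have h4 : L * (r - s) ≤ ε / 2 := by
    calc L * (r - s) ≤ L * η := by
          apply mul_le_mul_of_nonneg_left _ hL.le
          linarith [hr.2]
      _ = ε / 2 := by rw [hη]; field_simp
  rw [Real.dist_eq, sub_zero, abs_of_nonneg (hφ s)]
  linarith

variable {E : Type*} [NormedAddCommGroup E] [InnerProductSpace ℝ E] [FiniteDimensional ℝ E]

/-- A gradient trajectory which is bounded in the future converges to a critical point, provided
that the critical points are countable. -/
theorem IsSolution.exists_tendsto_atTop {g : E → ℝ} (hg : Differentiable ℝ g)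
    (hF : ContDiff ℝ 1 (gradient g)) (hcount : {x | gradient g x = 0}.Countable)
    {w : ℝ → E} (hw : IsSolution (fun x => -gradient g x) w) {R : ℝ}
    (hR : ∀ s, 0 ≤ s → ‖w s‖ ≤ R) :
    ∃ p, gradient g p = 0 ∧ Tendsto w atTop (𝓝 p) := by
  have : ProperSpace E := FiniteDimensional.proper ℝ E
  have hcpt := isCompact_closedBall (0 : E) R
  have hmem : ∀ s, 0 ≤ s → w s ∈ Metric.closedBall (0 : E) R := fun s hs => by
    simpa using hR s hs
  obtain ⟨K, hK⟩ := hF.contDiffOn.exists_lipschitzOnWith one_ne_zero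
    (convex_closedBall (0 : E) R) hcpt
  obtain ⟨M, hM⟩ := hcpt.exists_bound_of_continuousOn hF.continuous.continuousOn
  obtain ⟨m, hm⟩ := (hcpt.image hg.continuous).bddBelow
  have hM0 : 0 ≤ M := (norm_nonneg _).trans (hM _ (hmem 0 le_rfl))
  have hd : ∀ s, HasDerivAt (fun s => g (w s)) (-‖gradient g (w s)‖ ^ 2) s := fun s => by
    have h1 := (hg (w s)).hasGradientAt.hasFDerivAt.comp_hasDerivAt s (hw s)
    simp only [map_neg, InnerProductSpace.toDual_apply_apply, real_inner_self_eq_norm_sq] at h1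
    exact h1
  have hwlip : ∀ s r, 0 ≤ s → s ≤ r → ‖w s - w r‖ ≤ M * (r - s) := by
    intro s r hs hsr
    have := (convex_Icc s r).norm_image_sub_le_of_norm_hasDerivWithin_le (f := w) (C := M)
      (fun x _ => (hw x).hasDerivWithinAt)
      (fun x hx => by simpa using hM _ (hmem x (hs.trans hx.1)))
      (right_mem_Icc.2 hsr) (left_mem_Icc.2 hsr)
    rwa [Real.norm_eq_abs, abs_sub_comm, abs_of_nonneg (sub_nonneg.2 hsr)] at this
  have hzero : Tendsto (fun s => ‖gradient g (w s)‖ ^ 2) atTop (𝓝 0) := by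
    -- `K * M` is a Lipschitz constant of the gradient along the curve; squaring a norm bounded by
    -- `M` costs a factor `2 * M`. The `+ 1` only ensures positivity.
    refine tendsto_zero_of_deriv_neg (L := 2 * M * (K * M) + 1) (m := m) (by positivity) hd
      (fun s => by positivity) (fun s hs => hm ⟨_, hmem s hs, rfl⟩) ?_
    intro s r hs hsr
    have h1 := hK.dist_le_mul _ (hmem s hs) _ (hmem r (hs.trans hsr))
    rw [dist_eq_norm, dist_eq_norm] at h1
    have h2 := hwlip s r hs hsr
    have h3 := norm_sub_norm_le (gradient g (w s)) (gradient g (w r))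
    have h4 := hM _ (hmem s hs)
    have h5 := hM _ (hmem r (hs.trans hsr))
    have h6 : ‖gradient g (w s)‖ - ‖gradient g (w r)‖ ≤ K * M * (r - s) := by
      calc _ ≤ K * ‖w s - w r‖ := h3.trans h1
        _ ≤ K * (M * (r - s)) := by gcongr
        _ = _ := by ring
    have h7 : 0 ≤ K * M * (r - s) := by
      have := sub_nonneg.2 hsr
      positivity
    have h8 := norm_nonneg (gradient g (w s))
    have h9 := norm_nonneg (gradient g (w r))
    have h10 : (‖gradient g (w s)‖ - ‖gradient g (w r)‖) *
        (‖gradient g (w s)‖ + ‖gradient g (w r)‖) ≤ K * M * (r - s) * (2 * M) := by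
      calc _ ≤ K * M * (r - s) * (‖gradient g (w s)‖ + ‖gradient g (w r)‖) := by gcongr
        _ ≤ _ := by gcongr; linarith
    nlinarith
  have hzero' : Tendsto (fun s => gradient g (w s)) atTop (𝓝 0) := by
    rw [tendsto_zero_iff_norm_tendsto_zero]
    simpa [Real.sqrt_sq] using hzero.sqrt
  refine exists_tendsto_of_countable_cluster hcount
    ((eventually_ge_atTop 0).mono fun s hs => hR s hs) ?_ ?_
  · intro p hp
    obtain ⟨U, hU, hUp⟩ := mapClusterPt_iff_ultrafilter.1 hp
    exact tendsto_nhds_unique ((hF.continuous.tendsto p).comp hUp) (hzero'.mono_left hU)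
  · intro A hA
    obtain ⟨a, ha⟩ := mem_atTop_sets.1 hA
    exact ⟨Ici a, Ici_mem_atTop a, ha, isPreconnected_Ici, hw.continuous.continuousOn⟩

end GradientDescent

/-! ### Orbits issuing from a fold point, by a cone argument. -/

section Fold

open scoped RealInnerProductSpace

variable {E : Type*} [NormedAddCommGroup E] [InnerProductSpace ℝ E]

/-- The quadratic form whose sublevel set `{coneForm ε ℓ ≤ 0}` is the cone of aperture `ε` around
the line spanned by the unit vector `ℓ`. -/
def coneForm (ε : ℝ) (ℓ h : E) : ℝ := ‖h‖ ^ 2 - (1 + ε ^ 2) * ⟪ℓ, h⟫ ^ 2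

lemma continuous_coneForm (ε : ℝ) (ℓ : E) : Continuous (coneForm ε ℓ) := by
  unfold coneForm; fun_prop

lemma norm_sq_le_of_coneForm_nonpos {ε : ℝ} (hε : 0 ≤ ε) (hε1 : ε ≤ 1) {ℓ h : E}
    (hh : coneForm ε ℓ h ≤ 0) : ‖h‖ ^ 2 ≤ 2 * ⟪ℓ, h⟫ ^ 2 := by
  have h1 : (1 + ε ^ 2) * ⟪ℓ, h⟫ ^ 2 ≤ 2 * ⟪ℓ, h⟫ ^ 2 := by
    gcongr; nlinarith
  unfold coneForm at hh
  linarith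

lemma eq_zero_of_coneForm_nonpos {ε : ℝ} {ℓ h : E} (hh : coneForm ε ℓ h ≤ 0) (hz : ⟪ℓ, h⟫ = 0) :
    h = 0 := by
  rw [coneForm, hz] at hh
  have : ‖h‖ ^ 2 = 0 := le_antisymm (by simpa using hh) (sq_nonneg _)
  simpa using this

lemma hasDerivAt_coneForm {ε : ℝ} {ℓ : E} {h : ℝ → E} {h' : E} {s : ℝ} (hh : HasDerivAt h h' s) :
    HasDerivAt (fun s => coneForm ε ℓ (h s))
      (2 * ⟪h s, h'⟫ - 2 * (1 + ε ^ 2) * (⟪ℓ, h s⟫ * ⟪ℓ, h'⟫)) s := by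
  have h1 := hh.norm_sq
  have h2 : HasDerivAt (fun s => ⟪ℓ, h s⟫) ⟪ℓ, h'⟫ s := by
    simpa using (hasDerivAt_const s ℓ).inner ℝ hh
  have h3 := h1.sub ((h2.pow 2).const_mul (1 + ε ^ 2))
  refine h3.congr_deriv ?_
  push_cast
  ring

/-- Local estimates near a degenerate zero `ξ` of the field `F`: the cone around `ℓ` is expanded
relative to its complement, along the cone the component of `-F` in the direction `ℓ` is at least
quadratic, and away from the cone `F` is at least linear. -/
structure IsFold (F : E → E) (ξ ℓ : E) (μ ε r κ : ℝ) : Prop where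
  zero : F ξ = 0
  unit : ‖ℓ‖ = 1
  mu_pos : 0 < μ
  eps_pos : 0 < ε
  eps_le : ε ≤ 1
  r_pos : 0 < r
  kappa_pos : 0 < κ
  -- The left side is the derivative of `coneForm ε ℓ` along the difference of two solutions of `w'
  -- = -F(w)`, so this is `V' ≤ -μ V`.
  cone : ∀ x ∈ Metric.ball ξ r, ∀ y ∈ Metric.ball ξ r,
    2 * ⟪x - y, -F x - -F y⟫ - 2 * (1 + ε ^ 2) * (⟪ℓ, x - y⟫ * ⟪ℓ, -F x - -F y⟫) ≤
      -μ * coneForm ε ℓ (x - y)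
  drift : ∀ x ∈ Metric.ball ξ r, coneForm ε ℓ (x - ξ) ≤ 0 → κ * ⟪ℓ, x - ξ⟫ ^ 2 ≤ ⟪ℓ, -F x⟫
  transverse : ∀ x ∈ Metric.ball ξ r, 0 ≤ coneForm ε ℓ (x - ξ) →
    μ * ε / 4 * ‖x - ξ‖ ≤ ‖F x‖

/-- Grönwall's inequality with an integrating factor. It keeps solutions inside the cone forward in
time and, read backwards, forces bounded pasts into it. -/
lemma antitoneOn_exp_mul {V V' : ℝ → ℝ} {μ : ℝ} {D : Set ℝ} (hD : Convex ℝ D)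
    (hV : ∀ s, HasDerivAt V (V' s) s) (hle : ∀ s ∈ interior D, V' s ≤ -μ * V s) :
    AntitoneOn (fun s => Real.exp (μ * s) * V s) D := by
  have hd : ∀ s, HasDerivAt (fun s => Real.exp (μ * s) * V s)
      (Real.exp (μ * s) * (μ * V s + V' s)) s := fun s => by
    have h1 : HasDerivAt (fun s => Real.exp (μ * s)) (Real.exp (μ * s) * μ) s := by
      simpa using ((hasDerivAt_id s).const_mul μ).exp
    exact (h1.mul (hV s)).congr_deriv (by ring)
  refine antitoneOn_of_deriv_nonpos hD
    (fun s _ => (hd s).continuousAt.continuousWithinAt)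
    (fun s _ => (hd s).differentiableAt.differentiableWithinAt) fun s hs => ?_
  rw [(hd s).deriv]
  exact mul_nonpos_of_nonneg_of_nonpos (Real.exp_pos _).le (by linarith [hle s hs])

variable {F : E → E} {ξ ℓ : E} {μ ε r κ : ℝ}

lemma hasDerivAt_coordinate {G : E → E} {w : ℝ → E} (hw : IsSolution G w) (ξ ℓ : E) (s : ℝ) :
    HasDerivAt (fun s => ⟪ℓ, w s - ξ⟫) ⟪ℓ, G (w s)⟫ s := by
  simpa using (hasDerivAt_const s ℓ).inner ℝ ((hw s).sub_const ξ)

lemma tendsto_coordinate {w : ℝ → E} {l : Filter ℝ} (hw : Tendsto w l (𝓝 ξ)) (ℓ : E) :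
    Tendsto (fun s => ⟪ℓ, w s - ξ⟫) l (𝓝 0) := by
  have h : Continuous fun x : E => ⟪ℓ, x - ξ⟫ := by fun_prop
  have := (h.tendsto ξ).comp hw
  simp only [sub_self, inner_zero_right] at this
  exact this

/-- Two solutions which remain near `ξ` in the past differ by a vector of the cone. -/
theorem IsFold.coneForm_nonpos (hF : IsFold F ξ ℓ μ ε r κ) {G : E → E} {w₁ w₂ : ℝ → E}
    (hG : ∀ x ∈ Metric.ball ξ r, G x = -F x) (h₁ : IsSolution G w₁) (h₂ : IsSolution G w₂) {S : ℝ}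
    (hb₁ : ∀ s ≤ S, w₁ s ∈ Metric.ball ξ r) (hb₂ : ∀ s ≤ S, w₂ s ∈ Metric.ball ξ r)
    {s : ℝ} (hs : s ≤ S) : coneForm ε ℓ (w₁ s - w₂ s) ≤ 0 := by
  have hanti := antitoneOn_exp_mul (μ := μ) (convex_Iic S)
    (fun s => hasDerivAt_coneForm (ε := ε) (ℓ := ℓ) ((h₁ s).sub (h₂ s))) (fun s hs => by
      have hs' : s ≤ S := mem_Iic.1 (interior_subset hs)
      simp only [Pi.sub_apply, hG _ (hb₁ s hs'), hG _ (hb₂ s hs')]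
      exact hF.cone _ (hb₁ s hs') _ (hb₂ s hs'))
  by_contra hpos
  push Not at hpos
  -- Going back in time `exp (μ t) V(t)` cannot decrease, but `V ≤ (2r)²` in the ball makes its
  -- upper bound tend to zero. A positive value at `s` is therefore impossible.
  have hlim : Tendsto (fun t => Real.exp (μ * t) * (2 * r) ^ 2) atBot (𝓝 0) := by
    have : Tendsto (fun t : ℝ => μ * t) atBot atBot := tendsto_id.const_mul_atBot hF.mu_pos
    simpa using (Real.tendsto_exp_atBot.comp this).mul_const ((2 * r) ^ 2)
  have hc : 0 < Real.exp (μ * s) * coneForm ε ℓ (w₁ s - w₂ s) := mul_pos (Real.exp_pos _) hpos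
  obtain ⟨t, ht, hts⟩ := ((hlim.eventually_lt_const hc).and (eventually_le_atBot s)).exists
  have h3 := hanti (hts.trans hs) hs hts
  simp only [Pi.sub_apply] at h3
  have h4 : coneForm ε ℓ (w₁ t - w₂ t) ≤ (2 * r) ^ 2 := by
    have h5 : ‖w₁ t - w₂ t‖ ≤ 2 * r := by
      have ha := hb₁ t (hts.trans hs)
      have hb := hb₂ t (hts.trans hs)
      rw [Metric.mem_ball] at ha hb
      rw [← dist_eq_norm]
      linarith [dist_triangle_right (w₁ t) (w₂ t) ξ]
    have h6 : ‖w₁ t - w₂ t‖ ^ 2 ≤ (2 * r) ^ 2 := by gcongr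
    unfold coneForm
    nlinarith [sq_nonneg ε, sq_nonneg ⟪ℓ, w₁ t - w₂ t⟫,
      mul_nonneg (sq_nonneg ε) (sq_nonneg ⟪ℓ, w₁ t - w₂ t⟫)]
  have := mul_le_mul_of_nonneg_left h4 (Real.exp_pos (μ * t)).le
  linarith

lemma IsFold.monotoneOn_coordinate (hF : IsFold F ξ ℓ μ ε r κ) {G : E → E} {w : ℝ → E}
    (hG : ∀ x ∈ Metric.ball ξ r, G x = -F x) (hw : IsSolution G w) {D : Set ℝ} (hD : Convex ℝ D)
    (hb : ∀ s ∈ interior D, w s ∈ Metric.ball ξ r)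
    (hc : ∀ s ∈ interior D, coneForm ε ℓ (w s - ξ) ≤ 0) :
    MonotoneOn (fun s => ⟪ℓ, w s - ξ⟫) D := by
  refine monotoneOn_of_deriv_nonneg hD
    (fun s _ => (hasDerivAt_coordinate hw ξ ℓ s).continuousAt.continuousWithinAt)
    (fun s _ => (hasDerivAt_coordinate hw ξ ℓ s).differentiableAt.differentiableWithinAt)
    fun s hs => ?_
  rw [(hasDerivAt_coordinate hw ξ ℓ s).deriv, hG _ (hb s hs)]
  exact (mul_nonneg hF.kappa_pos.le (sq_nonneg _)).trans (hF.drift _ (hb s hs) (hc s hs))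

/-- If the coordinate along `ℓ` is at least `a` on a time interval spent in the cone, then it grows
at least linearly, with slope `κ a²`. -/
lemma IsFold.coordinate_growth (hF : IsFold F ξ ℓ μ ε r κ) {G : E → E} {w : ℝ → E}
    (hG : ∀ x ∈ Metric.ball ξ r, G x = -F x) (hw : IsSolution G w) {a s t : ℝ} (ha : 0 ≤ a)
    (hst : s ≤ t) (hb : ∀ x ∈ Icc s t, w x ∈ Metric.ball ξ r)
    (hc : ∀ x ∈ Icc s t, coneForm ε ℓ (w x - ξ) ≤ 0)
    (haz : ∀ x ∈ Icc s t, a ≤ ⟪ℓ, w x - ξ⟫) :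
    κ * a ^ 2 * (t - s) ≤ ⟪ℓ, w t - ξ⟫ - ⟪ℓ, w s - ξ⟫ := by
  refine (convex_Icc s t).mul_sub_le_image_sub_of_le_deriv (f := fun s => ⟪ℓ, w s - ξ⟫)
    (fun s _ => (hasDerivAt_coordinate hw ξ ℓ s).continuousAt.continuousWithinAt)
    (fun s _ => (hasDerivAt_coordinate hw ξ ℓ s).differentiableAt.differentiableWithinAt)
    (fun x hx => ?_) s (left_mem_Icc.2 hst) t (right_mem_Icc.2 hst) hst
  have hx' := interior_subset hx
  rw [(hasDerivAt_coordinate hw ξ ℓ x).deriv, hG _ (hb x hx')]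
  refine le_trans ?_ (hF.drift _ (hb x hx') (hc x hx'))
  have := haz x hx'
  have := hF.kappa_pos
  gcongr

/-- A nontrivial solution issuing from `ξ` eventually lies, in the past, in the cone, with positive
and increasing coordinate along `ℓ`. -/
lemma IsFold.past_of_tendsto [FiniteDimensional ℝ E] (hF : IsFold F ξ ℓ μ ε r κ)
    (hFc : ContDiff ℝ 1 F) {w : ℝ → E}
    (hw : IsSolution (fun x => -F x) w) (hne : ∃ s, w s ≠ ξ) (hlim : Tendsto w atBot (𝓝 ξ)) :
    ∃ S, ∀ s ≤ S, w s ∈ Metric.ball ξ r ∧ 0 < ⟪ℓ, w s - ξ⟫ := by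
  obtain ⟨S, hS⟩ := eventually_atBot.1 (hlim.eventually (Metric.ball_mem_nhds ξ hF.r_pos))
  refine ⟨S, fun s hs => ⟨hS s hs, ?_⟩⟩
  have hconst : IsSolution (fun x => -F x) (fun _ => ξ) := isSolution_const (by simp [hF.zero])
  have hcone : ∀ s ≤ S, coneForm ε ℓ (w s - ξ) ≤ 0 := fun s hs =>
    hF.coneForm_nonpos (fun _ _ => rfl) hw hconst hS
      (fun _ _ => Metric.mem_ball_self hF.r_pos) hs
  have hmono := hF.monotoneOn_coordinate (fun _ _ => rfl) hw (convex_Iic S)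
    (fun s hs => hS s (mem_Iic.1 (interior_subset hs)))
    (fun s hs => hcone s (mem_Iic.1 (interior_subset hs)))
  -- The coordinate is monotone with limit `0` in the past, hence nonnegative. If it vanished once,
  -- the cone condition would give `w s = ξ` and `w` would be stationary.
  have hz := tendsto_coordinate hlim ℓ
  have h0 : 0 ≤ ⟪ℓ, w s - ξ⟫ :=
    le_of_tendsto hz ((eventually_le_atBot s).mono fun t ht => hmono (ht.trans hs) hs ht)
  refine lt_of_le_of_ne h0 fun h => ?_
  have h1 : w s = ξ := sub_eq_zero.1 (eq_zero_of_coneForm_nonpos (hcone s hs) h.symm)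
  have h2 := hw.eq_of_eq hFc.neg hconst (s₀ := s) h1
  obtain ⟨t, ht⟩ := hne
  exact ht (congrFun h2 t)

/-- The nontrivial solution issuing from `ξ` is unique up to a time translation. -/
theorem IsFold.unique [FiniteDimensional ℝ E] (hF : IsFold F ξ ℓ μ ε r κ)
    (hFc : ContDiff ℝ 1 F) {w₁ w₂ : ℝ → E}
    (h₁ : IsSolution (fun x => -F x) w₁) (hne₁ : ∃ s, w₁ s ≠ ξ) (hlim₁ : Tendsto w₁ atBot (𝓝 ξ))
    (h₂ : IsSolution (fun x => -F x) w₂) (hne₂ : ∃ s, w₂ s ≠ ξ) (hlim₂ : Tendsto w₂ atBot (𝓝 ξ)) :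
    ∃ c, ∀ s, w₁ s = w₂ (s + c) := by
  obtain ⟨S₁, hS₁⟩ := hF.past_of_tendsto hFc h₁ hne₁ hlim₁
  obtain ⟨S₂, hS₂⟩ := hF.past_of_tendsto hFc h₂ hne₂ hlim₂
  have match_level : ∀ {w : ℝ → E} {S a : ℝ}, IsSolution (fun x => -F x) w →
      Tendsto w atBot (𝓝 ξ) → 0 < a → a ≤ ⟪ℓ, w S - ξ⟫ → ∃ s ≤ S, ⟪ℓ, w s - ξ⟫ = a := by
    intro w S a hw hlim ha haS
    obtain ⟨t, hta, htS⟩ := (((tendsto_coordinate hlim ℓ).eventually_lt_const ha).and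
      (eventually_le_atBot S)).exists
    have hcont : ContinuousOn (fun s => ⟪ℓ, w s - ξ⟫) (Icc t S) :=
      fun s _ => (hasDerivAt_coordinate hw ξ ℓ s).continuousAt.continuousWithinAt
    obtain ⟨s, hs, hsa⟩ := intermediate_value_Icc htS hcont ⟨hta.le, haS⟩
    exact ⟨s, hs.2, hsa⟩
  -- Both coordinates rise continuously from `0`, so the smaller of the two values at `S₁` and `S₂`
  -- is attained by both orbits.
  obtain ⟨s₁, hs₁, s₂, hs₂, heq⟩ : ∃ s₁ ≤ S₁, ∃ s₂ ≤ S₂, ⟪ℓ, w₁ s₁ - ξ⟫ = ⟪ℓ, w₂ s₂ - ξ⟫ := by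
    rcases le_total ⟪ℓ, w₁ S₁ - ξ⟫ ⟪ℓ, w₂ S₂ - ξ⟫ with h | h
    · obtain ⟨s, hs, hsa⟩ := match_level h₂ hlim₂ (hS₁ S₁ le_rfl).2 h
      exact ⟨S₁, le_rfl, s, hs, hsa.symm⟩
    · obtain ⟨s, hs, hsa⟩ := match_level h₁ hlim₁ (hS₂ S₂ le_rfl).2 h
      exact ⟨s, hs, S₂, le_rfl, hsa⟩
  have hsol := h₂.comp_add (s₂ - s₁)
  have hcone := hF.coneForm_nonpos (fun _ _ => rfl) h₁ hsol (S := s₁)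
    (fun s hs => (hS₁ s (hs.trans hs₁)).1)
    (fun s hs => (hS₂ (s + (s₂ - s₁)) (by linarith)).1) le_rfl
  -- After the time shift the difference lies in the cone and has zero coordinate along `ℓ`, so it
  -- vanishes.
  have h3 : w₁ s₁ - w₂ (s₁ + (s₂ - s₁)) = 0 := by
    refine eq_zero_of_coneForm_nonpos hcone ?_
    rw [add_sub_cancel, ← sub_sub_sub_cancel_right _ _ ξ, inner_sub_right, heq, sub_self]
  exact ⟨s₂ - s₁, congrFun (h₁.eq_of_eq hFc.neg hsol (sub_eq_zero.1 h3))⟩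

/-- The truncated cone at `ξ`. -/
def truncatedCone (ξ ℓ : E) (ε δ : ℝ) : Set E :=
  {x | coneForm ε ℓ (x - ξ) ≤ 0 ∧ 0 ≤ ⟪ℓ, x - ξ⟫ ∧ ⟪ℓ, x - ξ⟫ ≤ δ}

lemma isClosed_truncatedCone (ξ ℓ : E) (ε δ : ℝ) : IsClosed (truncatedCone ξ ℓ ε δ) := by
  have h1 : Continuous fun x : E => ⟪ℓ, x - ξ⟫ := by fun_prop
  have h2 : Continuous fun x : E => coneForm ε ℓ (x - ξ) :=
    (continuous_coneForm ε ℓ).comp (by fun_prop)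
  exact (isClosed_le h2 continuous_const).inter
    ((isClosed_le continuous_const h1).inter (isClosed_le h1 continuous_const))

lemma truncatedCone_subset_closedBall (hF : IsFold F ξ ℓ μ ε r κ) (δ : ℝ) :
    truncatedCone ξ ℓ ε δ ⊆ Metric.closedBall ξ (2 * δ) := by
  intro x hx
  have h1 := norm_sq_le_of_coneForm_nonpos hF.eps_pos.le hF.eps_le hx.1
  have h2 : ⟪ℓ, x - ξ⟫ ^ 2 ≤ δ ^ 2 := pow_le_pow_left₀ hx.2.1 hx.2.2 2
  rw [mem_closedBall_iff_norm]
  have hδ : 0 ≤ δ := hx.2.1.trans hx.2.2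
  nlinarith [norm_nonneg (x - ξ)]

/-- The truncation level `r / 4` is small enough for the closed ball of radius `r / 2` to sit where
the fold estimates hold. -/
lemma truncatedCone_subset_ball (hF : IsFold F ξ ℓ μ ε r κ) :
    truncatedCone ξ ℓ ε (r / 4) ⊆ Metric.ball ξ r :=
  (truncatedCone_subset_closedBall hF _).trans
    (Metric.closedBall_subset_ball (by linarith [hF.r_pos]))

/-- A solution starting on the axis of the cone stays in the truncated cone until its coordinate
along `ℓ` reaches the level of truncation. -/
lemma IsFold.exists_exit (hF : IsFold F ξ ℓ μ ε r κ) {G : E → E} {w : ℝ → E}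
    (hG : ∀ x ∈ Metric.ball ξ r, G x = -F x) (hw : IsSolution G w) {z₀ : ℝ} (hz₀ : 0 < z₀)
    (hz₀δ : z₀ < r / 4) (hw0 : w 0 = ξ + z₀ • ℓ) :
    ∃ T, 0 ≤ T ∧ ⟪ℓ, w T - ξ⟫ = r / 4 ∧ ∀ s ∈ Icc 0 T, w s ∈ truncatedCone ξ ℓ ε (r / 4) := by
  set z : ℝ → ℝ := fun s => ⟪ℓ, w s - ξ⟫ with hz
  set V : ℝ → ℝ := fun s => coneForm ε ℓ (w s - ξ) with hV
  have hzc : Continuous z := continuous_iff_continuousAt.2 fun s =>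
    (hasDerivAt_coordinate hw ξ ℓ s).continuousAt
  have hVc : Continuous V := (continuous_coneForm ε ℓ).comp (hw.continuous.sub continuous_const)
  have hz0 : z 0 = z₀ := by
    simp [hz, hw0, inner_smul_right, hF.unit]
  have hV0 : V 0 < 0 := by
    have h1 : V 0 = -(ε ^ 2 * z₀ ^ 2) := by
      simp [hV, hw0, coneForm, inner_smul_right, hF.unit, norm_smul]
      ring
    have := hF.eps_pos
    rw [h1]
    have : 0 < ε ^ 2 * z₀ ^ 2 := by positivity
    linarith
  set O : Set ℝ := {s | V s < 0 ∧ 0 < z s ∧ z s < r / 4} with hO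
  have hOopen : IsOpen O := (isOpen_lt hVc continuous_const).inter
    ((isOpen_lt continuous_const hzc).inter (isOpen_lt hzc continuous_const))
  have hOS : ∀ s ∈ O, w s ∈ truncatedCone ξ ℓ ε (r / 4) := fun s hs =>
    ⟨hs.1.le, hs.2.1.le, hs.2.2.le⟩
  have hOb : ∀ s ∈ O, w s ∈ Metric.ball ξ r := fun s hs => truncatedCone_subset_ball hF (hOS s hs)
  have hmono : ∀ T, (∀ s ∈ Ico 0 T, s ∈ O) → MonotoneOn z (Icc 0 T) := fun T hT => by
    refine hF.monotoneOn_coordinate hG hw (convex_Icc 0 T) (fun s hs => ?_) (fun s hs => ?_)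
    all_goals rw [interior_Icc] at hs
    · exact hOb s (hT s (Ioo_subset_Ico_self hs))
    · exact (hT s (Ioo_subset_Ico_self hs)).1.le
  have h0O : (0 : ℝ) ∈ O := ⟨hV0, by rw [hz0]; exact hz₀, by rw [hz0]; exact hz₀δ⟩
  -- A solution that never left would have its coordinate grow at rate at least `κ z₀²`, passing `r
  -- / 4` within the time `t` below.
  have hne : (Ici 0 ∩ Oᶜ).Nonempty := by
    by_contra hempty
    have hall : ∀ s, 0 ≤ s → s ∈ O := fun s hs => by
      by_contra h
      exact hempty ⟨s, hs, h⟩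
    set t := r / 4 / (κ * z₀ ^ 2) with ht
    have hκ := hF.kappa_pos
    have hr := hF.r_pos
    have ht0 : 0 ≤ t := by positivity
    have := hF.coordinate_growth hG hw hz₀.le ht0 (fun s hs => hOb s (hall s hs.1))
      (fun s hs => (hall s hs.1).1.le) (fun s hs => by
        rw [← hz0]
        exact hmono t (fun s hs => hall s hs.1) (left_mem_Icc.2 ht0) hs hs.1)
    rw [sub_zero, ht, mul_div_cancel₀ _ (by positivity)] at this
    have h2 := (hall t ht0).2.2
    change r / 4 ≤ z t - z 0 at this
    linarith
  set T := sInf (Ici 0 ∩ Oᶜ) with hT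
  have hbdd : BddBelow (Ici 0 ∩ Oᶜ) := ⟨0, fun s hs => hs.1⟩
  have hTmem : T ∈ Ici 0 ∩ Oᶜ :=
    (isClosed_Ici.inter hOopen.isClosed_compl).csInf_mem hne hbdd
  have hT0 : 0 ≤ T := hTmem.1
  have hbefore : ∀ s ∈ Ico 0 T, s ∈ O := fun s hs => by
    by_contra h
    exact absurd (csInf_le hbdd ⟨hs.1, h⟩) (not_le.2 hs.2)
  have hTpos : 0 < T := lt_of_le_of_ne hT0 fun h => hTmem.2 (h ▸ h0O)
  have hzT : 0 < z T := by
    have := hmono T hbefore (left_mem_Icc.2 hT0) (right_mem_Icc.2 hT0) hT0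
    linarith
  -- The inequality stays strict at the first exit time, and the coordinate stays positive; so the
  -- exit is through the top of the cone only.
  have hVT : V T < 0 := by
    have hξ : G ξ = 0 := by rw [hG ξ (Metric.mem_ball_self hF.r_pos), hF.zero, neg_zero]
    have hanti := antitoneOn_exp_mul (μ := μ) (convex_Icc 0 T)
      (fun s => hasDerivAt_coneForm (ε := ε) (ℓ := ℓ) ((hw s).sub_const ξ)) (fun s hs => by
        rw [interior_Icc] at hs
        have hs' := hOb s (hbefore s (Ioo_subset_Ico_self hs))
        have := hF.cone _ hs' ξ (Metric.mem_ball_self hF.r_pos)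
        rw [hF.zero, neg_zero, sub_zero, ← hG _ hs'] at this
        exact this)
    have h1 := hanti (left_mem_Icc.2 hT0) (right_mem_Icc.2 hT0) hT0
    simp only [mul_zero, Real.exp_zero, one_mul] at h1
    change _ * V T ≤ V 0 at h1
    by_contra hcon
    have := mul_nonneg (Real.exp_pos (μ * T)).le (not_lt.1 hcon)
    linarith
  have hle : z T ≤ r / 4 := by
    have hl : Tendsto z (𝓝[<] T) (𝓝 (z T)) := hzc.continuousAt.continuousWithinAt
    refine le_of_tendsto hl ?_
    filter_upwards [Ioo_mem_nhdsLT hTpos] with s hs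
    exact (hbefore s (Ioo_subset_Ico_self hs)).2.2.le
  have hge : r / 4 ≤ z T := by
    by_contra h
    exact hTmem.2 ⟨hVT, hzT, not_le.1 h⟩
  refine ⟨T, hT0, le_antisymm hle hge, fun s hs => ?_⟩
  rcases hs.2.lt_or_eq with h | h
  · exact hOS s (hbefore s ⟨hs.1, h⟩)
  · rw [h]
    exact ⟨hVT.le, hzT.le, hle⟩

/-- There is a nontrivial solution issuing from `ξ`. -/
theorem IsFold.exists_solution [FiniteDimensional ℝ E] (hF : IsFold F ξ ℓ μ ε r κ) {G : E → E}
    {K : NNReal} {M : ℝ} (hG : ∀ x ∈ Metric.ball ξ r, G x = -F x) (hK : LipschitzWith K G)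
    (hM : ∀ x, ‖G x‖ ≤ M) :
    ∃ w, IsSolution G w ∧ w 0 ≠ ξ ∧ (∀ s ≤ 0, w s ∈ Metric.ball ξ r) ∧ Tendsto w atBot (𝓝 ξ) := by
  have : ProperSpace E := FiniteDimensional.proper ℝ E
  have hr := hF.r_pos
  choose Φ hΦ0 hΦ using exists_isSolution hK hM
  have hξ : G ξ = 0 := by rw [hG ξ (Metric.mem_ball_self hr), hF.zero, neg_zero]
  have hcont : ∀ s, Continuous fun b => Φ b s := fun s => by
    refine LipschitzWith.continuous (K := Real.toNNReal (Real.exp (K * |s|))) ?_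
    refine LipschitzWith.of_dist_le_mul fun a b => ?_
    have := (hΦ a).dist_le hK (hΦ b) s
    rw [hΦ0, hΦ0] at this
    rwa [Real.coe_toNNReal _ (Real.exp_pos _).le, mul_comm]
  set S := truncatedCone ξ ℓ ε (r / 4) with hS
  -- Points on the exit section whose orbit has been in the truncated cone during the last `N` units
  -- of time. These sets are compact and nested; a common point has its whole past in the cone.
  set C : ℕ → Set E := fun N =>
    {b | ⟪ℓ, b - ξ⟫ = r / 4} ∩ (S ∩ ⋂ s ∈ Icc (-(N : ℝ)) 0, {b | Φ b s ∈ S}) with hC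
  have hCclosed : ∀ N, IsClosed (C N) := fun N => by
    have h1 : Continuous fun x : E => ⟪ℓ, x - ξ⟫ := by fun_prop
    refine (isClosed_eq h1 continuous_const).inter ((isClosed_truncatedCone _ _ _ _).inter ?_)
    exact isClosed_biInter fun s _ => (isClosed_truncatedCone _ _ _ _).preimage (hcont s)
  have hCne : ∀ N, (C N).Nonempty := fun N => by
    -- Distances to `ξ` grow at most like `exp (K s)`, so before time `N` the orbit is within `r /
    -- 8` of `ξ`, short of the exit level `r / 4`.
    set z₀ := r / 8 * Real.exp (-(K * N)) with hz₀
    have hz₀pos : 0 < z₀ := by positivity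
    have hexp : Real.exp (-(K * N : ℝ)) ≤ 1 := Real.exp_le_one_iff.2 (by
      have : (0 : ℝ) ≤ K * N := by positivity
      linarith)
    have hz₀lt : z₀ < r / 4 := by nlinarith
    set p := ξ + z₀ • ℓ with hp
    obtain ⟨T, hT0, hTz, hTS⟩ := hF.exists_exit hG (hΦ p) hz₀pos hz₀lt (hΦ0 p)
    have hNT : (N : ℝ) ≤ T := by
      by_contra hlt
      push Not at hlt
      have h1 := (hΦ p).dist_le hK (isSolution_const hξ) T
      rw [hΦ0, hp, dist_self_add_left, norm_smul, hF.unit, mul_one, Real.norm_eq_abs,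
        abs_of_pos hz₀pos, abs_of_nonneg hT0, hz₀, mul_assoc, ← Real.exp_add] at h1
      have h2 : Real.exp (-(K * N) + K * T) ≤ 1 := Real.exp_le_one_iff.2 (by
        have : (K : ℝ) * T ≤ K * N := by gcongr
        linarith)
      have h3 : r / 4 ≤ dist (Φ p T) ξ := by
        rw [← hTz, dist_eq_norm]
        simpa [hF.unit] using real_inner_le_norm ℓ (Φ p T - ξ)
      nlinarith
    have hshift : Φ (Φ p T) = fun s => Φ p (s + T) := by
      funext s
      have := (hΦ (Φ p T)).dist_le hK ((hΦ p).comp_add T) s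
      simp only [hΦ0, zero_add, dist_self, zero_mul] at this
      exact dist_le_zero.1 this
    refine ⟨Φ p T, hTz, hTS T ⟨hT0, le_rfl⟩, ?_⟩
    simp only [mem_iInter]
    intro s hs
    change Φ (Φ p T) s ∈ S
    rw [hshift]
    exact hTS _ ⟨by linarith [hs.1], by linarith [hs.2]⟩
  obtain ⟨b, hb⟩ : (⋂ N, C N).Nonempty := by
    refine IsCompact.nonempty_iInter_of_sequence_nonempty_isCompact_isClosed C ?_ hCne ?_ hCclosed
    · intro N b hb
      refine ⟨hb.1, hb.2.1, ?_⟩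
      have h := hb.2.2
      simp only [mem_iInter] at h ⊢
      intro s hs
      exact h s ⟨by push_cast; linarith [hs.1], hs.2⟩
    · refine (isCompact_closedBall ξ (2 * (r / 4))).of_isClosed_subset (hCclosed 0) ?_
      exact fun b hb => truncatedCone_subset_closedBall hF _ hb.2.1
  rw [mem_iInter] at hb
  have hbS : ∀ s ≤ 0, Φ b s ∈ S := fun s hs => by
    obtain ⟨N, hN⟩ := exists_nat_ge (-s)
    have h := (hb N).2.2
    simp only [mem_iInter] at h
    exact h s ⟨by linarith, hs⟩
  have hball : ∀ s ≤ 0, Φ b s ∈ Metric.ball ξ r := fun s hs =>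
    truncatedCone_subset_ball hF (hbS s hs)
  refine ⟨Φ b, hΦ b, ?_, hball, ?_⟩
  · rw [hΦ0]
    rintro rfl
    have := (hb 0).1
    simp at this
    linarith
  have hmono := hF.monotoneOn_coordinate hG (hΦ b) (convex_Iic 0)
    (fun s hs => hball s (mem_Iic.1 (interior_subset hs)))
    (fun s hs => (hbS s (mem_Iic.1 (interior_subset hs))).1)
  rw [Metric.tendsto_nhds]
  intro η hη
  -- If the coordinate stayed above `η / 2` for all past times, its growth over a long enough
  -- interval would exceed `r / 4`, the height of the cone.
  obtain ⟨s₀, hs₀, hs₀η⟩ : ∃ s₀ ≤ 0, ⟪ℓ, Φ b s₀ - ξ⟫ < η / 2 := by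
    by_contra! hcon
    have hκ := hF.kappa_pos
    set t := r / 4 / (κ * (η / 2) ^ 2) with ht
    have ht0 : 0 ≤ t := by positivity
    have := hF.coordinate_growth hG (hΦ b) (a := η / 2) (by positivity) (neg_nonpos.2 ht0)
      (fun s hs => hball s hs.2) (fun s hs => (hbS s hs.2).1) (fun s hs => hcon s hs.2)
    rw [sub_neg_eq_add, zero_add, ht, mul_div_cancel₀ _ (by positivity)] at this
    have h1 := (hbS 0 le_rfl).2.2
    have h2 := hcon (-t) (neg_nonpos.2 ht0)
    rw [← ht] at this
    linarith
  filter_upwards [eventually_le_atBot s₀] with s hs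
  have h1 := hmono (hs.trans hs₀) hs₀ hs
  have h2 := hbS s (hs.trans hs₀)
  have h3 := norm_sq_le_of_coneForm_nonpos hF.eps_pos.le hF.eps_le h2.1
  have h4 : ⟪ℓ, Φ b s - ξ⟫ ^ 2 ≤ (η / 2) ^ 2 :=
    pow_le_pow_left₀ h2.2.1 (h1.trans hs₀η.le) 2
  rw [dist_eq_norm]
  nlinarith [norm_nonneg (Φ b s - ξ)]

end Fold

/-! ### Verification of the fold estimates, and their consequence in time. -/

section FoldEstimates

open scoped RealInnerProductSpace

variable {E : Type*} [NormedAddCommGroup E] [InnerProductSpace ℝ E]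

/-- Second order Taylor expansion of a `C²` map. -/
theorem taylor_two_of_contDiff {F : E → E} (hF : ContDiff ℝ 2 F) (ξ : E) {κ : ℝ} (hκ : 0 < κ) :
    ∃ r > 0, ∀ x ∈ Metric.ball ξ r, ‖F x - F ξ - fderiv ℝ F ξ (x - ξ) -
      (1 / 2 : ℝ) • fderiv ℝ (fderiv ℝ F) ξ (x - ξ) (x - ξ)‖ ≤ κ * ‖x - ξ‖ ^ 2 := by
  set A := fderiv ℝ F ξ
  set D := fderiv ℝ (fderiv ℝ F) ξ with hD
  have hsymm : ∀ a b, D a b = D b a := by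
    have := (hF.contDiffAt (x := ξ)).isSymmSndFDerivAt (by simp)
    exact fun a b => this a b
  have hF1 : ContDiff ℝ 1 (fderiv ℝ F) := hF.fderiv_right (by norm_num)
  have hDF : HasFDerivAt (fderiv ℝ F) D ξ :=
    (hF1.differentiable one_ne_zero ξ).hasFDerivAt
  have hsmall := (hasFDerivAt_iff_isLittleO.1 hDF).def hκ
  obtain ⟨r, hr, hball⟩ := Metric.eventually_nhds_iff_ball.1 hsmall
  refine ⟨r, hr, fun x hx => ?_⟩
  -- By symmetry of `D`, the derivative of `ψ` is `fderiv ℝ F y - A - D (y - ξ)`, which is small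
  -- relative to `y - ξ`. The mean value inequality then gives the expansion.
  set ψ : E → E := fun y => F y - A (y - ξ) - (1 / 2 : ℝ) • D (y - ξ) (y - ξ) with hψ
  have hψd : ∀ y, HasFDerivAt ψ (fderiv ℝ F y - A - D (y - ξ)) y := by
    intro y
    have h0 : HasFDerivAt (fun y : E => y - ξ) (ContinuousLinearMap.id ℝ E) y :=
      (hasFDerivAt_id y).sub_const ξ
    have h1 := (hF.differentiable two_ne_zero y).hasFDerivAt
    have h2 := A.hasFDerivAt.comp y h0
    have h3 := ((D.hasFDerivAt.comp y h0).clm_apply h0).const_smul (1 / 2 : ℝ)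
    refine ((h1.sub h2).sub h3).congr_fderiv ?_
    ext v
    have h4 : (1 / 2 : ℝ) • (D (y - ξ) v + D v (y - ξ)) = D (y - ξ) v := by
      rw [hsymm v, ← two_smul ℝ, smul_smul]
      norm_num
    simpa using h4
  have hmv := (convex_closedBall ξ ‖x - ξ‖).norm_image_sub_le_of_norm_hasFDerivWithin_le
    (C := κ * ‖x - ξ‖) (fun y _ => (hψd y).hasFDerivWithinAt) (fun y hy => ?_)
    (Metric.mem_closedBall_self (norm_nonneg _)) (show x ∈ _ by simp [dist_eq_norm])
  · have h5 : ψ x - ψ ξ = F x - F ξ - A (x - ξ) - (1 / 2 : ℝ) • D (x - ξ) (x - ξ) := by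
      simp only [hψ, sub_self, map_zero, smul_zero, sub_zero]
      abel
    rw [h5] at hmv
    calc _ ≤ _ := hmv
      _ = _ := by ring
  · rw [mem_closedBall_iff_norm] at hy
    have hyr : y ∈ Metric.ball ξ r := by
      rw [mem_ball_iff_norm] at hx ⊢
      exact hy.trans_lt hx
    exact (hball y hyr).trans (by gcongr)

/-- A quadratic form which is positive on the nonzero vectors of a closed cone is coercive on it. -/
theorem exists_coercive_of_pos [FiniteDimensional ℝ E] {A : E →L[ℝ] E} {C : Set E}
    (hC : IsClosed C) (hsmul : ∀ y ∈ C, ∀ c : ℝ, c • y ∈ C)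
    (hpos : ∀ y ∈ C, y ≠ 0 → 0 < ⟪A y, y⟫) : ∃ μ > 0, ∀ y ∈ C, μ * ‖y‖ ^ 2 ≤ ⟪A y, y⟫ := by
  have : ProperSpace E := FiniteDimensional.proper ℝ E
  set S : Set E := Metric.sphere 0 1 ∩ C with hS
  have hScpt : IsCompact S := (isCompact_sphere 0 1).inter_right hC
  obtain ⟨μ, hμ, hμS⟩ : ∃ μ > 0, ∀ y ∈ S, μ ≤ ⟪A y, y⟫ := by
    rcases S.eq_empty_or_nonempty with h | h
    · exact ⟨1, one_pos, by simp [h]⟩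
    · obtain ⟨y, hy, hmin⟩ := hScpt.exists_isMinOn h
        (f := fun y => ⟪A y, y⟫) (by fun_prop)
      refine ⟨_, hpos y hy.2 ?_, fun x hx => hmin hx⟩
      rintro rfl
      simpa using hy.1
  refine ⟨μ, hμ, fun y hy => ?_⟩
  rcases eq_or_ne y 0 with rfl | hy0
  · simp
  have hn : 0 < ‖y‖ := norm_pos_iff.2 hy0
  have := hμS (‖y‖⁻¹ • y) ⟨by simp [norm_smul, hn.ne'], hsmul y hy _⟩
  rw [map_smul, real_inner_smul_left, real_inner_smul_right] at this
  calc μ * ‖y‖ ^ 2 ≤ (‖y‖⁻¹ * (‖y‖⁻¹ * ⟪A y, y⟫)) * ‖y‖ ^ 2 := by gcongr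
    _ = ⟪A y, y⟫ := by field_simp

/-- A positive semidefinite symmetric operator is coercive on the orthogonal complement of its
kernel, here assumed to be a line. -/
theorem exists_coercive_of_ker_subset_span [FiniteDimensional ℝ E] {A : E →L[ℝ] E} {ℓ : E}
    (hsymm : ∀ x y, ⟪A x, y⟫ = ⟪x, A y⟫) (hpos : ∀ x, 0 ≤ ⟪A x, x⟫)
    (hker : ∀ x, A x = 0 → x ∈ Submodule.span ℝ {ℓ}) :
    ∃ μ > 0, ∀ y, ⟪ℓ, y⟫ = 0 → μ * ‖y‖ ^ 2 ≤ ⟪A y, y⟫ := by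
  refine exists_coercive_of_pos (C := {y | ⟪ℓ, y⟫ = 0})
    (isClosed_eq (by fun_prop) continuous_const)
    (fun y hy c => by simp only [mem_ofPred_eq] at hy ⊢; rw [real_inner_smul_right, hy, mul_zero])
    fun y hy hy0 => ?_
  refine lt_of_le_of_ne (hpos y) fun h0 => hy0 ?_
  have hAy : A y = 0 := by
    -- This is nonnegativity of the form at `y + t • A y`. With vanishing constant term, the
    -- discriminant condition kills the linear coefficient `2 ‖A y‖²`.
    have hquad : ∀ t : ℝ, 0 ≤ ⟪A (A y), A y⟫ * (t * t) + (2 * ‖A y‖ ^ 2) * t + 0 := by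
      intro t
      have := hpos (y + t • A y)
      have e1 : ⟪A (A y), y⟫ = ‖A y‖ ^ 2 := by
        rw [hsymm, real_inner_self_eq_norm_sq]
      simp only [map_add, map_smul, inner_add_left, inner_add_right, real_inner_smul_left,
        real_inner_smul_right, ← h0, e1, real_inner_self_eq_norm_sq] at this
      linarith
    have hdisc := discrim_le_zero hquad
    rw [discrim] at hdisc
    have h1 : (2 * ‖A y‖ ^ 2) ^ 2 ≤ 0 := by linarith
    have h2 := pow_eq_zero_iff (two_ne_zero) |>.1 (le_antisymm h1 (sq_nonneg _))
    simpa using h2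
  obtain ⟨c, rfl⟩ := Submodule.mem_span_singleton.1 (hker y hAy)
  have h1 : ⟪ℓ, c • ℓ⟫ = 0 := hy
  have h2 : ⟪c • ℓ, c • ℓ⟫ = 0 := by rw [real_inner_smul_left, h1, mul_zero]
  exact inner_self_eq_zero.1 h2

set_option maxHeartbeats 1000000 in
/-- The estimates of `IsFold` at a zero of a `C²` field whose linearization is symmetric, positive
semidefinite, with kernel spanned by `ℓ`, and whose cubic coefficient along `ℓ` is negative. -/
theorem exists_isFold [FiniteDimensional ℝ E] {F : E → E} (hF : ContDiff ℝ 2 F) {ξ ℓ : E}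
    (hzero : F ξ = 0) (hunit : ‖ℓ‖ = 1)
    (hsymm : ∀ x y, ⟪fderiv ℝ F ξ x, y⟫ = ⟪x, fderiv ℝ F ξ y⟫)
    (hpos : ∀ x, 0 ≤ ⟪fderiv ℝ F ξ x, x⟫) (hℓ : fderiv ℝ F ξ ℓ = 0)
    (hker : ∀ x, fderiv ℝ F ξ x = 0 → x ∈ Submodule.span ℝ {ℓ})
    (hcubic : ⟪fderiv ℝ (fderiv ℝ F) ξ ℓ ℓ, ℓ⟫ < 0) :
    ∃ μ ε r κ, IsFold F ξ ℓ μ ε r κ := by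
  set A := fderiv ℝ F ξ with hA
  set D := fderiv ℝ (fderiv ℝ F) ξ with hD
  obtain ⟨μ, hμ, hcoer⟩ := exists_coercive_of_ker_subset_span hsymm hpos hker
  set c := -⟪D ℓ ℓ, ℓ⟫ with hc
  have hcpos : 0 < c := by linarith
  -- In the cone the transverse part has norm at most `ε |z|`, so the three cross terms of `D h h`
  -- are at most half of the main term `c z²`.
  obtain ⟨ε, hε, hε1, hεD⟩ : ∃ ε : ℝ, 0 < ε ∧ ε ≤ 1 ∧ ε * (3 * ‖D‖) ≤ c / 2 := by
    refine ⟨min 1 (c / 2 / (3 * ‖D‖ + 1)), by positivity, min_le_left _ _, ?_⟩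
    calc _ ≤ c / 2 / (3 * ‖D‖ + 1) * (3 * ‖D‖ + 1) := by
          gcongr
          · exact min_le_right _ _
          · linarith
      _ = c / 2 := by field_simp
  -- The linearization error enters the cone inequality as `6 η ‖h‖² = μ ε² (z² + ‖y‖²)`. The
  -- contraction `-2 μ ‖y‖²` absorbs it, leaving `-μ (‖y‖² - ε² z²)`.
  set η := μ * ε ^ 2 / 6 with hη
  have hηpos : 0 < η := by positivity
  have hstrict : HasStrictFDerivAt F A ξ := hF.contDiffAt.hasStrictFDerivAt two_ne_zero
  obtain ⟨r₁, hr₁, hlin⟩ : ∃ r > 0, ∀ x ∈ Metric.ball ξ r, ∀ y ∈ Metric.ball ξ r,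
      ‖F x - F y - A (x - y)‖ ≤ η * ‖x - y‖ := by
    have h1 := hstrict.isLittleO.def hηpos
    obtain ⟨r, hr, h2⟩ := Metric.eventually_nhds_iff_ball.1 h1
    refine ⟨r, hr, fun x hx y hy => h2 (x, y) ?_⟩
    rw [← ball_prod_same]
    exact ⟨hx, hy⟩
  -- In the cone `‖h‖² ≤ 2 z²`, so the remainder costs `c / 8` out of the `c / 4` left by the
  -- quadratic term, whence `κ = c / 8`.
  obtain ⟨r₂, hr₂, htay⟩ := taylor_two_of_contDiff hF ξ (κ := c / 16) (by positivity)
  have hyorth : ∀ h : E, ⟪ℓ, h - ⟪ℓ, h⟫ • ℓ⟫ = 0 := fun h => by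
    rw [inner_sub_right, real_inner_smul_right, real_inner_self_eq_norm_sq, hunit]; ring
  have hAy : ∀ h : E, A (h - ⟪ℓ, h⟫ • ℓ) = A h := fun h => by simp [hℓ]
  have hℓA : ∀ h : E, ⟪ℓ, A h⟫ = 0 := fun h => by rw [← hsymm, hℓ, inner_zero_left]
  have hpyth : ∀ h : E, ‖h‖ ^ 2 = ⟪ℓ, h⟫ ^ 2 + ‖h - ⟪ℓ, h⟫ • ℓ‖ ^ 2 := fun h => by
    rw [norm_sub_sq_real, norm_smul, real_inner_smul_right, real_inner_comm, hunit,
      Real.norm_eq_abs, mul_one, sq_abs]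
    ring
  have hAcoer : ∀ h : E, μ * ‖h - ⟪ℓ, h⟫ • ℓ‖ ^ 2 ≤ ⟪h, A h⟫ := fun h => by
    refine (hcoer _ (hyorth h)).trans (le_of_eq ?_)
    rw [hAy, inner_sub_right, real_inner_smul_right, real_inner_comm ℓ, hℓA, mul_zero, sub_zero,
      real_inner_comm]
  refine ⟨μ, ε, min r₁ r₂, c / 8, hzero, hunit, hμ, hε, hε1, lt_min hr₁ hr₂, by positivity,
    ?_, ?_, ?_⟩
  · intro x hx y hy
    have hx := Metric.ball_subset_ball (min_le_left r₁ r₂) hx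
    have hy := Metric.ball_subset_ball (min_le_left r₁ r₂) hy
    set h := x - y with hh
    set e := F x - F y - A h with he
    have hle : ‖e‖ ≤ η * ‖h‖ := hlin x hx y hy
    have hFxy : -F x - -F y = -(A h + e) := by rw [he]; abel
    rw [hFxy, inner_neg_right, inner_neg_right, inner_add_right, inner_add_right, hℓA, zero_add]
    have h1 : -⟪h, e⟫ ≤ η * ‖h‖ ^ 2 := by
      have := neg_le_of_abs_le (abs_real_inner_le_norm h e)
      nlinarith [norm_nonneg h]
    have h2 : ⟪ℓ, h⟫ * ⟪ℓ, e⟫ ≤ η * ‖h‖ ^ 2 := by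
      have h3 := abs_real_inner_le_norm ℓ h
      have h4 := abs_real_inner_le_norm ℓ e
      rw [hunit, one_mul] at h3 h4
      calc _ ≤ |⟪ℓ, h⟫ * ⟪ℓ, e⟫| := le_abs_self _
        _ = |⟪ℓ, h⟫| * |⟪ℓ, e⟫| := abs_mul _ _
        _ ≤ ‖h‖ * (η * ‖h‖) := by gcongr; exact h4.trans hle
        _ = _ := by ring
    have h5 := hAcoer h
    have h6 := hpyth h
    set q := ‖h - ⟪ℓ, h⟫ • ℓ‖ ^ 2 with hq
    have hq0 : 0 ≤ q := sq_nonneg _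
    have hp0 := sq_nonneg ⟪ℓ, h⟫
    have hε2 : ε ^ 2 ≤ 1 := by nlinarith
    unfold coneForm
    have h7 : (1 + ε ^ 2) * (⟪ℓ, h⟫ * ⟪ℓ, e⟫) ≤ 2 * (η * ‖h‖ ^ 2) := by
      have h8 : 0 ≤ η * ‖h‖ ^ 2 := by positivity
      calc _ ≤ (1 + ε ^ 2) * (η * ‖h‖ ^ 2) := by gcongr
        _ ≤ 2 * (η * ‖h‖ ^ 2) := by gcongr; linarith
    have h9 : 6 * (η * ‖h‖ ^ 2) = μ * ε ^ 2 * ⟪ℓ, h⟫ ^ 2 + μ * ε ^ 2 * q := by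
      rw [h6, hη]; ring
    have h10 : μ * ε ^ 2 * q ≤ μ * q := by
      have : μ * ε ^ 2 ≤ μ := by nlinarith
      gcongr
    rw [h6] at h9 h1 h7 ⊢
    linarith
  · intro x hx hcone
    have hx := Metric.ball_subset_ball (min_le_right r₁ r₂) hx
    have h1 := htay x hx
    rw [hzero, sub_zero] at h1
    set h := x - ξ with hh
    set z := ⟪ℓ, h⟫ with hz
    set y := h - z • ℓ with hy
    have hhzy : h = z • ℓ + y := by rw [hy]; abel
    have h2 := norm_sq_le_of_coneForm_nonpos hε.le hε1 hcone
    have hyz : ‖y‖ ≤ ε * |z| := by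
      have h3 := hpyth h
      rw [coneForm] at hcone
      refine abs_le_of_sq_le_sq' ?_ (by positivity) |>.2
      rw [mul_pow, sq_abs]
      linarith
    have hDh : ⟪ℓ, D h h⟫ ≤ -(c / 2) * z ^ 2 := by
      have e1 : D h h = z ^ 2 • D ℓ ℓ + (z • D ℓ y + z • D y ℓ + D y y) := by
        rw [hhzy]
        simp only [map_add, map_smul, add_apply, smul_apply]
        module
      have e2 : ‖z • D ℓ y + z • D y ℓ + D y y‖ ≤ ε * (3 * ‖D‖) * z ^ 2 := by
        have b1 : ‖D ℓ y‖ ≤ ‖D‖ * ‖y‖ := by simpa [hunit] using D.le_opNorm₂ ℓ y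
        have b2 : ‖D y ℓ‖ ≤ ‖D‖ * ‖y‖ := by simpa [hunit] using D.le_opNorm₂ y ℓ
        have b3 : ‖D y y‖ ≤ ‖D‖ * ‖y‖ * ‖y‖ := D.le_opNorm₂ y y
        have hy1 : ‖y‖ ≤ |z| := hyz.trans (by nlinarith [abs_nonneg z])
        calc _ ≤ ‖z • D ℓ y‖ + ‖z • D y ℓ‖ + ‖D y y‖ := norm_add₃_le
          _ ≤ |z| * (‖D‖ * ‖y‖) + |z| * (‖D‖ * ‖y‖) + ‖D‖ * ‖y‖ * |z| := by
              rw [norm_smul, norm_smul, Real.norm_eq_abs]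
              gcongr
              exact b3.trans (by gcongr)
          _ = 3 * ‖D‖ * |z| * ‖y‖ := by ring
          _ ≤ 3 * ‖D‖ * |z| * (ε * |z|) := by gcongr
          _ = ε * (3 * ‖D‖) * |z| ^ 2 := by ring
          _ = _ := by rw [sq_abs]
      have e3 := (le_abs_self _).trans
        (abs_real_inner_le_norm ℓ (z • D ℓ y + z • D y ℓ + D y y))
      rw [hunit, one_mul] at e3
      rw [e1, inner_add_right, real_inner_smul_right, real_inner_comm]
      have e4 : ⟪D ℓ ℓ, ℓ⟫ = -c := by rw [hc]; ring
      rw [e4]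
      nlinarith [mul_le_mul_of_nonneg_right hεD (sq_nonneg z)]
    set R := F x - A h - (1 / 2 : ℝ) • D h h with hR
    have hFx : F x = A h + (1 / 2 : ℝ) • D h h + R := by rw [hR]; abel
    have h4 : ⟪ℓ, R⟫ ≤ c / 16 * (2 * z ^ 2) := by
      have := (le_abs_self _).trans (abs_real_inner_le_norm ℓ R)
      rw [hunit, one_mul] at this
      exact this.trans (h1.trans (by gcongr))
    rw [hFx, inner_neg_right, inner_add_right, inner_add_right, hℓA, real_inner_smul_right]
    linarith
  · intro x hx hcone
    have hx := Metric.ball_subset_ball (min_le_left r₁ r₂) hx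
    have h1 := hlin x hx ξ (Metric.mem_ball_self hr₁)
    rw [hzero, sub_zero] at h1
    set h := x - ξ with hh
    set z := ⟪ℓ, h⟫ with hz
    set y := h - z • ℓ with hy
    have h3 := hpyth h
    have hyh : ε * ‖h‖ ≤ 3 / 2 * ‖y‖ := by
      refine abs_le_of_sq_le_sq' ?_ (by positivity) |>.2
      rw [coneForm] at hcone
      have h4 : ε ^ 2 * z ^ 2 ≤ ‖y‖ ^ 2 := by linarith
      have h5 : ε ^ 2 * ‖y‖ ^ 2 ≤ ‖y‖ ^ 2 := by
        have : ε ^ 2 ≤ 1 := by nlinarith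
        nlinarith [sq_nonneg ‖y‖]
      rw [mul_pow, h3]
      nlinarith [sq_nonneg ‖y‖]
    -- Pairing with the transverse part `y`: there `A` is coercive, and outside the cone `y`
    -- controls all of `h`.
    have h6 : μ * ‖y‖ ^ 2 - η * ‖h‖ * ‖y‖ ≤ ‖F x‖ * ‖y‖ := by
      have e1 : ⟪y, F x⟫ = ⟪h, A h⟫ + ⟪y, F x - A h⟫ := by
        rw [inner_sub_right]
        have : ⟪y, A h⟫ = ⟪h, A h⟫ := by
          rw [hy, inner_sub_left, real_inner_smul_left, hℓA, mul_zero, sub_zero]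
        rw [this]; ring
      have e2 := hAcoer h
      have e3 := neg_le_of_abs_le (abs_real_inner_le_norm y (F x - A h))
      have e4 := (le_abs_self _).trans (abs_real_inner_le_norm y (F x))
      have e5 : ‖y‖ * ‖F x - A h‖ ≤ ‖y‖ * (η * ‖h‖) := by gcongr
      change μ * ‖y‖ ^ 2 ≤ _ at e2
      linarith
    have h7 : η * ‖h‖ ≤ μ / 4 * ‖y‖ := by
      have : η * ‖h‖ = μ * ε / 6 * (ε * ‖h‖) := by rw [hη]; ring
      rw [this]
      calc _ ≤ μ * ε / 6 * (3 / 2 * ‖y‖) := by gcongr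
        _ ≤ μ * 1 / 6 * (3 / 2 * ‖y‖) := by gcongr
        _ = _ := by ring
    rcases (norm_nonneg y).eq_or_lt with h0 | h0
    · rw [← h0, mul_zero] at hyh
      have : ‖h‖ = 0 := le_antisymm (by nlinarith [norm_nonneg h]) (norm_nonneg h)
      rw [this, mul_zero]
      exact norm_nonneg _
    · have h8 : 3 / 4 * μ * ‖y‖ ≤ ‖F x‖ := by
        refine le_of_mul_le_mul_right ?_ h0
        nlinarith [mul_le_mul_of_nonneg_right h7 h0.le]
      calc μ * ε / 4 * ‖h‖ = μ / 4 * (ε * ‖h‖) := by ring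
        _ ≤ μ / 4 * (3 / 2 * ‖y‖) := by gcongr
        _ ≤ 3 / 4 * μ * ‖y‖ := by nlinarith [mul_pos hμ h0]
        _ ≤ _ := h8

/-- If zeros of `F t` approach a fold point of `F τ` as `t ↑ τ`, then the time derivative of the
component of `F` along `ℓ` is nonpositive. -/
theorem IsFold.timeDeriv_nonpos {F : ℝ → E → E} {τ : ℝ} {ξ ℓ : E} {μ ε r κ : ℝ}
    (hF : IsFold (F τ) ξ ℓ μ ε r κ) {D : ℝ × E →L[ℝ] E}
    (hD : HasStrictFDerivAt (Function.uncurry F) D (τ, ξ)) (hDℓ : ∀ h, ⟪ℓ, D (0, h)⟫ = 0)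
    {u : ℝ → E} (hu : Tendsto u (𝓝[<] τ) (𝓝 ξ)) (hzero : ∀ᶠ t in 𝓝[<] τ, F t (u t) = 0) :
    ⟪ℓ, D (1, 0)⟫ ≤ 0 := by
  by_contra! ha
  set a := ⟪ℓ, D (1, 0)⟫ with hadef
  have hμ := hF.mu_pos
  have hε := hF.eps_pos
  set ν := μ * ε / 4 with hν
  have hνpos : 0 < ν := by positivity
  set B := ‖D (1, 0)‖ + 1 with hB
  have hBpos : 0 < B := by positivity
  -- The first bound makes `‖F τ x‖ ≤ B s`, the second preserves the sign of the time term, and the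
  -- third beats the displacement `‖x - ξ‖ ≤ B s / ν` available outside the cone.
  set σ := min 1 (min (a / 2) (a * ν / (4 * B))) with hσ
  have hσpos : 0 < σ := by positivity
  have hσ1 : σ ≤ 1 := min_le_left _ _
  have hσa : σ ≤ a / 2 := (min_le_right _ _).trans (min_le_left _ _)
  have hσν : σ * (4 * B) ≤ a * ν := by
    calc _ ≤ a * ν / (4 * B) * (4 * B) := by
          gcongr
          exact (min_le_right _ _).trans (min_le_right _ _)
      _ = _ := by field_simp
  have hlim : Tendsto (fun t => (t, u t)) (𝓝[<] τ) (𝓝 (τ, ξ)) :=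
    (tendsto_nhdsWithin_of_tendsto_nhds tendsto_id).prodMk_nhds hu
  have hlim' : Tendsto (fun t => (τ, u t)) (𝓝[<] τ) (𝓝 (τ, ξ)) := tendsto_const_nhds.prodMk_nhds hu
  have hev := hD.isLittleO.def hσpos
  have h1 := (hlim.prodMk_nhds (tendsto_const_nhds (x := (τ, ξ)))).eventually hev
  have h2 := (hlim.prodMk_nhds hlim').eventually hev
  obtain ⟨t, h1, h2, h0, hball, hlt⟩ := (h1.and (h2.and (hzero.and
    ((hu.eventually (Metric.ball_mem_nhds ξ hF.r_pos)).and self_mem_nhdsWithin)))).exists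
  have hlt : t < τ := hlt
  simp only [Function.uncurry_apply_pair, h0, hF.zero, Prod.mk_sub_mk, sub_self, zero_sub] at h1 h2
  set x := u t with hx
  set s := τ - t with hs
  have hspos : 0 < s := sub_pos.2 hlt
  have hts : t - τ = -s := by rw [hs]; ring
  rw [hts] at h1 h2
  have hn2 : ‖((-s, 0) : ℝ × E)‖ = s := by simp [Prod.norm_def, abs_of_pos hspos, hspos.le]
  have hDs : ∀ h, D (-s, h) = -(s • D (1, 0)) + D (0, h) := fun h => by
    rw [← map_smul, ← map_neg, ← map_add]; simp
  have hinner : ∀ h, ⟪ℓ, D (-s, h)⟫ = -(s * a) := fun h => by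
    rw [hDs, inner_add_right, inner_neg_right, real_inner_smul_right, hDℓ, add_zero]
  rw [hn2] at h2
  have hFx : ‖F τ x‖ ≤ B * s := by
    have h3 : ‖D (-s, 0)‖ ≤ ‖D (1, 0)‖ * s := by
      rw [hDs, show ((0 : ℝ), (0 : E)) = 0 from rfl, map_zero, add_zero, norm_neg, norm_smul,
        Real.norm_eq_abs, abs_of_pos hspos, mul_comm]
    have h4 : -F τ x = (-F τ x - D (-s, 0)) + D (-s, 0) := by abel
    rw [← norm_neg, h4]
    refine (norm_add_le _ _).trans ?_
    calc _ ≤ σ * s + ‖D (1, 0)‖ * s := add_le_add h2 h3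
      _ ≤ 1 * s + ‖D (1, 0)‖ * s := by gcongr
      _ = B * s := by rw [hB]; ring
  rcases le_total (coneForm ε ℓ (x - ξ)) 0 with hc | hc
  -- In the cone the drift makes the `ℓ`-component of `-F τ x` nonnegative, while changing only the
  -- time gives about `-s a < 0`.
  · have h5 := hF.drift x hball hc
    have h6 := (neg_le_of_abs_le (abs_real_inner_le_norm ℓ (-F τ x - D (-s, 0))))
    have h6' := (le_abs_self _).trans (abs_real_inner_le_norm ℓ (-F τ x - D (-s, 0)))
    rw [hF.unit, one_mul] at h6 h6'
    rw [inner_sub_right, hinner] at h6 h6'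
    have h7 : 0 ≤ κ * ⟪ℓ, x - ξ⟫ ^ 2 := mul_nonneg hF.kappa_pos.le (sq_nonneg _)
    have h8 : σ * s ≤ a / 2 * s := by gcongr
    have h9 : 0 < s * a := mul_pos hspos ha
    linarith
  -- Outside the cone `‖x - ξ‖` is of order `s`. Expanding `F t x = 0` around `(τ, ξ)` leaves `-s a`
  -- along `ℓ`, since `D (0, ·)` has no `ℓ`-component, and this exceeds the error.
  · have h5 := hF.transverse x hball hc
    have h6 : s * a ≤ σ * (s + ‖x - ξ‖) := by
      have h7 := abs_real_inner_le_norm ℓ (D (-s, x - ξ))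
      have h8 : ‖((-s, x - ξ) : ℝ × E)‖ ≤ s + ‖x - ξ‖ := by
        rw [Prod.norm_def, Real.norm_eq_abs, abs_neg, abs_of_pos hspos]
        exact max_le (by linarith [norm_nonneg (x - ξ)]) (by linarith)
      rw [norm_neg] at h1
      rw [hinner, abs_neg, abs_of_pos (mul_pos hspos ha), hF.unit, one_mul] at h7
      exact h7.trans (h1.trans (by gcongr))
    have h9 : ν * ‖x - ξ‖ ≤ B * s := h5.trans hFx
    have h10 : s * a / 2 ≤ σ * ‖x - ξ‖ := by
      have : σ * s ≤ a / 2 * s := by gcongr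
      linarith
    have h11 : s * a / 2 * (4 * B) ≤ a * ν * ‖x - ξ‖ := by
      calc _ ≤ σ * ‖x - ξ‖ * (4 * B) := by gcongr
        _ = σ * (4 * B) * ‖x - ξ‖ := by ring
        _ ≤ _ := by gcongr
    have h12 : a * ν * ‖x - ξ‖ ≤ a * (B * s) := by
      rw [mul_assoc]; gcongr
    have : 0 < a * (B * s) := by positivity
    linarith

end FoldEstimates

/-! ### Regularity of spatial derivatives on the closed time strip. -/

section Slices

variable {E H : Type*} [NormedAddCommGroup E] [NormedSpace ℝ E] [NormedAddCommGroup H]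
  [NormedSpace ℝ H]

lemma uniqueDiffOn_strip {T : ℝ} (hT : 0 < T) :
    UniqueDiffOn ℝ (Icc 0 T ×ˢ (univ : Set E)) := (uniqueDiffOn_Icc hT).prod uniqueDiffOn_univ

lemma hasFDerivAt_slice {T : ℝ} {G : ℝ → E → H} {D : ℝ × E →L[ℝ] H} {t : ℝ} {x : E}
    (ht : t ∈ Icc 0 T)
    (hG : HasFDerivWithinAt (Function.uncurry G) D (Icc 0 T ×ˢ univ) (t, x)) :
    HasFDerivAt (G t) (D.comp (ContinuousLinearMap.inr ℝ ℝ E)) x := by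
  have h1 : HasFDerivAt (fun y : E => (t, y)) (ContinuousLinearMap.inr ℝ ℝ E) x :=
    hasFDerivAt_prodMk_right t x
  have := hG.comp (s := univ) x h1.hasFDerivWithinAt (fun y _ => ⟨ht, mem_univ y⟩)
  rw [hasFDerivWithinAt_univ] at this
  exact this

lemma fderiv_slice {T : ℝ} {G : ℝ → E → H} {m : WithTop ℕ∞} (hm : m ≠ 0)
    (hG : ContDiffOn ℝ m (Function.uncurry G) (Icc 0 T ×ˢ univ)) {t : ℝ} (ht : t ∈ Icc 0 T)
    (x : E) : HasFDerivAt (G t) (fderiv ℝ (G t) x) x ∧ fderiv ℝ (G t) x =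
      (fderivWithin ℝ (Function.uncurry G) (Icc 0 T ×ˢ univ) (t, x)).comp
        (ContinuousLinearMap.inr ℝ ℝ E) := by
  have h := hasFDerivAt_slice ht
    ((hG.differentiableOn hm (t, x) ⟨ht, mem_univ x⟩).hasFDerivWithinAt)
  exact ⟨h.differentiableAt.hasFDerivAt, h.fderiv⟩

/-- The spatial derivative is the derivative within the strip restricted to spatial directions, so
it is jointly regular up to the end times. -/
lemma contDiffOn_fderiv_slice {T : ℝ} (hT : 0 < T) {G : ℝ → E → H} {m k : WithTop ℕ∞}
    (hk : m + 1 ≤ k) (hG : ContDiffOn ℝ k (Function.uncurry G) (Icc 0 T ×ˢ univ)) :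
    ContDiffOn ℝ m (fun p : ℝ × E => fderiv ℝ (G p.1) p.2) (Icc 0 T ×ˢ univ) := by
  have h1 := hG.fderivWithin (uniqueDiffOn_strip hT) hk
  have h2 : ContDiffOn ℝ m (fun p : ℝ × E =>
      (fderivWithin ℝ (Function.uncurry G) (Icc 0 T ×ˢ univ) p).comp
        (ContinuousLinearMap.inr ℝ ℝ E)) (Icc 0 T ×ˢ univ) := h1.clm_comp contDiffOn_const
  refine h2.congr fun p hp => (fderiv_slice ?_ hG hp.1 p.2).2
  rintro rfl
  simp at hk

lemma contDiff_slice {T : ℝ} {G : ℝ → E → H} {m : WithTop ℕ∞}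
    (hG : ContDiffOn ℝ m (Function.uncurry G) (Icc 0 T ×ˢ univ)) {t : ℝ} (ht : t ∈ Icc 0 T) :
    ContDiff ℝ m (G t) := by
  rw [← contDiffOn_univ]
  exact hG.comp (s := univ) (f := fun y : E => (t, y)) (by fun_prop) (fun y _ => ⟨ht, mem_univ y⟩)

end Slices

/-! ### Local branches of nondegenerate zeros. -/

section Branches

open scoped RealInnerProductSpace

variable {E : Type*} [NormedAddCommGroup E] [InnerProductSpace ℝ E]

/-- The quadratic form of the operator `A` is positive definite. -/
def PosOp (A : E →L[ℝ] E) : Prop := ∀ v, v ≠ 0 → 0 < ⟪A v, v⟫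

lemma PosOp.exists_coercive [FiniteDimensional ℝ E] {A : E →L[ℝ] E} (hA : PosOp A) :
    ∃ m > 0, ∀ v, m * ‖v‖ ^ 2 ≤ ⟪A v, v⟫ := by
  obtain ⟨m, hm, h⟩ := exists_coercive_of_pos (A := A) (C := univ) isClosed_univ
    (fun _ _ _ => mem_univ _) (fun y _ hy => hA y hy)
  exact ⟨m, hm, fun v => h v (mem_univ v)⟩

lemma PosOp.injective {A : E →L[ℝ] E} (hA : PosOp A) : Function.Injective A := by
  refine (injective_iff_map_eq_zero A).2 fun v hv => ?_
  by_contra h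
  have := hA v h
  simp [hv] at this

lemma PosOp.isInvertible [FiniteDimensional ℝ E] {A : E →L[ℝ] E} (hA : PosOp A) :
    A.IsInvertible :=
  ⟨(LinearEquiv.ofInjectiveEndo A.toLinearMap hA.injective).toContinuousLinearEquiv, by
    ext v; simp⟩

/-- `u` is a continuous branch on `[a, b)` of zeros of `F t` with positive definite
linearization. -/
structure IsBranch (F : ℝ → E → E) (a b : ℝ) (u : ℝ → E) : Prop where
  continuousOn : ContinuousOn u (Ico a b)
  zero : ∀ s ∈ Ico a b, F s (u s) = 0
  pos : ∀ s ∈ Ico a b, PosOp (fderiv ℝ (F s) (u s))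

variable {T : ℝ} {F : ℝ → E → E}

/-- Near a zero with positive definite linearization, the zeros of `F t` form a unique continuous
branch. -/
theorem exists_local_branch [FiniteDimensional ℝ E] (hT : 0 < T)
    (hF : ContDiffOn ℝ 2 (Function.uncurry F) (Icc 0 T ×ˢ univ)) {t₀ : ℝ} {y₀ : E}
    (ht₀ : t₀ ∈ Icc 0 T) (hy₀ : F t₀ y₀ = 0) (hpos : PosOp (fderiv ℝ (F t₀) y₀)) :
    ∃ δ > 0, ∃ ρ > 0, ∃ U : ℝ → E, U t₀ = y₀ ∧ ContinuousOn U (Icc 0 T ∩ Metric.ball t₀ δ) ∧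
      ∀ t ∈ Icc 0 T ∩ Metric.ball t₀ δ, F t (U t) = 0 ∧ PosOp (fderiv ℝ (F t) (U t)) ∧
        ∀ x ∈ Metric.ball y₀ ρ, F t x = 0 → x = U t := by
  -- An implicit function argument that also works one-sidedly at `0` and `T`. Uniformly in `t`, the
  -- map `F t` is within slope `m / 2` of `A`, which expands by `m`. So `F t` is injective near `y₀`
  -- with constant `m / 2`, and covers a ball of radius `m / 2 * (ρ / 2)` around `F t y₀`, which
  -- contains `0`.
  obtain ⟨m, hm, hcoer⟩ := hpos.exists_coercive
  set A := fderiv ℝ (F t₀) y₀ with hA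
  have hAc : ContinuousWithinAt (fun p : ℝ × E => fderiv ℝ (F p.1) p.2) (Icc 0 T ×ˢ univ)
      (t₀, y₀) := (contDiffOn_fderiv_slice (m := 1) hT (by norm_num) hF).continuousOn _
        ⟨ht₀, mem_univ _⟩
  have hev := Metric.tendsto_nhds.1 hAc (m / 2) (by positivity)
  obtain ⟨ρ, hρ, hball⟩ := Metric.mem_nhdsWithin_iff.1 hev
  have hnear : ∀ t ∈ Icc 0 T ∩ Metric.ball t₀ ρ, ∀ x ∈ Metric.ball y₀ ρ,
      ‖fderiv ℝ (F t) x - A‖ < m / 2 := by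
    intro t ht x hx
    have := hball (show (t, x) ∈ _ from
      ⟨by rw [← ball_prod_same]; exact ⟨ht.2, hx⟩, ht.1, mem_univ x⟩)
    rwa [← dist_eq_norm]
  have hFt : ContinuousWithinAt (fun t => F t y₀) (Icc 0 T) t₀ :=
    (hF.continuousOn (t₀, y₀) ⟨ht₀, mem_univ _⟩).comp (f := fun t => (t, y₀)) (s := Icc 0 T)
      (by fun_prop) (fun t ht => ⟨ht, mem_univ _⟩)
  have hev' := Metric.tendsto_nhds.1 hFt (m / 2 * (ρ / 2)) (by positivity)
  obtain ⟨δ', hδ', hball'⟩ := Metric.mem_nhdsWithin_iff.1 hev'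
  set δ := min ρ δ' with hδ
  have hδpos : 0 < δ := lt_min hρ hδ'
  have happ : ∀ t ∈ Icc 0 T ∩ Metric.ball t₀ δ,
      ApproximatesLinearOn (F t) A (Metric.ball y₀ ρ) ⟨m / 2, by positivity⟩ := by
    intro t ht x hx y hy
    have hd : ∀ z ∈ Metric.ball y₀ ρ, HasFDerivWithinAt (fun z => F t z - A z)
        (fderiv ℝ (F t) z - A) (Metric.ball y₀ ρ) z := fun z _ =>
      ((fderiv_slice two_ne_zero hF ht.1 z).1.sub A.hasFDerivAt).hasFDerivWithinAt
    have := (convex_ball y₀ ρ).norm_image_sub_le_of_norm_hasFDerivWithin_le hd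
      (fun z hz => (hnear t ⟨ht.1, Metric.ball_subset_ball (min_le_left _ _) ht.2⟩ z hz).le) hy hx
    have e : F t x - F t y - A (x - y) = F t x - A x - (F t y - A y) := by
      rw [map_sub]; abel
    rw [e]
    exact this
  have hmono : ∀ t ∈ Icc 0 T ∩ Metric.ball t₀ δ, ∀ x ∈ Metric.ball y₀ ρ, ∀ y ∈ Metric.ball y₀ ρ,
      m / 2 * ‖x - y‖ ≤ ‖F t x - F t y‖ := by
    intro t ht x hx y hy
    have h1 : ‖F t x - F t y - A (x - y)‖ ≤ m / 2 * ‖x - y‖ := happ t ht x hx y hy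
    have h2 : m * ‖x - y‖ ≤ ‖A (x - y)‖ := by
      rcases (norm_nonneg (x - y)).eq_or_lt with h0 | h0
      · rw [← h0, mul_zero]; exact norm_nonneg _
      · refine le_of_mul_le_mul_right ?_ h0
        have := (hcoer (x - y)).trans (real_inner_le_norm _ _)
        nlinarith
    have h3 := norm_sub_norm_le (A (x - y)) (F t x - F t y)
    rw [norm_sub_rev (A (x - y))] at h3
    linarith
  obtain ⟨e, he⟩ := hpos.isInvertible
  have hex : ∀ t ∈ Icc 0 T ∩ Metric.ball t₀ δ, ∃ x ∈ Metric.ball y₀ ρ, F t x = 0 := by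
    intro t ht
    let R : A.NonlinearRightInverse :=
      { toFun := e.symm
        nnnorm := ⟨m⁻¹, by positivity⟩
        bound' := fun y => by
          have h1 : A (e.symm y) = y := by rw [← he]; simp
          have h2 := (hcoer (e.symm y)).trans (real_inner_le_norm _ _)
          rw [h1] at h2
          change _ ≤ m⁻¹ * ‖y‖
          rw [inv_mul_eq_div, le_div_iff₀ hm]
          rcases (norm_nonneg (e.symm y)).eq_or_lt with h0 | h0
          · rw [← h0, zero_mul]; exact norm_nonneg _
          · refine le_of_mul_le_mul_right ?_ h0
            nlinarith
        right_inv' := fun y => by rw [← he]; simp }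
    have hsurj := (happ t ht).surjOn_closedBall_of_nonlinearRightInverse R (b := y₀)
      (ε := ρ / 2) (by positivity) (Metric.closedBall_subset_ball (by linarith))
    have h0 : (0 : E) ∈ Metric.closedBall (F t y₀) ((((R.nnnorm : NNReal) : ℝ)⁻¹ -
        ((⟨m / 2, by positivity⟩ : NNReal) : ℝ)) * (ρ / 2)) := by
      have h1 : dist (F t y₀) (F t₀ y₀) < m / 2 * (ρ / 2) :=
        hball' ⟨Metric.ball_subset_ball (min_le_right _ _) ht.2, ht.1⟩
      rw [hy₀] at h1
      have h2 : (((R.nnnorm : NNReal) : ℝ)⁻¹ - ((⟨m / 2, by positivity⟩ : NNReal) : ℝ)) = m / 2 := by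
        change (m⁻¹)⁻¹ - m / 2 = m / 2
        rw [inv_inv]; ring
      rw [h2, Metric.mem_closedBall, dist_comm]
      exact h1.le
    obtain ⟨x, hx, hx0⟩ := hsurj h0
    exact ⟨x, Metric.closedBall_subset_ball (by linarith) hx, hx0⟩
  choose! U hUb hU0 using hex
  have huniq : ∀ t ∈ Icc 0 T ∩ Metric.ball t₀ δ, ∀ x ∈ Metric.ball y₀ ρ, F t x = 0 → x = U t := by
    intro t ht x hx hx0
    have := hmono t ht x hx (U t) (hUb t ht)
    rw [hx0, hU0 t ht, sub_zero, norm_zero] at this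
    have : ‖x - U t‖ ≤ 0 := by nlinarith [norm_nonneg (x - U t)]
    exact sub_eq_zero.1 (norm_le_zero_iff.1 this)
  refine ⟨δ, hδpos, ρ, hρ, U, ?_, ?_, fun t ht => ⟨hU0 t ht, ?_, huniq t ht⟩⟩
  · exact (huniq t₀ ⟨ht₀, Metric.mem_ball_self hδpos⟩ y₀ (Metric.mem_ball_self hρ) hy₀).symm
  · intro t₁ ht₁
    have hFt₁ : ContinuousWithinAt (fun t => F t (U t₁)) (Icc 0 T) t₁ :=
      (hF.continuousOn (t₁, U t₁) ⟨ht₁.1, mem_univ _⟩).comp (f := fun t => (t, U t₁))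
        (s := Icc 0 T) (by fun_prop) (fun t ht => ⟨ht, mem_univ _⟩)
    have hlim : Tendsto (fun t => 2 / m * ‖F t (U t₁)‖) (𝓝[Icc 0 T ∩ Metric.ball t₀ δ] t₁)
        (𝓝 0) := by
      have := ((hFt₁.mono (inter_subset_left (t := Metric.ball t₀ δ))).norm).const_mul (2 / m)
      simpa [ContinuousWithinAt, hU0 t₁ ht₁] using this
    rw [ContinuousWithinAt, tendsto_iff_norm_sub_tendsto_zero]
    refine tendsto_of_tendsto_of_tendsto_of_le_of_le' tendsto_const_nhds hlim
      (Eventually.of_forall fun t => norm_nonneg _) ?_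
    filter_upwards [self_mem_nhdsWithin] with t ht
    have := hmono t ht (U t) (hUb t ht) (U t₁) (hUb t₁ ht₁)
    rw [hU0 t ht, zero_sub, norm_neg] at this
    calc ‖U t - U t₁‖ = 2 / m * (m / 2 * ‖U t - U t₁‖) := by field_simp
      _ ≤ _ := by gcongr
  · intro v hv
    have h1 := (hnear t ⟨ht.1, Metric.ball_subset_ball (min_le_left _ _) ht.2⟩ (U t) (hUb t ht)).le
    have h2 : ⟪fderiv ℝ (F t) (U t) v, v⟫ = ⟪A v, v⟫ + ⟪(fderiv ℝ (F t) (U t) - A) v, v⟫ := by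
      rw [← inner_add_left]; simp
    have h3 := neg_le_of_abs_le (abs_real_inner_le_norm ((fderiv ℝ (F t) (U t) - A) v) v)
    have h4 : ‖(fderiv ℝ (F t) (U t) - A) v‖ * ‖v‖ ≤ m / 2 * ‖v‖ * ‖v‖ := by
      gcongr
      exact ContinuousLinearMap.le_of_opNorm_le _ h1 v
    have h5 := hcoer v
    have h6 : 0 < m * ‖v‖ ^ 2 := by
      have := norm_pos_iff.2 hv
      positivity
    rw [h2]
    nlinarith

/-- Two branches with the same initial value coincide. -/
theorem IsBranch.eqOn [FiniteDimensional ℝ E] (hT : 0 < T)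
    (hF : ContDiffOn ℝ 2 (Function.uncurry F) (Icc 0 T ×ˢ univ)) {a b : ℝ} (ha : 0 ≤ a)
    (hb : b ≤ T) {u v : ℝ → E} (hu : IsBranch F a b u) (hv : IsBranch F a b v) (huv : u a = v a) :
    EqOn u v (Ico a b) := by
  intro s hs
  have hsub : Icc a s ⊆ Ico a b := fun x hx => ⟨hx.1, hx.2.trans_lt hs.2⟩
  have hIcc : Ico a b ⊆ Icc 0 T := fun x hx => ⟨ha.trans hx.1, hx.2.le.trans hb⟩
  have hclosed : IsClosed ({x | u x = v x} ∩ Icc a s) := by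
    have h1 : ContinuousOn (fun x => u x - v x) (Icc a s) :=
      (hu.continuousOn.sub hv.continuousOn).mono hsub
    have := h1.preimage_isClosed_of_isClosed isClosed_Icc (isClosed_singleton (x := (0 : E)))
    convert this using 1
    ext x
    simp [sub_eq_zero, and_comm]
  -- The agreement set is closed, and local uniqueness of zeros extends agreement to the right.
  refine hclosed.Icc_subset_of_forall_mem_nhdsWithin huv ?_ (right_mem_Icc.2 hs.1)
  rintro x ⟨hx, hxs⟩
  have hxI : x ∈ Ico a b := hsub (Ico_subset_Icc_self hxs)
  obtain ⟨δ, hδ, ρ, hρ, U, -, -, hU⟩ := exists_local_branch hT hF (hIcc hxI) (hu.zero x hxI)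
    (hu.pos x hxI)
  have hle : 𝓝[>] x ≤ 𝓝[Ico a b] x := by
    rw [← nhdsWithin_Ioo_eq_nhdsGT hxI.2]
    exact nhdsWithin_mono x fun z hz => ⟨hxI.1.trans hz.1.le, hz.2⟩
  have h1 := ((hu.continuousOn x hxI).mono_left hle).eventually (Metric.ball_mem_nhds _ hρ)
  have h2 := ((hv.continuousOn x hxI).mono_left hle).eventually
    (Metric.ball_mem_nhds _ (show 0 < ρ from hρ))
  filter_upwards [h1, h2, hle self_mem_nhdsWithin,
    mem_nhdsWithin_of_mem_nhds (Metric.ball_mem_nhds x hδ)] with z hz1 hz2 hzI hzδ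
  have hx' : u x = v x := hx
  rw [← hx'] at hz2
  obtain ⟨-, -, huniq⟩ := hU z ⟨hIcc hzI, hzδ⟩
  exact (huniq _ hz1 (hu.zero z hzI)).trans (huniq _ hz2 (hv.zero z hzI)).symm

lemma IsBranch.mono {a b c : ℝ} {u : ℝ → E} (hu : IsBranch F a b u) (hc : c ≤ b) :
    IsBranch F a c u :=
  have h : Ico a c ⊆ Ico a b := Ico_subset_Ico_right hc
  ⟨hu.continuousOn.mono h, fun s hs => hu.zero s (h hs), fun s hs => hu.pos s (h hs)⟩

/-- A continuous branch is of class `C²`. -/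
theorem IsBranch.contDiffOn [FiniteDimensional ℝ E] (hT : 0 < T)
    (hF : ContDiffOn ℝ 2 (Function.uncurry F) (Icc 0 T ×ˢ univ)) {a b : ℝ} (ha : 0 ≤ a)
    (hb : b ≤ T) {u : ℝ → E} (hu : IsBranch F a b u) : ContDiffOn ℝ 2 u (Ico a b) := by
  set S : Set (ℝ × E) := Icc 0 T ×ˢ univ with hS
  set Ψ := Function.uncurry F with hΨ
  have hmaps : MapsTo (fun s => (s, u s)) (Ico a b) S := fun s hs =>
    ⟨⟨ha.trans hs.1, hs.2.le.trans hb⟩, mem_univ _⟩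
  set X : ℝ × E → E := fun p =>
    -((fderiv ℝ (F p.1) p.2).inverse (fderivWithin ℝ Ψ S p (1, 0))) with hX
  have hderiv : ∀ s ∈ Ico a b, HasDerivWithinAt u (X (s, u s)) (Ico a b) s := by
    intro s hs
    have hsS := hmaps hs
    obtain ⟨e, he⟩ := (hu.pos s hs).isInvertible
    set D := fderivWithin ℝ Ψ S (s, u s) with hD
    have hDd : HasFDerivWithinAt Ψ D S (s, u s) :=
      (hF.differentiableOn two_ne_zero _ hsS).hasFDerivWithinAt
    have hslice : fderiv ℝ (F s) (u s) = D.comp (ContinuousLinearMap.inr ℝ ℝ E) :=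
      (fderiv_slice two_ne_zero hF hsS.1 (u s)).2
    -- The map `p ↦ (p.1, Ψ p)` sends `(s, u s)` to `(s, 0)` and its derivative is left invertible.
    -- Continuity of `u` then gives differentiability, with `u' = X(s, u)`; since `X` is C¹, this
    -- bootstraps to C².
    have hΦ : HasFDerivWithinAt (fun p : ℝ × E => (p.1, Ψ p))
        ((ContinuousLinearMap.fst ℝ ℝ E).prod D) S (s, u s) :=
      hasFDerivWithinAt_fst.prodMk hDd
    have hh : HasFDerivWithinAt (fun r : ℝ => (r, (0 : E)))
        (ContinuousLinearMap.inl ℝ ℝ E) (Ico a b) s :=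
      (hasFDerivAt_prodMk_left s 0).hasFDerivWithinAt
    set L : ℝ × E →L[ℝ] ℝ × E := (ContinuousLinearMap.fst ℝ ℝ E).prod
      ((e.symm : E →L[ℝ] E).comp (ContinuousLinearMap.snd ℝ ℝ E -
        (D.comp ((ContinuousLinearMap.inl ℝ ℝ E).comp (ContinuousLinearMap.fst ℝ ℝ E))))) with hL
    have hleft : Function.LeftInverse L ((ContinuousLinearMap.fst ℝ ℝ E).prod D) := by
      rintro ⟨d, k⟩
      have h1 : D (d, k) - D (d, 0) = e k := by
        have h2 : e k = fderiv ℝ (F s) (u s) k := by rw [← he]; rfl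
        rw [h2, hslice, ← map_sub]
        simp
      have h3 : e.symm (D (d, k) - D (d, 0)) = k := by rw [h1, e.symm_apply_apply]
      rw [map_sub] at h3
      simp [hL, h3]
    have hcont : Tendsto (fun r => (r, u r)) (𝓝[Ico a b] s) (𝓝[S] (s, u s)) :=
      tendsto_nhdsWithin_iff.2 ⟨(tendsto_nhdsWithin_of_tendsto_nhds tendsto_id).prodMk_nhds
        (hu.continuousOn s hs), eventually_mem_nhdsWithin.mono fun r hr => hmaps hr⟩
    have hres := HasFDerivWithinAt.of_comp_of_leftInverse hcont hΦ hh
      (eventually_mem_nhdsWithin.mono fun r hr => by simp [hΨ, hu.zero r hr]) hleft hs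
    have h3 := (hasFDerivAt_snd (𝕜 := ℝ) (E := ℝ) (F := E) (p := (s, u s))).comp_hasFDerivWithinAt
      s hres
    have h4 := h3.hasDerivWithinAt
    refine h4.congr_deriv ?_
    simp [hL, hX, ← he, ← hD]
  have hXc : ContDiffOn ℝ 1 (fun p => X p) {p | p ∈ S ∧ PosOp (fderiv ℝ (F p.1) p.2)} := by
    have h1 := (contDiffOn_fderiv_slice (m := 1) hT (by norm_num) hF).mono
      (sep_subset S fun p => PosOp (fderiv ℝ (F p.1) p.2))
    have h2 := (hF.fderivWithin (uniqueDiffOn_strip hT) (m := 1) (by norm_num)).mono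
      (sep_subset S fun p => PosOp (fderiv ℝ (F p.1) p.2))
    refine ContDiffOn.neg (ContDiffOn.clm_apply ?_ (h2.clm_apply contDiffOn_const))
    intro p hp
    exact (hp.2.isInvertible.contDiffAt_map_inverse (𝕜 := ℝ)).comp_contDiffWithinAt p (h1 p hp)
  have hmaps' : MapsTo (fun s => (s, u s)) (Ico a b)
      {p | p ∈ S ∧ PosOp (fderiv ℝ (F p.1) p.2)} := fun s hs => ⟨hmaps hs, hu.pos s hs⟩
  have hdiff : DifferentiableOn ℝ u (Ico a b) := fun s hs => (hderiv s hs).differentiableWithinAt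
  have huniq : UniqueDiffOn ℝ (Ico a b) := uniqueDiffOn_Ico a b
  have hdw : EqOn (derivWithin u (Ico a b)) (fun s => X (s, u s)) (Ico a b) := fun s hs =>
    (hderiv s hs).derivWithin (huniq s hs)
  have hc1 : ContDiffOn ℝ 1 u (Ico a b) := by
    rw [contDiffOn_one_iff_derivWithin huniq]
    exact ⟨hdiff, (hXc.continuousOn.comp (continuousOn_id.prodMk hu.continuousOn) hmaps').congr hdw⟩
  rw [show (2 : WithTop ℕ∞) = 1 + 1 by norm_num, contDiffOn_succ_iff_derivWithin huniq]
  exact ⟨hdiff, by simp, (hXc.comp (contDiffOn_id.prodMk hc1) hmaps').congr hdw⟩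

end Branches

/-! ### Continuation of branches up to degeneracy. -/

section MaximalBranch

open scoped RealInnerProductSpace

variable {E : Type*} [NormedAddCommGroup E] [InnerProductSpace ℝ E] [FiniteDimensional ℝ E]
  {T : ℝ} {F : ℝ → E → E}

lemma exists_isBranch_right (hT : 0 < T)
    (hF : ContDiffOn ℝ 2 (Function.uncurry F) (Icc 0 T ×ˢ univ)) {a : ℝ} {y₀ : E}
    (ha : a ∈ Ico 0 T) (hy₀ : F a y₀ = 0) (hpos : PosOp (fderiv ℝ (F a) y₀)) :
    ∃ b u, a < b ∧ b ≤ T ∧ u a = y₀ ∧ IsBranch F a b u := by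
  obtain ⟨δ, hδ, ρ, hρ, U, hU0, hUc, hU⟩ :=
    exists_local_branch hT hF (Ico_subset_Icc_self ha) hy₀ hpos
  have hsub : Ico a (min (a + δ) T) ⊆ Icc 0 T ∩ Metric.ball a δ := by
    intro s hs
    have h1 := hs.2.trans_le (min_le_left _ _)
    refine ⟨⟨ha.1.trans hs.1, (hs.2.trans_le (min_le_right _ _)).le⟩, ?_⟩
    rw [Metric.mem_ball, Real.dist_eq, abs_of_nonneg (sub_nonneg.2 hs.1)]
    linarith
  exact ⟨min (a + δ) T, U, lt_min (by linarith) ha.2, min_le_right _ _, hU0,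
    hUc.mono hsub, fun s hs => (hU s (hsub hs)).1, fun s hs => (hU s (hsub hs)).2.1⟩

/-- A branch whose left limit at the end point has positive definite linearization can be
continued. -/
lemma IsBranch.exists_extension (hT : 0 < T)
    (hF : ContDiffOn ℝ 2 (Function.uncurry F) (Icc 0 T ×ˢ univ)) {a b : ℝ} (ha : 0 ≤ a)
    (hab : a < b) (hb : b < T) {u : ℝ → E} (hu : IsBranch F a b u) {x : E}
    (hlim : Tendsto u (𝓝[<] b) (𝓝 x)) (hx : F b x = 0) (hpos : PosOp (fderiv ℝ (F b) x)) :
    ∃ b' v, b < b' ∧ b' ≤ T ∧ v a = u a ∧ IsBranch F a b' v := by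
  obtain ⟨δ, hδ, ρ, hρ, U, hU0, hUc, hU⟩ :=
    exists_local_branch hT hF (⟨ha.trans hab.le, hb.le⟩ : b ∈ Icc 0 T) hx hpos
  obtain ⟨c, hcb, hc⟩ := (mem_nhdsLT_iff_exists_Ioo_subset' hab).1
    ((hlim.eventually (Metric.ball_mem_nhds x hρ)).and (Ioo_mem_nhdsLT
      (max_lt hab (sub_lt_self b hδ))))
  set b' := min (b + δ) T with hb'
  have hbb' : b < b' := lt_min (by linarith) hb
  have hcb : c < b := hcb
  have hmem : ∀ s, max a (b - δ) < s → s < b' → s ∈ Icc 0 T ∩ Metric.ball b δ := by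
    intro s h1 h2
    have h3 := (le_max_left a (b - δ)).trans_lt h1
    have h4 := (le_max_right a (b - δ)).trans_lt h1
    have h5 := h2.trans_le (min_le_left _ _)
    refine ⟨⟨ha.trans h3.le, (h2.trans_le (min_le_right _ _)).le⟩, ?_⟩
    rw [Metric.mem_ball, Real.dist_eq, abs_lt]
    constructor <;> linarith
  set d := max c (max a (b - δ)) with hd
  have hdb : d < b := max_lt hcb (max_lt hab (sub_lt_self b hδ))
  -- Close to `b` the branch has entered the ball around `x` in which the zeros of `F s` are unique.
  have heq : ∀ s ∈ Ioo d b, u s = U s := by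
    intro s hs
    obtain ⟨h1, h2⟩ := hc ⟨(le_max_left _ _).trans_lt hs.1, hs.2⟩
    have h3 := hmem s h2.1 (hs.2.trans hbb')
    exact (hU s h3).2.2 _ h1 (hu.zero s ⟨(le_max_left _ _).trans h2.1.le, hs.2⟩)
  set v : ℝ → E := fun s => if s < b then u s else U s with hv
  have hvu : ∀ s < b, v s = u s := fun s hs => by simp [hv, hs]
  have hvU : ∀ s, d < s → v s = U s := fun s hs => by
    by_cases h : s < b
    · rw [hvu s h, heq s ⟨hs, h⟩]
    · simp [hv, h]
  have hmem' : ∀ s, d < s → s < b' → s ∈ Icc 0 T ∩ Metric.ball b δ := fun s h1 h2 =>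
    hmem s ((le_max_right _ _).trans_lt h1) h2
  refine ⟨b', v, hbb', min_le_right _ _, hvu a hab, ?_, ?_, ?_⟩
  · intro s hs
    rcases lt_or_ge s b with h | h
    · have h1 : ContinuousWithinAt u (Ico a b') s :=
        (hu.continuousOn s ⟨hs.1, h⟩).mono_of_mem_nhdsWithin
          (mem_nhdsWithin.2 ⟨Iio b, isOpen_Iio, h, fun z hz => ⟨hz.2.1, hz.1⟩⟩)
      refine h1.congr_of_eventuallyEq ?_ (hvu s h)
      filter_upwards [mem_nhdsWithin_of_mem_nhds (Iio_mem_nhds h)] with z hz using hvu z hz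
    · have hds : d < s := hdb.trans_le h
      have h1 : ContinuousWithinAt U (Ico a b') s :=
        (hUc s (hmem' s hds hs.2)).mono_of_mem_nhdsWithin
          (mem_nhdsWithin.2 ⟨Ioi d, isOpen_Ioi, hds, fun z hz => hmem' z hz.1 hz.2.2⟩)
      refine h1.congr_of_eventuallyEq ?_ (hvU s hds)
      filter_upwards [mem_nhdsWithin_of_mem_nhds (Ioi_mem_nhds hds)] with z hz using hvU z hz
  · intro s hs
    rcases lt_or_ge s b with h | h
    · rw [hvu s h]; exact hu.zero s ⟨hs.1, h⟩
    · have hds : d < s := hdb.trans_le h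
      rw [hvU s hds]; exact (hU s (hmem' s hds hs.2)).1
  · intro s hs
    rcases lt_or_ge s b with h | h
    · rw [hvu s h]; exact hu.pos s ⟨hs.1, h⟩
    · have hds : d < s := hdb.trans_le h
      rw [hvU s hds]; exact (hU s (hmem' s hds hs.2)).2.1

/-- The left limit of a branch exists, is a zero, and has positive semidefinite linearization. -/
lemma IsBranch.exists_limit (hT : 0 < T)
    (hF : ContDiffOn ℝ 2 (Function.uncurry F) (Icc 0 T ×ˢ univ)) {R : ℝ}
    (hR : ∀ t ∈ Icc 0 T, ∀ x, F t x = 0 → ‖x‖ ≤ R) {a b : ℝ} (ha : 0 ≤ a)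
    (hab : a < b) (hb : b ≤ T) (hcount : {x | F b x = 0}.Countable) {u : ℝ → E}
    (hu : IsBranch F a b u) :
    ∃ x, Tendsto u (𝓝[<] b) (𝓝 x) ∧ F b x = 0 ∧ ∀ v, 0 ≤ ⟪fderiv ℝ (F b) x v, v⟫ := by
  have : ProperSpace E := FiniteDimensional.proper ℝ E
  have hbT : b ∈ Icc 0 T := ⟨ha.trans hab.le, hb⟩
  have hev : ∀ᶠ s in 𝓝[<] b, s ∈ Ico a b :=
    (Ioo_mem_nhdsLT hab : Ioo a b ∈ 𝓝[<] b) |> fun h => mem_of_superset h Ioo_subset_Ico_self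
  have hevT : ∀ᶠ s in 𝓝[<] b, s ∈ Icc 0 T :=
    hev.mono fun s hs => ⟨ha.trans hs.1, hs.2.le.trans hb⟩
  have hpair : ∀ (l : Filter ℝ) (x : E), l ≤ 𝓝[<] b → Tendsto u l (𝓝 x) →
      Tendsto (fun s => (s, u s)) l (𝓝[Icc 0 T ×ˢ univ] (b, x)) := fun l x hl hux =>
    tendsto_nhdsWithin_iff.2 ⟨((tendsto_nhdsWithin_of_tendsto_nhds tendsto_id).mono_left
      hl).prodMk_nhds hux, (hevT.filter_mono hl).mono fun s hs => ⟨hs, mem_univ _⟩⟩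
  -- By continuity of `F`, every cluster point of `u` at `b` is a zero of `F b`, and these are
  -- countable.
  obtain ⟨x, hx, hlim⟩ := exists_tendsto_of_countable_cluster (l := 𝓝[<] b) (u := u) hcount
    (hev.and hevT |>.mono fun s hs => hR s hs.2 _ (hu.zero s hs.1)) (by
      intro p hp
      obtain ⟨V, hV, hVp⟩ := mapClusterPt_iff_ultrafilter.1 hp
      have h1 : Tendsto (fun s => F s (u s)) V (𝓝 (F b p)) :=
        (hF.continuousOn (b, p) ⟨hbT, mem_univ _⟩).tendsto.comp (hpair V p hV hVp)
      have h2 : Tendsto (fun s => F s (u s)) V (𝓝 0) :=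
        tendsto_const_nhds.congr' ((hev.filter_mono hV).mono fun s hs => (hu.zero s hs).symm)
      exact tendsto_nhds_unique h1 h2) (by
      intro A hA
      obtain ⟨c, hc, hcA⟩ := (mem_nhdsLT_iff_exists_Ioo_subset' hab).1 hA
      refine ⟨Ioo (max a c) b, Ioo_mem_nhdsLT (max_lt hab hc), fun s hs =>
        hcA ⟨(le_max_right _ _).trans_lt hs.1, hs.2⟩, isPreconnected_Ioo, ?_⟩
      exact hu.continuousOn.mono fun s hs => ⟨(le_max_left _ _).trans hs.1.le, hs.2⟩)
  refine ⟨x, hlim, hx, fun v => ?_⟩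
  have hA : Tendsto (fun s => fderiv ℝ (F s) (u s)) (𝓝[<] b) (𝓝 (fderiv ℝ (F b) x)) :=
    ((contDiffOn_fderiv_slice (m := 1) hT (by norm_num) hF).continuousOn (b, x)
      ⟨hbT, mem_univ _⟩).tendsto.comp (hpair _ x le_rfl hlim)
  have hAv : Tendsto (fun s => ⟪fderiv ℝ (F s) (u s) v, v⟫) (𝓝[<] b)
      (𝓝 ⟪fderiv ℝ (F b) x v, v⟫) :=
    (((ContinuousLinearMap.apply ℝ E v).continuous.tendsto _).comp hA).inner tendsto_const_nhds
  refine ge_of_tendsto hAv (hev.mono fun s hs => ?_)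
  rcases eq_or_ne v 0 with rfl | hv
  · simp
  · exact (hu.pos s hs v hv).le

/-- Each zero with positive definite linearization starts a branch which can be followed until the
linearization degenerates or the final time is reached. -/
theorem exists_maximal_branch (hT : 0 < T)
    (hF : ContDiffOn ℝ 2 (Function.uncurry F) (Icc 0 T ×ˢ univ)) {R : ℝ}
    (hR : ∀ t ∈ Icc 0 T, ∀ x, F t x = 0 → ‖x‖ ≤ R)
    (hcount : ∀ t ∈ Icc 0 T, {x | F t x = 0}.Countable) {a : ℝ} {y₀ : E} (ha : a ∈ Ico 0 T)
    (hy₀ : F a y₀ = 0) (hpos : PosOp (fderiv ℝ (F a) y₀)) :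
    ∃ b u x, a < b ∧ b ≤ T ∧ u a = y₀ ∧ IsBranch F a b u ∧ Tendsto u (𝓝[<] b) (𝓝 x) ∧
      F b x = 0 ∧ (∀ v, 0 ≤ ⟪fderiv ℝ (F b) x v, v⟫) ∧
      (b < T → ¬ PosOp (fderiv ℝ (F b) x)) := by
  set B : Set ℝ := {b | a < b ∧ b ≤ T ∧ ∃ u : ℝ → E, u a = y₀ ∧ IsBranch F a b u} with hB
  obtain ⟨b₀, u₀, hab₀, hb₀T, hu₀, hbr₀⟩ := exists_isBranch_right hT hF ha hy₀ hpos
  have hb₀ : b₀ ∈ B := ⟨hab₀, hb₀T, u₀, hu₀, hbr₀⟩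
  have hbdd : BddAbove B := ⟨T, fun b hb => hb.2.1⟩
  set c := sSup B with hc
  have hac : a < c := hab₀.trans_le (le_csSup hbdd hb₀)
  have hcT : c ≤ T := csSup_le ⟨b₀, hb₀⟩ fun b hb => hb.2.1
  have hex : ∀ s, s < c → ∃ b u, s < b ∧ a < b ∧ b ≤ T ∧ u a = y₀ ∧ IsBranch F a b u := by
    intro s hs
    obtain ⟨b, hb, hsb⟩ := exists_lt_of_lt_csSup ⟨b₀, hb₀⟩ hs
    obtain ⟨h1, h2, u, h3, h4⟩ := hb
    exact ⟨b, u, hsb, h1, h2, h3, h4⟩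
  -- `W s` is a branch surviving beyond `s`. By uniqueness of branches, the diagonal `W s s` agrees
  -- with each of them and is a branch on all of `[a, c)`.
  choose! β W hβ haβ hβT hW0 hW using hex
  set u : ℝ → E := fun s => W s s with hu
  have huW : ∀ s < c, EqOn u (W s) (Ico a (min (β s) c)) := by
    intro s hs z hz
    have hzc : z < c := hz.2.trans_le (min_le_right _ _)
    have hzβ : z < β s := hz.2.trans_le (min_le_left _ _)
    have hz' := hβ z hzc
    exact ((hW z hzc).mono (min_le_left _ (β s))).eqOn hT hF ha.1
      ((min_le_left _ _).trans (hβT z hzc))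
      ((hW s hs).mono (min_le_right (β z) _)) ((hW0 z hzc).trans (hW0 s hs).symm)
      ⟨hz.1, lt_min hz' hzβ⟩
  have hbr : IsBranch F a c u := by
    refine ⟨fun s hs => ?_, fun s hs => (hW s hs.2).zero s ⟨hs.1, hβ s hs.2⟩,
      fun s hs => (hW s hs.2).pos s ⟨hs.1, hβ s hs.2⟩⟩
    have hsm : s < min (β s) c := lt_min (hβ s hs.2) hs.2
    have h1 : ContinuousWithinAt (W s) (Ico a c) s :=
      ((hW s hs.2).continuousOn s ⟨hs.1, hβ s hs.2⟩).mono_of_mem_nhdsWithin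
        (mem_nhdsWithin.2 ⟨Iio (β s), isOpen_Iio, hβ s hs.2, fun z hz => ⟨hz.2.1, hz.1⟩⟩)
    refine h1.congr_of_eventuallyEq ?_ rfl
    filter_upwards [mem_nhdsWithin_of_mem_nhds (Iio_mem_nhds hsm), self_mem_nhdsWithin]
      with z hz hz'
    exact huW s hs.2 ⟨hz'.1, hz⟩
  have hcI : c ∈ Icc 0 T := ⟨ha.1.trans hac.le, hcT⟩
  obtain ⟨x, hlim, hx, hpsd⟩ := hbr.exists_limit hT hF hR ha.1 hac hcT (hcount c hcI)
  refine ⟨c, u, x, hac, hcT, hW0 a hac, hbr, hlim, hx, hpsd, fun hlt hP => ?_⟩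
  obtain ⟨b', v, hb', hb'T, hva, hv⟩ := hbr.exists_extension hT hF ha.1 hac hlt hlim hx hP
  have : b' ≤ c := le_csSup hbdd ⟨hac.trans hb', hb'T, v, hva.trans (hW0 a hac), hv⟩
  linarith

end MaximalBranch

/-! ### Coordinate expressions as operators and multilinear forms. -/

section Coordinates

open scoped RealInnerProductSpace

lemma sum_smul_single (v : Rn n) : ∑ j, v j • EuclideanSpace.single j (1 : ℝ) = v := by
  ext i
  simp [Pi.single_apply]

lemma gradient_apply (g : Rn n → ℝ) (x : Rn n) (i : Fin n) : gradient g x i = pderiv i g x := by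
  rw [pderiv, ← inner_gradient_left, EuclideanSpace.inner_single_right]
  simp

lemma contDiff_gradient {g : Rn n → ℝ} {m k : WithTop ℕ∞} (hk : m + 1 ≤ k) (hg : ContDiff ℝ k g) :
    ContDiff ℝ m (gradient g) := by
  rw [contDiff_euclidean]
  intro i
  simp only [gradient_apply, pderiv]
  exact (hg.fderiv_right hk).clm_apply contDiff_const

lemma contDiffOn_gradient {T : ℝ} (hT : 0 < T) {f : ℝ → Rn n → ℝ}
    (hf : ContDiffOn ℝ 3 (Function.uncurry f) (Icc 0 T ×ˢ univ)) :
    ContDiffOn ℝ 2 (Function.uncurry fun t => gradient (f t)) (Icc 0 T ×ˢ univ) := by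
  rw [contDiffOn_euclidean]
  intro i
  simp only [Function.uncurry, gradient_apply, pderiv]
  exact (contDiffOn_fderiv_slice hT (by norm_num) hf).clm_apply contDiffOn_const

lemma fderiv_coordinate {F : Rn n → Rn n} {x : Rn n} (hF : DifferentiableAt ℝ F x) (v : Rn n)
    (i : Fin n) : fderiv ℝ (fun y => F y i) x v = fderiv ℝ F x v i := by
  have := (EuclideanSpace.proj (𝕜 := ℝ) i).hasFDerivAt.comp x hF.hasFDerivAt
  have h2 : fderiv ℝ (fun y => F y i) x = (EuclideanSpace.proj (𝕜 := ℝ) i).comp (fderiv ℝ F x) :=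
    this.fderiv
  rw [h2]
  simp

lemma pderiv_pderiv {g : Rn n → ℝ} {x : Rn n} (hg : DifferentiableAt ℝ (gradient g) x)
    (i j : Fin n) :
    pderiv j (pderiv i g) x = fderiv ℝ (gradient g) x (EuclideanSpace.single j 1) i := by
  have : pderiv i g = fun y => gradient g y i := funext fun y => (gradient_apply g y i).symm
  rw [this, pderiv, fderiv_coordinate hg]

lemma toEuclideanLin_hessian {g : Rn n → ℝ} {x : Rn n} (hg : DifferentiableAt ℝ (gradient g) x)
    (v : Rn n) : Matrix.toEuclideanLin (hessian g x) v = fderiv ℝ (gradient g) x v := by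
  ext i
  rw [← sum_smul_single v, map_sum, map_sum]
  simp only [map_smul, Finset.sum_apply, WithLp.ofLp_sum, WithLp.ofLp_smul, Pi.smul_apply]
  refine Finset.sum_congr rfl fun j _ => ?_
  congr 1
  rw [← pderiv_pderiv hg]
  simp [Matrix.toLpLin_apply, hessian]

lemma dotProduct_hessian {g : Rn n → ℝ} {x : Rn n} (hg : DifferentiableAt ℝ (gradient g) x)
    (v : Rn n) : star v.ofLp ⬝ᵥ (hessian g x).mulVec v.ofLp = ⟪fderiv ℝ (gradient g) x v, v⟫ := by
  rw [← toEuclideanLin_hessian hg, Matrix.toLpLin_apply, EuclideanSpace.inner_eq_star_dotProduct]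
  simp

/-- Links the linearized gradient to the second derivative of `g`, whose symmetry makes the
linearization self-adjoint. -/
lemma inner_fderiv_gradient {g : Rn n → ℝ} (hg : ContDiff ℝ 2 g) (x v w : Rn n) :
    ⟪fderiv ℝ (gradient g) x v, w⟫ = fderiv ℝ (fderiv ℝ g) x v w := by
  have hd : DifferentiableAt ℝ (gradient g) x :=
    (contDiff_gradient (m := 1) (by norm_num) hg).differentiable one_ne_zero x
  have hd2 : DifferentiableAt ℝ (fderiv ℝ g) x :=
    (hg.fderiv_right (m := 1) (by norm_num)).differentiable one_ne_zero x
  have h1 : HasFDerivAt (fun y => ⟪gradient g y, w⟫)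
      ((fderivInnerCLM ℝ (gradient g x, w)).comp ((fderiv ℝ (gradient g) x).prod 0)) x :=
    hd.hasFDerivAt.inner ℝ (hasFDerivAt_const w x)
  have h2 : HasFDerivAt (fun y => fderiv ℝ g y w) ((fderiv ℝ (fderiv ℝ g) x).flip w) x := by
    simpa using hd2.hasFDerivAt.clm_apply (hasFDerivAt_const w x)
  have h3 : (fun y => ⟪gradient g y, w⟫) = fun y => fderiv ℝ g y w :=
    funext fun y => inner_gradient_left
  rw [h3] at h1
  have := congrArg (fun L => L v) (h1.unique h2)
  simpa using this

lemma fderiv_gradient_symm {g : Rn n → ℝ} (hg : ContDiff ℝ 2 g) (x v w : Rn n) :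
    ⟪fderiv ℝ (gradient g) x v, w⟫ = ⟪v, fderiv ℝ (gradient g) x w⟫ := by
  rw [real_inner_comm _ v, inner_fderiv_gradient hg, inner_fderiv_gradient hg]
  exact (hg.contDiffAt (x := x)).isSymmSndFDerivAt (by simp) v w

lemma isHermitian_hessian {g : Rn n → ℝ} (hg : ContDiff ℝ 2 g) (x : Rn n) :
    (hessian g x).IsHermitian := by
  have hd : DifferentiableAt ℝ (gradient g) x :=
    (contDiff_gradient (m := 1) (by norm_num) hg).differentiable one_ne_zero x
  ext i j
  have := fderiv_gradient_symm hg x (EuclideanSpace.single i 1) (EuclideanSpace.single j 1)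
  rw [EuclideanSpace.inner_single_right, EuclideanSpace.inner_single_left] at this
  simpa [hessian, pderiv_pderiv hd] using this

lemma posDef_hessian_iff {g : Rn n → ℝ} (hg : ContDiff ℝ 2 g) (x : Rn n) :
    (hessian g x).PosDef ↔ PosOp (fderiv ℝ (gradient g) x) := by
  have hd : DifferentiableAt ℝ (gradient g) x :=
    (contDiff_gradient (m := 1) (by norm_num) hg).differentiable one_ne_zero x
  rw [Matrix.posDef_iff_dotProduct_mulVec]
  refine ⟨fun h v hv => ?_, fun h => ⟨isHermitian_hessian hg x, fun v hv => ?_⟩⟩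
  · rw [← dotProduct_hessian hd]
    exact h.2 (by simpa using hv)
  · have := h (WithLp.toLp 2 v) (by simpa using hv)
    rwa [← dotProduct_hessian hd] at this

lemma posSemidef_hessian_iff {g : Rn n → ℝ} (hg : ContDiff ℝ 2 g) (x : Rn n) :
    (hessian g x).PosSemidef ↔ ∀ v, 0 ≤ ⟪fderiv ℝ (gradient g) x v, v⟫ := by
  have hd : DifferentiableAt ℝ (gradient g) x :=
    (contDiff_gradient (m := 1) (by norm_num) hg).differentiable one_ne_zero x
  rw [Matrix.posSemidef_iff_dotProduct_mulVec]
  refine ⟨fun h v => ?_, fun h => ⟨isHermitian_hessian hg x, fun v => ?_⟩⟩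
  · rw [← dotProduct_hessian hd]
    exact h.2 _
  · have := h (WithLp.toLp 2 v)
    rwa [← dotProduct_hessian hd] at this

lemma det_hessian_eq_zero_iff {g : Rn n → ℝ} (hg : ContDiff ℝ 2 g) (x : Rn n) :
    (hessian g x).det = 0 ↔ ∃ v, v ≠ 0 ∧ fderiv ℝ (gradient g) x v = 0 := by
  have hd : DifferentiableAt ℝ (gradient g) x :=
    (contDiff_gradient (m := 1) (by norm_num) hg).differentiable one_ne_zero x
  rw [← Matrix.exists_mulVec_eq_zero_iff]
  constructor
  · rintro ⟨v, hv, h⟩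
    refine ⟨WithLp.toLp 2 v, by simpa using hv, ?_⟩
    rw [← toEuclideanLin_hessian hd, Matrix.toLpLin_apply]
    simp [h]
  · rintro ⟨v, hv, h⟩
    refine ⟨v.ofLp, by simpa using hv, ?_⟩
    rw [← toEuclideanLin_hessian hd, Matrix.toLpLin_apply] at h
    simpa using h

/-- Turns the cubic coefficient into the quantity whose sign is required by `exists_isFold`. -/
lemma cubicForm_eq {g : Rn n → ℝ} (hg : ContDiff ℝ 3 g) (x ℓ : Rn n) :
    cubicForm g x ℓ = ⟪fderiv ℝ (fderiv ℝ (gradient g)) x ℓ ℓ, ℓ⟫ := by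
  have hF : ContDiff ℝ 2 (gradient g) := contDiff_gradient (by norm_num) hg
  have hd2 : DifferentiableAt ℝ (fderiv ℝ (gradient g)) x :=
    (hF.fderiv_right (m := 1) (by norm_num)).differentiable one_ne_zero x
  set D := fderiv ℝ (fderiv ℝ (gradient g)) x with hD
  have h1 : ∀ i j k, pderiv k (pderiv j (pderiv i g)) x =
      D (EuclideanSpace.single k 1) (EuclideanSpace.single j 1) i := by
    intro i j k
    have e : pderiv j (pderiv i g) =
        fun y => fderiv ℝ (gradient g) y (EuclideanSpace.single j 1) i := funext fun y =>
      pderiv_pderiv (hF.differentiable two_ne_zero y) i j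
    have h2 : HasFDerivAt (fun y => fderiv ℝ (gradient g) y (EuclideanSpace.single j 1))
        (D.flip (EuclideanSpace.single j 1)) x := by
      simpa using hd2.hasFDerivAt.clm_apply (hasFDerivAt_const (EuclideanSpace.single j 1) x)
    rw [e, pderiv, fderiv_coordinate h2.differentiableAt, h2.fderiv]
    rfl
  have h3 : ∀ i, D ℓ ℓ i = ∑ j, ∑ k, ℓ k * (ℓ j *
      D (EuclideanSpace.single k 1) (EuclideanSpace.single j 1) i) := by
    intro i
    have e1 : D ℓ ℓ = ∑ j, ∑ k, ℓ k • ℓ j •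
        D (EuclideanSpace.single k 1) (EuclideanSpace.single j 1) := by
      conv_lhs => rw [← sum_smul_single ℓ]
      simp only [map_sum, map_smul, sum_apply, smul_apply, Finset.smul_sum]
      exact Finset.sum_congr rfl fun j _ => Finset.sum_congr rfl fun k _ => smul_comm _ _ _
    rw [e1]
    simp [Finset.sum_apply]
  rw [cubicForm, PiLp.inner_apply]
  refine Finset.sum_congr rfl fun i _ => ?_
  rw [h3]
  simp only [h1, RCLike.inner_apply, conj_trivial, Finset.mul_sum]
  refine Finset.sum_congr rfl fun j _ => Finset.sum_congr rfl fun k _ => ?_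
  ring

lemma spansKernel_iff {g : Rn n → ℝ} (hg : ContDiff ℝ 2 g) {x ℓ : Rn n}
    (h : SpansKernel g x ℓ) (v : Rn n) :
    fderiv ℝ (gradient g) x v = 0 ↔ v ∈ Submodule.span ℝ {ℓ} := by
  have hd : DifferentiableAt ℝ (gradient g) x :=
    (contDiff_gradient (m := 1) (by norm_num) hg).differentiable one_ne_zero x
  rw [← h.2, LinearMap.mem_ker, toEuclideanLin_hessian hd]

/-- At an interior time, `∇_x f_t · ℓ` is the time derivative of `∇_x f · ℓ`. -/
lemma mixedForm_eq {T : ℝ} {f : ℝ → Rn n → ℝ}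
    (hf : ContDiffOn ℝ 3 (Function.uncurry f) (Icc 0 T ×ˢ univ)) {τ : ℝ} (hτ : τ ∈ Ioo 0 T)
    (ξ ℓ : Rn n) {D : ℝ × Rn n →L[ℝ] Rn n}
    (hD : HasFDerivAt (Function.uncurry fun t => gradient (f t)) D (τ, ξ)) :
    mixedForm T f τ ξ ℓ = ⟪ℓ, D (1, 0)⟫ := by
  set Φ := Function.uncurry f with hΦ
  have hnhds : ∀ x : Rn n, (Icc 0 T ×ˢ univ : Set (ℝ × Rn n)) ∈ 𝓝 (τ, x) := fun x =>
    prod_mem_nhds (Icc_mem_nhds hτ.1 hτ.2) univ_mem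
  have hΦat : ∀ x : Rn n, ContDiffAt ℝ 3 Φ (τ, x) := fun x => hf.contDiffAt (hnhds x)
  have hD2 : HasFDerivAt (fderiv ℝ Φ) (fderiv ℝ (fderiv ℝ Φ) (τ, ξ)) (τ, ξ) :=
    (((hΦat ξ).fderiv_right (m := 2) (by norm_num)).differentiableAt two_ne_zero).hasFDerivAt
  set D2 := fderiv ℝ (fderiv ℝ Φ) (τ, ξ) with hD2def
  have htd : timeDeriv T f τ = fun x => fderiv ℝ Φ (τ, x) (1, 0) := by
    funext x
    have h1 : HasDerivAt (fun s => f s x) (fderiv ℝ Φ (τ, x) (1, 0)) τ := by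
      have h2 : HasFDerivAt (fun s : ℝ => (s, x)) (ContinuousLinearMap.inl ℝ ℝ (Rn n)) τ :=
        hasFDerivAt_prodMk_left τ x
      have h3 := (((hΦat x).differentiableAt three_ne_zero).hasFDerivAt.comp τ h2).hasDerivAt
      simp only [ContinuousLinearMap.comp_apply, ContinuousLinearMap.inl_apply] at h3
      exact h3
    exact (h1.hasDerivWithinAt).derivWithin
      (uniqueDiffOn_Icc (hτ.1.trans hτ.2) τ (Ioo_subset_Icc_self hτ))
  have h1 : mixedForm T f τ ξ ℓ = D2 (0, ℓ) (1, 0) := by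
    rw [mixedForm, inner_gradient_left, htd]
    have h2 : HasFDerivAt (fun x : Rn n => (τ, x)) (ContinuousLinearMap.inr ℝ ℝ (Rn n)) ξ :=
      hasFDerivAt_prodMk_right τ ξ
    have h3 := (hD2.comp ξ h2).clm_apply (hasFDerivAt_const ((1 : ℝ), (0 : Rn n)) ξ)
    have h4 := h3.fderiv
    simp only [Function.comp_apply] at h4
    rw [h4]
    simp
  have h2 : ⟪ℓ, D (1, 0)⟫ = D2 (1, 0) (0, ℓ) := by
    have e1 : HasFDerivAt (fun p : ℝ × Rn n => ⟪ℓ, gradient (f p.1) p.2⟫)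
        ((fderivInnerCLM ℝ (ℓ, gradient (f τ) ξ)).comp
          ((0 : ℝ × Rn n →L[ℝ] Rn n).prod D)) (τ, ξ) :=
      (hasFDerivAt_const ℓ (τ, ξ)).inner ℝ hD
    have e2 : HasFDerivAt (fun p : ℝ × Rn n => fderiv ℝ Φ p (0, ℓ)) (D2.flip (0, ℓ)) (τ, ξ) := by
      simpa using hD2.clm_apply (hasFDerivAt_const ((0 : ℝ), ℓ) (τ, ξ))
    have e3 : (fun p : ℝ × Rn n => ⟪ℓ, gradient (f p.1) p.2⟫) =ᶠ[𝓝 (τ, ξ)]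
        fun p => fderiv ℝ Φ p (0, ℓ) := by
      have hopen : (Ioo 0 T ×ˢ univ : Set (ℝ × Rn n)) ∈ 𝓝 (τ, ξ) :=
        prod_mem_nhds (Ioo_mem_nhds hτ.1 hτ.2) univ_mem
      filter_upwards [hopen] with p hp
      have hp' : (Icc 0 T ×ˢ univ : Set (ℝ × Rn n)) ∈ 𝓝 p :=
        prod_mem_nhds (Icc_mem_nhds hp.1.1 hp.1.2) univ_mem
      rw [real_inner_comm, inner_gradient_left,
        (fderiv_slice three_ne_zero hf (Ioo_subset_Icc_self hp.1) p.2).2,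
        fderivWithin_of_mem_nhds hp']
      simp [hΦ]
    have := congrArg (fun L => L (1, 0)) ((e1.congr_of_eventuallyEq e3.symm).unique e2)
    simpa using this
  rw [h1, h2]
  -- Exchanging the time and space derivatives is the symmetry of the second derivative of `f` on
  -- space-time.
  exact (hΦat ξ).isSymmSndFDerivAt (by simp; norm_num) (0, ℓ) (1, 0)

lemma mixedForm_smul (T : ℝ) (f : ℝ → Rn n → ℝ) (τ : ℝ) (ξ ℓ : Rn n) (c : ℝ) :
    mixedForm T f τ ξ (c • ℓ) = c * mixedForm T f τ ξ ℓ := real_inner_smul_right _ _ _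

/-- Both transversality coefficients have odd degree in `ℓ`, so the sign of their product does not
depend on the choice of `ℓ`. -/
lemma cubicForm_smul (g : Rn n → ℝ) (ξ ℓ : Rn n) (c : ℝ) :
    cubicForm g ξ (c • ℓ) = c ^ 3 * cubicForm g ξ ℓ := by
  simp only [cubicForm, Finset.mul_sum, PiLp.smul_apply, smul_eq_mul]
  refine Finset.sum_congr rfl fun i _ => Finset.sum_congr rfl fun j _ =>
    Finset.sum_congr rfl fun k _ => ?_
  ring

end Coordinates

/-! ### Critical points of `f` and orbits of its gradient flow. -/

section Critical

open scoped RealInnerProductSpace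

variable {T : ℝ} {f : ℝ → Rn n → ℝ}

lemma SmoothCoercive.contDiff (h : SmoothCoercive T f) {t : ℝ} (ht : t ∈ Icc 0 T) :
    ContDiff ℝ 3 (f t) := contDiff_slice h.1 ht

lemma SmoothCoercive.contDiff_two (h : SmoothCoercive T f) {t : ℝ} (ht : t ∈ Icc 0 T) :
    ContDiff ℝ 2 (f t) := (h.contDiff ht).of_le (by norm_num)

lemma SmoothCoercive.contDiff_gradient (h : SmoothCoercive T f) {t : ℝ} (ht : t ∈ Icc 0 T) :
    ContDiff ℝ 2 (gradient (f t)) := GradFlow.contDiff_gradient (by norm_num) (h.contDiff ht)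

lemma SmoothCoercive.exists_bound (h : SmoothCoercive T f) :
    ∃ R, ∀ t ∈ Icc 0 T, ∀ x, gradient (f t) x = 0 → ‖x‖ ≤ R := by
  obtain ⟨a₀, c₀, ha₀, hc₀, hco⟩ := h.2
  refine ⟨√(a₀ / c₀), fun t ht x hx => Real.le_sqrt_of_sq_le ?_⟩
  have := hco t ht x
  rw [hx, inner_zero_left] at this
  rw [le_div_iff₀ hc₀]
  linarith

/-- At each time there are countably many critical points. -/
lemma countable_critical (h : SmoothCoercive T f) (hinj : InjOn Prod.fst (degenerateSet T f))
    {t : ℝ} (ht : t ∈ Icc 0 T) : {x | gradient (f t) x = 0}.Countable := by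
  set N : Set (Rn n) := {x | gradient (f t) x = 0 ∧ (hessian (f t) x).det ≠ 0} with hN
  set Z : Set (Rn n) := {x | (t, x) ∈ degenerateSet T f} with hZ
  have hcover : {x | gradient (f t) x = 0} ⊆ N ∪ Z := by
    intro x hx
    by_cases hd : (hessian (f t) x).det = 0
    · exact Or.inr ⟨⟨ht, hx⟩, hd⟩
    · exact Or.inl ⟨hx, hd⟩
  have hZc : Z.Countable := by
    refine Set.Subsingleton.countable fun x hx y hy => ?_
    exact congrArg Prod.snd (hinj hx hy rfl)
  -- Nondegenerate critical points are isolated because the linearization is injective, and a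
  -- discrete subset of `ℝⁿ` is countable.
  have hNc : N.Countable := by
    refine (HereditarilyLindelofSpace.isLindelof N).countable_of_isDiscrete ?_
    rw [isDiscrete_iff_nhdsNE]
    intro x hx
    have hd : HasFDerivAt (gradient (f t)) (fderiv ℝ (gradient (f t)) x) x :=
      ((h.contDiff_gradient ht).differentiable two_ne_zero x).hasFDerivAt
    have hker : LinearMap.ker (fderiv ℝ (gradient (f t)) x).toLinearMap = ⊥ := by
      rw [LinearMap.ker_eq_bot']
      intro v hv
      by_contra hv0
      exact hx.2 ((det_hessian_eq_zero_iff (h.contDiff_two ht) x).2 ⟨v, hv0, hv⟩)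
    obtain ⟨K, -, hK⟩ := LinearMap.exists_antilipschitzWith _ hker
    have := hd.eventually_ne (c := 0) ⟨K, hK⟩
    rw [← disjoint_iff, Filter.disjoint_principal_right]
    filter_upwards [this] with y hy hyN using hy hyN.1
  exact (hNc.union hZc).mono hcover

/-- The local estimates of `IsFold` hold at a degenerate critical point with positive semidefinite
Hessian, one-dimensional kernel and nonzero cubic term. -/
lemma exists_isFold_gradient {g : Rn n → ℝ} (hg : ContDiff ℝ 3 g) {ξ ℓ : Rn n}
    (hξ : gradient g ξ = 0) (hpsd : (hessian g ξ).PosSemidef) (hℓ : SpansKernel g ξ ℓ)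
    (hc : cubicForm g ξ ℓ ≠ 0) :
    ∃ c : ℝ, c ≠ 0 ∧ cubicForm g ξ (c • ℓ) < 0 ∧ fderiv ℝ (gradient g) ξ (c • ℓ) = 0 ∧
      ∃ μ ε r κ, IsFold (gradient g) ξ (c • ℓ) μ ε r κ := by
  have hg2 : ContDiff ℝ 2 g := hg.of_le (by norm_num)
  have hn : 0 < ‖ℓ‖ := norm_pos_iff.2 hℓ.1
  -- Normalization to unit length; the sign points `ℓ` to the side on which the flow leaves `ξ`.
  obtain ⟨c, hcn, hcneg⟩ : ∃ c : ℝ, |c| = ‖ℓ‖⁻¹ ∧ c ^ 3 * cubicForm g ξ ℓ < 0 := by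
    have hinv : 0 < ‖ℓ‖⁻¹ := inv_pos.2 hn
    have hinv3 : 0 < ‖ℓ‖⁻¹ ^ 3 := pow_pos hinv 3
    rcases lt_or_gt_of_ne hc with h | h
    · exact ⟨‖ℓ‖⁻¹, abs_of_pos hinv, mul_neg_of_pos_of_neg hinv3 h⟩
    · refine ⟨-‖ℓ‖⁻¹, by rw [abs_neg, abs_of_pos hinv], ?_⟩
      have : (-‖ℓ‖⁻¹) ^ 3 = -‖ℓ‖⁻¹ ^ 3 := by ring
      rw [this]
      exact mul_neg_of_neg_of_pos (neg_lt_zero.2 hinv3) h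
  have hc0 : c ≠ 0 := by
    rintro rfl
    simp at hcneg
  have hspan : Submodule.span ℝ {c • ℓ} = Submodule.span ℝ {ℓ} :=
    Submodule.span_singleton_smul_eq (IsUnit.mk0 c hc0) ℓ
  have hcub : cubicForm g ξ (c • ℓ) < 0 := by rwa [cubicForm_smul]
  have hker0 : fderiv ℝ (gradient g) ξ (c • ℓ) = 0 := by
    rw [spansKernel_iff hg2 hℓ, ← hspan]
    exact Submodule.mem_span_singleton_self _
  refine ⟨c, hc0, hcub, hker0, ?_⟩
  refine exists_isFold (contDiff_gradient (by norm_num) hg) hξ ?_ (fderiv_gradient_symm hg2 ξ)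
    ((posSemidef_hessian_iff hg2 ξ).1 hpsd) hker0 (fun x hx => ?_) ?_
  · rw [norm_smul, Real.norm_eq_abs, hcn, inv_mul_cancel₀ hn.ne']
  · rw [hspan]
    exact (spansKernel_iff hg2 hℓ x).1 hx
  · rwa [← cubicForm_eq hg]

/-- Gradient trajectories issuing from a degenerate critical point exist and are bounded. -/
lemma exists_orbit {g : Rn n → ℝ} (hg : ContDiff ℝ 3 g) {a₀ c₀ : ℝ} (hc₀ : 0 < c₀) (ha₀ : 0 ≤ a₀)
    (hco : ∀ x, c₀ * ‖x‖ ^ 2 - a₀ ≤ ⟪gradient g x, x⟫) {ξ ℓ : Rn n} {μ ε r κ : ℝ}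
    (hfold : IsFold (gradient g) ξ ℓ μ ε r κ) :
    ∃ w, IsGradientFlow g w ∧ (∃ s, w s ≠ ξ) ∧ Tendsto w atBot (𝓝 ξ) ∧
      ∃ R, ∀ s, 0 ≤ s → ‖w s‖ ≤ R := by
  have hF : ContDiff ℝ 2 (gradient g) := contDiff_gradient (by norm_num) hg
  -- The ball of radius `R` contains the fold neighbourhood, and `c₀ R² > a₀` makes the flow point
  -- inwards on its boundary.
  set R := ‖ξ‖ + r + (a₀ / c₀ + 1) with hR
  have hr := hfold.r_pos
  have hac : 0 ≤ a₀ / c₀ := by positivity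
  have hRpos : 0 < R := by positivity
  have hRco : a₀ < c₀ * R ^ 2 := by
    have h1 : a₀ / c₀ + 1 ≤ R := by rw [hR]; linarith [norm_nonneg ξ]
    have h2 : a₀ / c₀ < R ^ 2 := by nlinarith
    rwa [div_lt_iff₀' hc₀] at h2
  have hsub : Metric.ball ξ r ⊆ Metric.closedBall 0 R := by
    intro x hx
    rw [mem_ball_iff_norm] at hx
    rw [mem_closedBall_zero_iff]
    have h1 := norm_add_le (x - ξ) ξ
    rw [sub_add_cancel] at h1
    rw [hR]
    linarith
  -- The cutoff makes the field bounded and globally Lipschitz. The orbit never leaves the ball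
  -- where `χ = 1`, so it solves the original equation.
  let χ : ContDiffBump (0 : Rn n) := ⟨R, R + 1, hRpos, by linarith⟩
  set G : Rn n → Rn n := fun x => -(χ x • gradient g x) with hG
  have hGc : ContDiff ℝ 1 G := (χ.contDiff.smul (hF.of_le (by norm_num))).neg
  have hGs : HasCompactSupport G := by
    have : HasCompactSupport fun x => χ x • gradient g x := χ.hasCompactSupport.smul_right
    exact this.neg
  obtain ⟨K, hK⟩ := hGc.lipschitzWith_of_hasCompactSupport hGs one_ne_zero
  obtain ⟨M, hM⟩ := hGs.exists_bound_of_continuous hGc.continuous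
  have hGF : ∀ x ∈ Metric.closedBall (0 : Rn n) R, G x = -gradient g x := fun x hx => by
    simp only [hG, χ.one_of_mem_closedBall hx, one_smul]
  obtain ⟨w, hw, hw0, hpast, hlim⟩ := hfold.exists_solution (fun x hx => hGF x (hsub hx)) hK hM
  have hfut : ∀ s, 0 ≤ s → ‖w s‖ ≤ R := by
    intro s hs
    have hd : ∀ t, HasDerivAt (fun t => ‖w t‖ ^ 2) (2 * ⟪w t, G (w t)⟫) t := fun t =>
      (hw t).norm_sq
    have h1 := image_le_of_deriv_right_lt_deriv_boundary (a := 0) (b := s)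
      (f := fun t => ‖w t‖ ^ 2) (f' := fun t => 2 * ⟪w t, G (w t)⟫) (B := fun _ => R ^ 2)
      (B' := fun _ => 0)
      (fun t _ => (hd t).continuousAt.continuousWithinAt) (fun t _ => (hd t).hasDerivWithinAt)
      (by
        have := mem_closedBall_zero_iff.1 (hsub (hpast 0 le_rfl))
        gcongr)
      (fun t => hasDerivAt_const t _) (fun t _ ht => by
        have h2 : ‖w t‖ = R := by
          rwa [sq_eq_sq₀ (norm_nonneg _) hRpos.le] at ht
        rw [hGF _ (mem_closedBall_zero_iff.2 h2.le), inner_neg_right, real_inner_comm]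
        have h3 := hco (w t)
        rw [h2] at h3
        linarith) (right_mem_Icc.2 hs)
    exact (sq_le_sq₀ (norm_nonneg _) hRpos.le).1 h1
  refine ⟨w, fun s => ?_, ⟨0, hw0⟩, hlim, R, hfut⟩
  have h1 := hw s
  rw [hGF] at h1
  · exact h1
  · rcases le_total s 0 with h | h
    · exact hsub (hpast s h)
    · exact mem_closedBall_zero_iff.2 (hfut s h)

/-- The orbits issuing from a degenerate critical point are unique up to a time translation. -/
lemma orbit_unique {g : Rn n → ℝ} (hg : ContDiff ℝ 3 g) {ξ ℓ : Rn n}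
    (hξ : gradient g ξ = 0) (hpsd : (hessian g ξ).PosSemidef) (hℓ : SpansKernel g ξ ℓ)
    (hc : cubicForm g ξ ℓ ≠ 0) {w₁ w₂ : ℝ → Rn n}
    (h₁ : IsGradientFlow g w₁) (hne₁ : ∃ s, w₁ s ≠ ξ) (hlim₁ : Tendsto w₁ atBot (𝓝 ξ))
    (h₂ : IsGradientFlow g w₂) (hne₂ : ∃ s, w₂ s ≠ ξ) (hlim₂ : Tendsto w₂ atBot (𝓝 ξ)) :
    ∃ c, ∀ s, w₁ s = w₂ (s + c) := by
  obtain ⟨c, -, -, -, μ, ε, r, κ, hfold⟩ := exists_isFold_gradient hg hξ hpsd hℓ hc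
  exact hfold.unique (contDiff_gradient (by norm_num) hg) h₁ hne₁ hlim₁ h₂ hne₂ hlim₂

/-- If critical points accumulate from the left at a degenerate critical point, then the two
transversality coefficients have the same sign. -/
lemma mixedForm_mul_cubicForm_pos (hT : 0 < T) (h : SmoothCoercive T f) {τ : ℝ}
    (hτ : τ ∈ Ioo 0 T) {ξ ℓ : Rn n} (hξ : gradient (f τ) ξ = 0)
    (hpsd : (hessian (f τ) ξ).PosSemidef) (hℓ : SpansKernel (f τ) ξ ℓ)
    (hm : mixedForm T f τ ξ ℓ ≠ 0) (hc : cubicForm (f τ) ξ ℓ ≠ 0) {u : ℝ → Rn n}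
    (hu : Tendsto u (𝓝[<] τ) (𝓝 ξ)) (hzero : ∀ᶠ t in 𝓝[<] τ, gradient (f t) (u t) = 0) :
    0 < mixedForm T f τ ξ ℓ * cubicForm (f τ) ξ ℓ := by
  have hτ' := Ioo_subset_Icc_self hτ
  have hg := h.contDiff hτ'
  obtain ⟨c, hc0, hcub, hker, μ, ε, r, κ, hfold⟩ := exists_isFold_gradient hg hξ hpsd hℓ hc
  have hF := contDiffOn_gradient hT h.1
  have hnhds : (Icc 0 T ×ˢ univ : Set (ℝ × Rn n)) ∈ 𝓝 (τ, ξ) :=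
    prod_mem_nhds (Icc_mem_nhds hτ.1 hτ.2) univ_mem
  have hstrict := (hF.contDiffAt hnhds).hasStrictFDerivAt two_ne_zero
  set D := fderiv ℝ (Function.uncurry fun t => gradient (f t)) (τ, ξ) with hD
  have hDslice : ∀ v, D (0, v) = fderiv ℝ (gradient (f τ)) ξ v := fun v => by
    rw [(fderiv_slice (G := fun t => gradient (f t)) two_ne_zero hF hτ' ξ).2,
      fderivWithin_of_mem_nhds hnhds]
    simp [hD]
  have hle := hfold.timeDeriv_nonpos (F := fun t => gradient (f t)) hstrict (fun v => by
    rw [hDslice, ← fderiv_gradient_symm (h.contDiff_two hτ'), hker, inner_zero_left]) hu hzero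
  rw [← mixedForm_eq h.1 hτ ξ (c • ℓ) hstrict.hasFDerivAt, mixedForm_smul] at hle
  have hneg : c * mixedForm T f τ ξ ℓ < 0 := lt_of_le_of_ne hle (mul_ne_zero hc0 hm)
  rw [cubicForm_smul] at hcub
  -- For the oriented kernel vector both coefficients are negative; going back to `ℓ` divides their
  -- product by `c ^ 4 > 0`.
  have h4 := mul_pos_of_neg_of_neg hneg hcub
  have h5 : c * mixedForm T f τ ξ ℓ * (c ^ 3 * cubicForm (f τ) ξ ℓ) =
      c ^ 4 * (mixedForm T f τ ξ ℓ * cubicForm (f τ) ξ ℓ) := by ring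
  rw [h5] at h4
  exact pos_of_mul_pos_right h4 (by positivity)

end Critical

/-! ### Assembling and comparing evolutions. -/

section Evolution

open scoped RealInnerProductSpace

variable {T : ℝ} {f : ℝ → Rn n → ℝ}

/-- `w` is a heteroclinic orbit at the time `b` from the degenerate critical point `ξ` to `y`. -/
structure IsJump (T : ℝ) (f : ℝ → Rn n → ℝ) (b : ℝ) (ξ : Rn n) (w : ℝ → Rn n) (y : Rn n) :
    Prop where
  degenerate : (b, ξ) ∈ degenerateSet T f
  posSemidef : (hessian (f b) ξ).PosSemidef
  sameSign : ∃ ℓ, SpansKernel (f b) ξ ℓ ∧ 0 < mixedForm T f b ξ ℓ * cubicForm (f b) ξ ℓ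
  flow : IsGradientFlow (f b) w
  atBot : Tendsto w atBot (𝓝 ξ)
  atTop : Tendsto w atTop (𝓝 y)

/-- Evolutions starting from the point `y₀` at the time `a`. -/
structure IsEvolutionFrom (T : ℝ) (f : ℝ → Rn n → ℝ) (a : ℝ) (y₀ : Rn n)
    (k : ℕ) (t : ℕ → ℝ) (u : ℕ → ℝ → Rn n) (x : ℕ → Rn n) (v : ℕ → ℝ → Rn n) : Prop where
  pos : 0 < k
  t_zero : t 0 = a
  t_last : t k = T
  t_lt : ∀ i < k, t i < t (i + 1)
  u_init : u 0 a = y₀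
  branch : ∀ i < k, IsBranch (fun s => gradient (f s)) (t i) (t (i + 1)) (u i)
  limit : ∀ i < k, Tendsto (u i) (𝓝[<] t (i + 1)) (𝓝 (x i))
  jump : ∀ i, i + 1 < k → IsJump T f (t (i + 1)) (x i) (v i) (u (i + 1) (t (i + 1)))

lemma le_of_forall_lt_succ {k : ℕ} {t : ℕ → ℝ} (h : ∀ i < k, t i < t (i + 1)) {i j : ℕ}
    (hij : i ≤ j) (hj : j ≤ k) : t i ≤ t j := by
  induction j, hij using Nat.le_induction with
  | base => exact le_rfl
  | succ j _ ih => exact (ih (by omega)).trans (h j (by omega)).le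

/-- The C² regularity of branches and orbits follows from their equations, so continuous branches
suffice. -/
lemma isEvolution_iff (hT : 0 < T) (h : SmoothCoercive T f) {y₀ : Rn n} {k : ℕ} {t : ℕ → ℝ}
    {u : ℕ → ℝ → Rn n} {x : ℕ → Rn n} {v : ℕ → ℝ → Rn n} :
    IsEvolution T f y₀ k t u x v ↔ IsEvolutionFrom T f 0 y₀ k t u x v := by
  constructor
  · intro e
    refine ⟨e.pos, e.t_zero, e.t_last, e.t_lt, e.u_init,
      fun i hi => ⟨(e.u_contDiff i hi).continuousOn, e.u_critical i hi, fun s hs => ?_⟩,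
      e.u_limit, fun i hi => ⟨e.x_degenerate i hi, e.x_posSemidef i hi, e.x_sameSign i hi,
        e.v_flow i hi, e.v_atBot i hi, e.v_atTop i hi⟩⟩
    have h0 := le_of_forall_lt_succ e.t_lt i.zero_le hi.le
    have h1 := le_of_forall_lt_succ e.t_lt (Nat.succ_le_of_lt hi) le_rfl
    rw [e.t_zero] at h0
    rw [e.t_last] at h1
    exact (posDef_hessian_iff (h.contDiff_two ⟨h0.trans hs.1, hs.2.le.trans h1⟩) _).1
      (e.u_posDef i hi s hs)
  · intro e
    have h0 : ∀ i ≤ k, 0 ≤ t i := fun i hi => by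
      rw [← e.t_zero]
      exact le_of_forall_lt_succ e.t_lt i.zero_le hi
    have h1 : ∀ i ≤ k, t i ≤ T := fun i hi => by
      rw [← e.t_last]
      exact le_of_forall_lt_succ e.t_lt hi le_rfl
    refine ⟨e.pos, e.t_zero, e.t_last, e.t_lt, fun i hi => ?_, fun i hi => ?_, e.u_init,
      fun i hi => (e.branch i hi).zero, fun i hi s hs => ?_, e.limit,
      fun i hi => (e.jump i hi).degenerate, fun i hi => (e.jump i hi).posSemidef,
      fun i hi => (e.jump i hi).sameSign, fun i hi => (e.jump i hi).flow,
      fun i hi => (e.jump i hi).atBot, fun i hi => (e.jump i hi).atTop⟩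
    · exact (e.branch i hi).contDiffOn hT (contDiffOn_gradient hT h.1) (h0 i hi.le) (h1 _ hi)
    · have ht : t (i + 1) ∈ Icc 0 T := ⟨h0 _ hi.le, h1 _ hi.le⟩
      have hw : IsSolution (fun x => -gradient (f (t (i + 1))) x) (v i) := (e.jump i hi).flow
      exact hw.contDiff_two ((h.contDiff_gradient ht).of_le (by norm_num)).neg
    · have ht : s ∈ Icc 0 T := ⟨(h0 i hi.le).trans hs.1, hs.2.le.trans (h1 _ hi)⟩
      exact (posDef_hessian_iff (h.contDiff_two ht) _).2 ((e.branch i hi).pos s hs)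

/-- From a nondegenerate minimum, the evolution follows a branch of critical points until the final
time or until a degenerate critical point, from which it jumps to a nondegenerate minimum. -/
lemma exists_branch_and_jump (hT : 0 < T) (h₁ : SmoothCoercive T f) (h₂ : FinitelyDegenerate T f)
    (h₃ : Transversal T f) (h₄ : HeteroclinicEndsNondegenerate T f) {a : ℝ} (ha : a ∈ Ico 0 T)
    {y₀ : Rn n} (hy₀ : gradient (f a) y₀ = 0) (hpos : (hessian (f a) y₀).PosDef) :
    ∃ b u ξ, a < b ∧ b ≤ T ∧ u a = y₀ ∧ IsBranch (fun s => gradient (f s)) a b u ∧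
      Tendsto u (𝓝[<] b) (𝓝 ξ) ∧ (b < T → ∃ w y, IsJump T f b ξ w y ∧
        gradient (f b) y = 0 ∧ (hessian (f b) y).PosDef) := by
  obtain ⟨R, hR⟩ := h₁.exists_bound
  have hcount := fun t (ht : t ∈ Icc 0 T) => countable_critical h₁ h₂.2.1 ht
  obtain ⟨b, u, ξ, hab, hbT, hua, hbr, hlim, hξ, hpsd, hdeg⟩ :=
    exists_maximal_branch hT (contDiffOn_gradient hT h₁.1) hR hcount ha hy₀
      ((posDef_hessian_iff (h₁.contDiff_two ⟨ha.1, ha.2.le⟩) y₀).1 hpos)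
  refine ⟨b, u, ξ, hab, hbT, hua, hbr, hlim, fun hbT' => ?_⟩
  have hb0 : 0 < b := ha.1.trans_lt hab
  have hb : b ∈ Icc 0 T := ⟨hb0.le, hbT⟩
  have hg2 := h₁.contDiff_two hb
  have hPSD : (hessian (f b) ξ).PosSemidef := (posSemidef_hessian_iff hg2 ξ).2 hpsd
  have hmem : (b, ξ) ∈ degenerateSet T f := by
    refine ⟨⟨hb, hξ⟩, ?_⟩
    -- A positive semidefinite matrix with nonzero determinant is positive definite, which would
    -- contradict maximality of the branch.
    by_contra hdet
    exact hdeg hbT' ((posDef_hessian_iff hg2 ξ).1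
      (hPSD.posDef_iff_det_ne_zero.2 hdet))
  obtain ⟨ℓ, hℓ, hm, hc⟩ := h₃ b ξ hmem hPSD
  have hsign := mixedForm_mul_cubicForm_pos hT h₁ ⟨hb0, hbT'⟩ hξ hPSD hℓ hm hc hlim (by
    filter_upwards [Ioo_mem_nhdsLT hab] with s hs using hbr.zero s ⟨hs.1.le, hs.2⟩)
  obtain ⟨a₀, c₀, ha₀, hc₀, hco⟩ := h₁.2
  obtain ⟨_, -, -, -, μ, ε, r, κ, hfold⟩ := exists_isFold_gradient (h₁.contDiff hb) hξ hPSD hℓ hc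
  obtain ⟨w, hw, hne, hbot, R', hR'⟩ := exists_orbit (h₁.contDiff hb) hc₀ ha₀ (hco b hb) hfold
  have hws : IsSolution (fun x => -gradient (f b) x) w := hw
  obtain ⟨y, hy, htop⟩ := hws.exists_tendsto_atTop (hg2.differentiable two_ne_zero)
    ((h₁.contDiff_gradient hb).of_le (by norm_num)) (hcount b hb) hR'
  exact ⟨w, y, ⟨hmem, hPSD, ⟨ℓ, hℓ, hsign⟩, hw, hbot, htop⟩, hy,
    h₄ b ξ hmem hPSD ⟨ℓ, hℓ, hc⟩ w y hw hne hbot htop⟩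

/-- The terminal case: the branch reaches `T`, so there is no jump and the orbits are dummies. -/
lemma isEvolutionFrom_one {a : ℝ} {y₀ ξ : Rn n} {u : ℝ → Rn n} (haT : a < T) (hu : u a = y₀)
    (hbr : IsBranch (fun s => gradient (f s)) a T u) (hlim : Tendsto u (𝓝[<] T) (𝓝 ξ)) :
    IsEvolutionFrom T f a y₀ 1 (fun i => Nat.casesOn i a fun _ => T) (fun _ => u) (fun _ => ξ)
      (fun _ _ => 0) := by
  refine ⟨one_pos, rfl, rfl, fun i hi => ?_, hu, fun i hi => ?_, fun i hi => ?_,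
    fun i hi => by omega⟩ <;> obtain rfl : i = 0 := by omega
  exacts [haT, hbr, hlim]

lemma IsEvolutionFrom.cons {a b : ℝ} {y₀ ξ y : Rn n} {u : ℝ → Rn n} {w : ℝ → Rn n} (hab : a < b)
    (hu : u a = y₀) (hbr : IsBranch (fun s => gradient (f s)) a b u)
    (hlim : Tendsto u (𝓝[<] b) (𝓝 ξ)) (hw : IsJump T f b ξ w y) {k : ℕ} {t' : ℕ → ℝ}
    {u' : ℕ → ℝ → Rn n} {x' : ℕ → Rn n} {v' : ℕ → ℝ → Rn n}
    (h : IsEvolutionFrom T f b y k t' u' x' v') :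
    IsEvolutionFrom T f a y₀ (k + 1) (fun i => Nat.casesOn i a t') (fun i => Nat.casesOn i u u')
      (fun i => Nat.casesOn i ξ x') (fun i => Nat.casesOn i w v') := by
  refine ⟨k.succ_pos, rfl, h.t_last, ?_, hu, ?_, ?_, ?_⟩
  · rintro (_ | i) hi
    · exact hab.trans_eq h.t_zero.symm
    · exact h.t_lt i (by omega)
  · rintro (_ | i) hi
    · change IsBranch _ a (t' 0) u
      rwa [h.t_zero]
    · exact h.branch i (by omega)
  · rintro (_ | i) hi
    · change Tendsto u (𝓝[<] t' 0) (𝓝 ξ)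
      rwa [h.t_zero]
    · exact h.limit i (by omega)
  · rintro (_ | i) hi
    · change IsJump T f (t' 0) ξ w (u' 0 (t' 0))
      rwa [h.t_zero, h.u_init]
    · exact h.jump i (by omega)

/-- Strong induction on the number of degenerate points at times after `a`: a jump at `b > a`
removes at least the point it starts from. -/
theorem exists_isEvolutionFrom (hT : 0 < T) (h₁ : SmoothCoercive T f)
    (h₂ : FinitelyDegenerate T f) (h₃ : Transversal T f)
    (h₄ : HeteroclinicEndsNondegenerate T f) {a : ℝ} (ha : a ∈ Ico 0 T) {y₀ : Rn n}
    (hy₀ : gradient (f a) y₀ = 0) (hpos : (hessian (f a) y₀).PosDef) :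
    ∃ k t u x v, IsEvolutionFrom T f a y₀ k t u x v := by
  induction hN : {p ∈ degenerateSet T f | a < p.1}.ncard using Nat.strong_induction_on
    generalizing a y₀ with
  | _ N ih =>
    obtain ⟨b, u, ξ, hab, hbT, hu, hbr, hlim, hjump⟩ :=
      exists_branch_and_jump hT h₁ h₂ h₃ h₄ ha hy₀ hpos
    rcases hbT.eq_or_lt with rfl | hbT'
    · exact ⟨_, _, _, _, _, isEvolutionFrom_one hab hu hbr hlim⟩
    · obtain ⟨w, y, hw, hy, hyd⟩ := hjump hbT'
      have hlt : {p ∈ degenerateSet T f | b < p.1}.ncard < N := by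
        rw [← hN]
        refine Set.ncard_lt_ncard ⟨fun p hp => ⟨hp.1, hab.trans hp.2⟩, fun hsub => ?_⟩
          (h₂.1.subset (sep_subset _ _))
        exact lt_irrefl b (hsub (a := (b, ξ)) ⟨hw.degenerate, hab⟩).2
      obtain ⟨k, t', u', x', v', h⟩ := ih _ hlt ⟨ha.1.trans hab.le, hbT'⟩ hy hyd rfl
      exact ⟨_, _, _, _, _, h.cons hab hu hbr hlim hw⟩

variable {a a' : ℝ} {y₀ y₀' : Rn n} {k k' : ℕ} {t t' : ℕ → ℝ} {u u' : ℕ → ℝ → Rn n}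
  {x x' : ℕ → Rn n} {v v' : ℕ → ℝ → Rn n}

lemma IsEvolutionFrom.mem_Icc (h : IsEvolutionFrom T f a y₀ k t u x v) (ha : 0 ≤ a) {i : ℕ}
    (hi : i ≤ k) : t i ∈ Icc 0 T := by
  constructor
  · exact (ha.trans_eq h.t_zero.symm).trans (le_of_forall_lt_succ h.t_lt i.zero_le hi)
  · exact (le_of_forall_lt_succ h.t_lt hi le_rfl).trans_eq h.t_last

/-- A branch cannot be continued beyond the next jump time. -/
lemma IsEvolutionFrom.time_succ_le (hT : 0 < T) (h₁ : SmoothCoercive T f) (ha : 0 ≤ a)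
    (ha' : 0 ≤ a') (h : IsEvolutionFrom T f a y₀ k t u x v)
    (h' : IsEvolutionFrom T f a' y₀' k' t' u' x' v') {i : ℕ} (hi : i < k) (hi' : i < k')
    (ht : t' i = t i) (hu : u' i (t i) = u i (t i)) : t' (i + 1) ≤ t (i + 1) := by
  by_contra! hlt
  have hik : i + 1 < k := by
    by_contra hk
    obtain rfl : k = i + 1 := by omega
    rw [h.t_last] at hlt
    exact hlt.not_ge (h'.mem_Icc ha' hi').2
  have hb := h'.branch i hi'
  rw [ht] at hb
  have hmem : t (i + 1) ∈ Ico (t i) (t' (i + 1)) := ⟨(h.t_lt i hi).le, hlt⟩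
  have heq : EqOn (u' i) (u i) (Ico (t i) (t (i + 1))) :=
    (hb.mono hlt.le).eqOn hT (contDiffOn_gradient hT h₁.1) (h.mem_Icc ha hi.le).1
      (h.mem_Icc ha hi).2 (h.branch i hi) hu
  have hl' : Tendsto (u' i) (𝓝[<] t (i + 1)) (𝓝 (u' i (t (i + 1)))) := by
    refine (hb.continuousOn _ hmem).mono_left ?_
    rw [← nhdsWithin_Ico_eq_nhdsLT (h.t_lt i hi)]
    exact nhdsWithin_mono _ (Ico_subset_Ico_right hlt.le)
  have hl : Tendsto (u' i) (𝓝[<] t (i + 1)) (𝓝 (x i)) := by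
    refine (h.limit i hi).congr' ?_
    filter_upwards [Ioo_mem_nhdsLT (h.t_lt i hi)] with s hs using (heq ⟨hs.1.le, hs.2⟩).symm
  have hpos := hb.pos _ hmem
  -- The longer branch passes through `x i` with positive definite linearization, whereas a jump
  -- starts at a degenerate point.
  rw [tendsto_nhds_unique hl' hl] at hpos
  obtain ⟨z, hz, hz0⟩ := (det_hessian_eq_zero_iff (h₁.contDiff_two (h.mem_Icc ha hi)) _).1
    (h.jump i hik).degenerate.2
  exact hz (hpos.injective (hz0.trans (map_zero _).symm))

/-- Uniqueness of orbits holds only among nonstationary ones; a stationary orbit would end at the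
degenerate point itself. -/
lemma IsJump.exists_ne {b : ℝ} {ξ y : Rn n} {w : ℝ → Rn n} (h : IsJump T f b ξ w y)
    (hy : (hessian (f b) y).PosDef) : ∃ s, w s ≠ ξ := by
  by_contra! hw
  have hξy : ξ = y := tendsto_nhds_unique
    (tendsto_const_nhds.congr fun s => (hw s).symm) h.atTop
  rw [← hξy] at hy
  exact hy.det_pos.ne' h.degenerate.2

/-- Jumps from a given degenerate critical point to nondegenerate minima are unique up to a time
translation. -/
lemma IsJump.unique (h₁ : SmoothCoercive T f) {b : ℝ} {ξ y y' : Rn n} {w w' : ℝ → Rn n}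
    (h : IsJump T f b ξ w y) (h' : IsJump T f b ξ w' y') (hy : (hessian (f b) y).PosDef)
    (hy' : (hessian (f b) y').PosDef) : (∃ c, ∀ s, w' s = w (s + c)) ∧ y' = y := by
  obtain ⟨ℓ, hℓ, hp⟩ := h.sameSign
  obtain ⟨c, hc⟩ := orbit_unique (h₁.contDiff h.degenerate.1.1) h.degenerate.1.2 h.posSemidef hℓ
    (right_ne_zero_of_mul hp.ne') h'.flow (h'.exists_ne hy') h'.atBot h.flow (h.exists_ne hy)
    h.atBot
  refine ⟨⟨c, hc⟩, tendsto_nhds_unique h'.atTop ?_⟩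
  exact (h.atTop.comp (tendsto_atTop_add_const_right _ c tendsto_id)).congr fun s => (hc s).symm

/-- Two evolutions which agree at the beginning of a branch agree up to the beginning of the next
one. -/
lemma IsEvolutionFrom.branch_unique (hT : 0 < T) (h₁ : SmoothCoercive T f) (ha : 0 ≤ a)
    (ha' : 0 ≤ a') (h : IsEvolutionFrom T f a y₀ k t u x v)
    (h' : IsEvolutionFrom T f a' y₀' k' t' u' x' v') {i : ℕ} (hi : i < k) (hi' : i < k')
    (ht : t' i = t i) (hu : u' i (t i) = u i (t i)) :
    t' (i + 1) = t (i + 1) ∧ EqOn (u' i) (u i) (Ico (t i) (t (i + 1))) ∧ x' i = x i ∧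
      (i + 1 < k → i + 1 < k' ∧ (∃ c, ∀ s, v' i s = v i (s + c)) ∧
        u' (i + 1) (t (i + 1)) = u (i + 1) (t (i + 1))) := by
  have htt : t' (i + 1) = t (i + 1) :=
    (h.time_succ_le hT h₁ ha ha' h' hi hi' ht hu).antisymm
      (h'.time_succ_le hT h₁ ha' ha h hi' hi ht.symm (by rw [ht, hu]))
  have hb := h'.branch i hi'
  rw [ht, htt] at hb
  have heq : EqOn (u' i) (u i) (Ico (t i) (t (i + 1))) :=
    hb.eqOn hT (contDiffOn_gradient hT h₁.1) (h.mem_Icc ha hi.le).1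
      (h.mem_Icc ha hi).2 (h.branch i hi) hu
  have hl' := h'.limit i hi'
  rw [htt] at hl'
  have hx : x' i = x i := by
    refine tendsto_nhds_unique hl' ((h.limit i hi).congr' ?_)
    filter_upwards [Ioo_mem_nhdsLT (h.t_lt i hi)] with s hs using (heq ⟨hs.1.le, hs.2⟩).symm
  refine ⟨htt, heq, hx, fun hk => ?_⟩
  -- If the second evolution stopped here, this time would be `T`, leaving no room for the next
  -- branch of the first.
  have hk' : i + 1 < k' := by
    by_contra hk'
    obtain rfl : k' = i + 1 := by omega
    have h1 := h.t_lt _ hk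
    rw [← htt, h'.t_last] at h1
    exact h1.not_ge (h.mem_Icc ha hk).2
  have hj' := h'.jump i hk'
  rw [htt, hx] at hj'
  have hg := h₁.contDiff_two (h.mem_Icc ha hi)
  have hpos := (h.branch _ hk).pos _ (left_mem_Ico.2 (h.t_lt _ hk))
  have hpos' := (h'.branch _ hk').pos _ (left_mem_Ico.2 (h'.t_lt _ hk'))
  rw [htt] at hpos'
  exact ⟨hk', (h.jump i hk).unique h₁ hj' ((posDef_hessian_iff hg _).2 hpos)
    ((posDef_hessian_iff hg _).2 hpos')⟩

/-- Agreement at the start of one branch propagates to the start of the next through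
`branch_unique`. -/
theorem IsEvolutionFrom.unique (hT : 0 < T) (h₁ : SmoothCoercive T f) (ha : 0 ≤ a)
    (h : IsEvolutionFrom T f a y₀ k t u x v) (h' : IsEvolutionFrom T f a y₀ k' t' u' x' v') :
    k' = k ∧ (∀ i ≤ k, t' i = t i) ∧ (∀ i < k, EqOn (u' i) (u i) (Ico (t i) (t (i + 1)))) ∧
      (∀ i < k, x' i = x i) ∧ ∀ i, i + 1 < k → ∃ c : ℝ, ∀ s, v' i s = v i (s + c) := by
  have hstart : ∀ i < k, i < k' ∧ t' i = t i ∧ u' i (t i) = u i (t i) := by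
    intro i
    induction i with
    | zero =>
      refine fun _ => ⟨h'.pos, h'.t_zero.trans h.t_zero.symm, ?_⟩
      rw [h.t_zero, h.u_init, h'.u_init]
    | succ i ih =>
      intro hi
      obtain ⟨h1, h2, h3⟩ := ih (by omega)
      obtain ⟨h4, -, -, h5⟩ := h.branch_unique hT h₁ ha ha h' (by omega) h1 h2 h3
      exact ⟨(h5 hi).1, h4, (h5 hi).2.2⟩
  have hstep := fun i (hi : i < k) => h.branch_unique hT h₁ ha ha h' hi (hstart i hi).1
    (hstart i hi).2.1 (hstart i hi).2.2
  have ht : ∀ i ≤ k, t' i = t i := by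
    rintro (_ | i) hi
    · exact h'.t_zero.trans h.t_zero.symm
    · exact (hstep i hi).1
  refine ⟨?_, ht, fun i hi => (hstep i hi).2.1, fun i hi => (hstep i hi).2.2.1,
    fun i hi => ((hstep i (by omega)).2.2.2 hi).2.1⟩
  have hpos := h.pos
  -- This gives `k ≤ k'`. A strict inequality would put `t' (k + 1)` beyond `t' k = T`.
  have hle := (hstart (k - 1) (by omega)).1
  by_contra hne
  have hlt : k < k' := by omega
  have h1 := h'.t_lt k hlt
  rw [ht k le_rfl, h.t_last] at h1
  exact h1.not_ge (h'.mem_Icc ha hlt).2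

end Evolution

end GradFlow

end

theorem mainTheorem3 (n : ℕ) (T : ℝ) (hT : 0 < T) (f : ℝ → GradFlow.Rn n → ℝ)
    (h₁ : GradFlow.SmoothCoercive T f)
    (h₂ : GradFlow.FinitelyDegenerate T f)
    (h₃ : GradFlow.Transversal T f)
    (h₄ : GradFlow.HeteroclinicEndsNondegenerate T f)
    (y₀ : GradFlow.Rn n) (hy₀ : gradient (f 0) y₀ = 0)
    (hy₀' : (GradFlow.hessian (f 0) y₀).PosDef) :
    ∃ (k : ℕ) (t : ℕ → ℝ) (u : ℕ → ℝ → GradFlow.Rn n) (x : ℕ → GradFlow.Rn n)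
      (v : ℕ → ℝ → GradFlow.Rn n),
      GradFlow.IsEvolution T f y₀ k t u x v ∧
      ∀ (k' : ℕ) (t' : ℕ → ℝ) (u' : ℕ → ℝ → GradFlow.Rn n) (x' : ℕ → GradFlow.Rn n)
        (v' : ℕ → ℝ → GradFlow.Rn n),
        GradFlow.IsEvolution T f y₀ k' t' u' x' v' →
        k' = k ∧
        (∀ i ≤ k, t' i = t i) ∧
        (∀ i < k, Set.EqOn (u' i) (u i) (Set.Ico (t i) (t (i + 1)))) ∧
        (∀ i < k, x' i = x i) ∧
        (∀ i, i + 1 < k → ∃ c : ℝ, ∀ s, v' i s = v i (s + c)) := by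
  obtain ⟨k, t, u, x, v, h⟩ :=
    GradFlow.exists_isEvolutionFrom hT h₁ h₂ h₃ h₄ (left_mem_Ico.2 hT) hy₀ hy₀'
  exact ⟨k, t, u, x, v, (GradFlow.isEvolution_iff hT h₁).2 h, fun k' t' u' x' v' h' =>
    h.unique hT h₁ le_rfl ((GradFlow.isEvolution_iff hT h₁).1 h')⟩
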